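/- Let $k$ be an algebraically closed field of characteristic $0$ and $Q$ a finite quiver without oriented cycles. For a dimension vector $\alpha$ let $\operatorname{Rep}_\alpha(Q)=\bigoplus_{a}\operatorname{Hom}(k^{\alpha(ta)},k^{\alpha(ha)})$ (with its Zariski topology), on which $\operatorname{GL}_\alpha=\prod_v\operatorname{GL}_{\alpha(v)}$ acts by base change; write $\langle\cdot,\cdot\rangle$ for the Euler form, $\hom_Q=\dim\operatorname{Hom}_Q$, $\operatorname{ext}_Q=\dim\operatorname{Ext}_Q$. A dimension vector, or an irreducible subset, as an argument of $\hom_Q$ or $\operatorname{ext}_Q$ stands for a general representation of that dimension vector, resp. in that subset. Let $E$ be an exceptional representation of $Q$ (that is, $\operatorname{Hom}_Q(E,E)=k$ and $\operatorname{Ext}_Q(E,E)=0$) of dimension vector $\epsilon$. Let $E^\perp$ be the category of finite-dimensional representations $N$ with $\operatorname{Hom}_Q(E,N)=\operatorname{Ext}_Q(E,N)=0$, and let $\tilde\pi_E$ be the left adjoint of the inclusion of $E^\perp$ into the category of all finite-dimensional representations. A representation $M$ of dimension vector $\alpha$ is $E$-regular if $\tilde\pi_E(M)$ has dimension vector $\alpha-\langle\epsilon,\alpha\rangle\epsilon$.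 Let $$\mathcal E_\alpha=\{M\in\operatorname{Rep}_\alpha(Q)\mid M\text{ is }E\text{-regular and }M\notin E^\perp\}.$$ Write $E\perp\alpha$ if some $M\in\operatorname{Rep}_\alpha(Q)$ lies in $E^\perp$; $E$ is left exceptional to $\alpha$ if moreover $\mathcal E_\alpha\neq\emptyset$. When $\langle\alpha,\beta\rangle=0$, a dimension vector $\gamma$ is a fundamental rank for $(\alpha,\beta)$ if there is an irreducible component $C_0$ of $\{(M,N)\in\operatorname{Rep}_\alpha(Q)\times\operatorname{Rep}_\beta(Q)\mid\hom_Q(M,N)>0\}$ such that, for general $(M,N)\in C_0$, a general homomorphism $M\to N$ has rank $\gamma$. Finally, let $\operatorname{Rep}_{\gamma\hookrightarrow\alpha}(Q)$ (resp. $\operatorname{Rep}_{\alpha\twoheadrightarrow\gamma}(Q)$) be the set of $M\in\operatorname{Rep}_\alpha(Q)$ that have a $\gamma$-dimensional subrepresentation (resp. quotient representation). Suppose $E\perp\alpha$. Then the following are equivalent: 1. $E$ is left exceptional to $\alpha$; 2. $\epsilon$ is a fundamental rank for $(\epsilon,\alpha)$; 3. $\epsilon\le\alpha$ and $\operatorname{ext}_Q(\epsilon,\alpha-\epsilon)=1$;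 4. $\epsilon\le\alpha$ and $\hom_Q(\epsilon,\alpha-\epsilon)=0$. In this case $\mathcal E_\alpha$ is irreducible and $\hom_Q(E,\mathcal E_\alpha)=1$. Moreover, $\overline{\mathcal E_\alpha}=\operatorname{Rep}_{\epsilon\hookrightarrow\alpha}(Q)$ and $\overline{\operatorname{GL}_\alpha\cdot\tilde\pi_E(\mathcal E_\alpha)}=\operatorname{Rep}_{\alpha\twoheadrightarrow\epsilon}(Q)$. -/

import Mathlib

open Topology

namespace QuiverRep

section Zariski

variable (k : Type*) [Field k] (V : Type*) [AddCommGroup V] [Module k V]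

/-- The algebra of polynomial functions on a vector space: the algebra of functions generated by
the linear forms. -/
def polyFun : Subalgebra k (V → k) :=
  Algebra.adjoin k (Set.range fun l : Module.Dual k V => (l : V → k))

/-- The Zariski topology on (the points of) a finite-dimensional vector space, viewed as an affine
space: the closed sets are the common zero loci of sets of polynomial functions. -/
@[reducible]
def zariski : TopologicalSpace V :=
  TopologicalSpace.ofClosed
    {Z | ∃ S : Set (V → k), S ⊆ (polyFun k V : Set (V → k)) ∧ Z = {x | ∀ p ∈ S, p x = 0}}
    ⟨{1}, by simp [(polyFun k V).one_mem], by ext x; simp⟩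
    (by
      intro A hA
      refine ⟨{p | p ∈ polyFun k V ∧ ∃ Z ∈ A, ∀ x ∈ Z, p x = 0}, fun p hp => hp.1, ?_⟩
      ext x
      constructor
      · rintro hx p ⟨-, Z, hZ, hp⟩
        exact hp x (hx Z hZ)
      · intro hx Z hZ
        obtain ⟨S, hS, rfl⟩ := hA hZ
        intro p hp
        exact hx p ⟨hS hp, _, hZ, fun y hy => hy p hp⟩)
    (by
      rintro _ ⟨S, hS, rfl⟩ _ ⟨T, hT, rfl⟩
      refine ⟨{r | ∃ p ∈ S, ∃ q ∈ T, r = p * q}, ?_, ?_⟩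
      · rintro _ ⟨p, hp, q, hq, rfl⟩
        exact (polyFun k V).mul_mem (hS hp) (hT hq)
      · ext x
        constructor
        · rintro (hx | hx) _ ⟨p, hp, q, hq, rfl⟩
          · simp [hx p hp]
          · simp [hx q hq]
        · intro hx
          by_contra hcon
          simp only [Set.mem_union, Set.mem_ofPred_eq, not_or, not_forall] at hcon
          obtain ⟨⟨p, hp, hpx⟩, q, hq, hqx⟩ := hcon
          exact mul_ne_zero hpx hqx (hx _ ⟨p, hp, q, hq, rfl⟩))

variable {V}

/-- `P` holds for a general point of the (irreducible) set `S`: it holds on a non-empty relatively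
Zariski open subset of `S`. -/
def Generically (S : Set V) (P : V → Prop) : Prop :=
  ∃ U : Set V, IsOpen[zariski k V] U ∧ (S ∩ U).Nonempty ∧ ∀ x ∈ S ∩ U, P x

end Zariski

/-- A quiver has no oriented cycles. -/
def NoOrientedCycles (Q : Type*) [Quiver Q] : Prop :=
  ∀ (v : Q) (p : Quiver.Path v v), p.length = 0

section Reps

variable (k : Type*) [Field k] {Q : Type*} [Quiver Q]

/-- `Rep_α(Q)`: the vector space of `α`-dimensional representations of `Q`. -/
abbrev RepSpace (α : Q → ℕ) : Type _ :=
  ∀ a b : Q, (a ⟶ b) → ((Fin (α a) → k) →ₗ[k] (Fin (α b) → k))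

/-- Families of linear maps `k^{α(v)} → k^{β(v)}`, one for each vertex `v`. -/
abbrev VertexMaps (α β : Q → ℕ) : Type _ :=
  ∀ v : Q, (Fin (α v) → k) →ₗ[k] (Fin (β v) → k)

/-- Families of linear maps `k^{α(ta)} → k^{β(ha)}`, one for each arrow `a`. -/
abbrev ArrowMaps (α β : Q → ℕ) : Type _ :=
  ∀ a b : Q, (a ⟶ b) → ((Fin (α a) → k) →ₗ[k] (Fin (β b) → k))

variable {k} {α β γ ε : Q → ℕ}

/-- The differential of the two-term complex `⨁_v Hom(M(v), N(v)) → ⨁_a Hom(M(ta), N(ha))`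
obtained by applying `Hom_Q(-, N)` to the canonical projective resolution of `M`. -/
def diff (M : RepSpace k α) (N : RepSpace k β) : VertexMaps k α β →ₗ[k] ArrowMaps k α β where
  toFun f := fun a b x => N a b x ∘ₗ f a - f b ∘ₗ M a b x
  map_add' f g := by
    funext a b x
    simp only [Pi.add_apply, LinearMap.comp_add, LinearMap.add_comp]
    abel
  map_smul' c f := by
    funext a b x
    simp only [Pi.smul_apply, LinearMap.comp_smul, LinearMap.smul_comp, RingHom.id_apply, smul_sub]

/-- `Hom_Q(M, N)`: the families of vertex maps that commute with all arrows. -/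
def homSpace (M : RepSpace k α) (N : RepSpace k β) : Submodule k (VertexMaps k α β) :=
  LinearMap.ker (diff M N)

theorem mem_homSpace (M : RepSpace k α) (N : RepSpace k β) (f : VertexMaps k α β) :
    f ∈ homSpace M N ↔ ∀ (a b : Q) (x : a ⟶ b), N a b x ∘ₗ f a = f b ∘ₗ M a b x := by
  simp [homSpace, diff, funext_iff, sub_eq_zero]

/-- `Ext_Q(M, N)`, the first extension group, computed by the canonical projective resolution. -/
abbrev ExtSpace (M : RepSpace k α) (N : RepSpace k β) : Type _ :=
  ArrowMaps k α β ⧸ LinearMap.range (diff M N)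

/-- `hom_Q(M, N) = dim Hom_Q(M, N)`. -/
noncomputable def homDim (M : RepSpace k α) (N : RepSpace k β) : ℕ :=
  Module.finrank k (homSpace M N)

/-- `ext_Q(M, N) = dim Ext_Q(M, N)`. -/
noncomputable def extDim (M : RepSpace k α) (N : RepSpace k β) : ℕ :=
  Module.finrank k (ExtSpace M N)

/-- `M ⊥ N`: both `Hom_Q(M, N)` and `Ext_Q(M, N)` vanish. -/
def Orthogonal (M : RepSpace k α) (N : RepSpace k β) : Prop :=
  homDim M N = 0 ∧ extDim M N = 0

/-- `E` is exceptional: `Hom_Q(E, E) = k` and `Ext_Q(E, E) = 0`. -/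
def IsExceptional (E : RepSpace k ε) : Prop :=
  homDim E E = 1 ∧ extDim E E = 0

/-- The Euler form of the quiver. -/
def eulerForm [Fintype Q] [∀ a b : Q, Fintype (a ⟶ b)] (α β : Q → ℕ) : ℤ :=
  ∑ v, (α v : ℤ) * β v - ∑ a, ∑ b, ∑ _x : a ⟶ b, (α a : ℤ) * β b

/-- `r : M → N` is the universal homomorphism from `M` to an object of `E^⊥`; equivalently `N`,
together with the unit `r`, is the value at `M` of the orthogonal projection `π̃_E`, the left adjoint
of the inclusion of `E^⊥` into the category of finite-dimensional representations. -/
def IsProjection (E : RepSpace k ε) (M : RepSpace k α) (N : RepSpace k β)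
    (r : VertexMaps k α β) : Prop :=
  Orthogonal E N ∧ r ∈ homSpace M N ∧
    ∀ (γ : Q → ℕ) (L : RepSpace k γ), Orthogonal E L → ∀ f ∈ homSpace M L,
      ∃! g : VertexMaps k β γ, g ∈ homSpace N L ∧ ∀ v, g v ∘ₗ r v = f v

/-- `M` is `E`-regular: the dimension vector of `π̃_E(M)` is `α - ⟨ε, α⟩ ε`. -/
def IsRegular [Fintype Q] [∀ a b : Q, Fintype (a ⟶ b)] (E : RepSpace k ε)
    (M : RepSpace k α) : Prop :=
  ∃ (β : Q → ℕ) (N : RepSpace k β) (r : VertexMaps k α β), IsProjection E M N r ∧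
    ∀ v, (β v : ℤ) = α v - eulerForm ε α * ε v

/-- `E ⊥ α`: the set `Rep_α(E^⊥)` is non-empty. -/
def LeftOrthogonal (E : RepSpace k ε) (α : Q → ℕ) : Prop :=
  ∃ M : RepSpace k α, Orthogonal E M

/-- The exceptional set in `Rep_α(Q)` with respect to `E`: the `E`-regular representations that do
not lie in `E^⊥`. -/
def exceptionalSet [Fintype Q] [∀ a b : Q, Fintype (a ⟶ b)] (E : RepSpace k ε) (α : Q → ℕ) :
    Set (RepSpace k α) :=
  {M | IsRegular E M ∧ ¬ Orthogonal E M}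

/-- `E` is left exceptional to `α`. -/
def LeftExceptional [Fintype Q] [∀ a b : Q, Fintype (a ⟶ b)] (E : RepSpace k ε)
    (α : Q → ℕ) : Prop :=
  LeftOrthogonal E α ∧ (exceptionalSet E α).Nonempty

/-- `GL_α · π̃_E(S)` for `S ⊆ Rep_α(Q)`: since `π̃_E(M)` is determined up to isomorphism, this is the
set of all points of `Rep_α(Q)` that are a value of `π̃_E` at some point of `S`. -/
def projectionOrbits (E : RepSpace k ε) (S : Set (RepSpace k α)) : Set (RepSpace k α) :=
  {N | ∃ M ∈ S, ∃ r : VertexMaps k α α, IsProjection E M N r}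

/-- A family of subspaces is a subrepresentation: it is stable under all arrows. -/
def IsSubrep (M : RepSpace k α) (W : ∀ v : Q, Submodule k (Fin (α v) → k)) : Prop :=
  ∀ (a b : Q) (x : a ⟶ b), ∀ w ∈ W a, M a b x w ∈ W b

variable (k)

/-- `Rep_{γ ↪ α}(Q)`: the representations with a `γ`-dimensional subrepresentation. -/
def repSub (γ α : Q → ℕ) : Set (RepSpace k α) :=
  {M | ∃ W, IsSubrep M W ∧ ∀ v, Module.finrank k (W v) = γ v}

/-- `Rep_{α ↠ γ}(Q)`: the representations with a `γ`-dimensional quotient representation. -/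
def repQuot (α γ : Q → ℕ) : Set (RepSpace k α) :=
  {M | ∃ W, IsSubrep M W ∧ ∀ v, Module.finrank k ((Fin (α v) → k) ⧸ W v) = γ v}

/-- `hom_Q(α, β) = n`: for a general `(M, N)` in `Rep_α(Q) × Rep_β(Q)`, `hom_Q(M, N) = n`. -/
def GeneralHomEq (α β : Q → ℕ) (n : ℕ) : Prop :=
  Generically k (Set.univ : Set (RepSpace k α × RepSpace k β)) fun p => homDim p.1 p.2 = n

/-- `ext_Q(α, β) = n`: for a general `(M, N)` in `Rep_α(Q) × Rep_β(Q)`, `ext_Q(M, N) = n`. -/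
def GeneralExtEq (α β : Q → ℕ) (n : ℕ) : Prop :=
  Generically k (Set.univ : Set (RepSpace k α × RepSpace k β)) fun p => extDim p.1 p.2 = n

/-- The set of points of the zero scheme of `c(M, N) = det φ`, where `φ` is the differential `diff`
(a square matrix when `⟨α, β⟩ = 0`): the pairs with a non-zero homomorphism. -/
def homLocus (α β : Q → ℕ) : Set (RepSpace k α × RepSpace k β) :=
  {p | 0 < homDim p.1 p.2}

/-- `γ` is a fundamental rank for `(α, β)`, where `⟨α, β⟩ = 0`: it is the general rank on some
irreducible component `C` of `homLocus`, that is, for a general `(M, N)` in `C` a general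
homomorphism `M → N` has rank `γ`. -/
def IsFundamentalRank [Fintype Q] [∀ a b : Q, Fintype (a ⟶ b)] (α β γ : Q → ℕ) : Prop :=
  eulerForm α β = 0 ∧ ∃ C : Set (RepSpace k α × RepSpace k β),
    Maximal (fun S => S ⊆ homLocus k α β ∧ @IsIrreducible _ (zariski k _) S) C ∧
    Generically k C fun p => Generically k (homSpace p.1 p.2 : Set (VertexMaps k α β)) fun f =>
      ∀ v, Module.finrank k (LinearMap.range (f v)) = γ v

end Reps

end QuiverRep

/-! Since $E^\perp$ contains an object of dimension $\alpha$, $\langle\epsilon,\alpha\rangle=0$. So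
$\hom(E,M)=\operatorname{ext}(E,M)$ for all $M$ of dimension $\alpha$, and
$\langle\epsilon,\alpha-\epsilon\rangle=-1$, which makes 3 and 4 equivalent pair by pair.

The projection has an explicit model (`isProjection_extRep_traceQuot`): divide $M$ by the image of
the evaluation map $E^{\hom(E,M)}\to M$, then take the universal extension of the quotient by copies
of $E$. Counting dimensions, evaluation is injective for regular $M$. If $M$ is exceptional with
$\hom(E,M)=n+1$, extending $M/E^{n+1}$ by only $n$ of the $n+1$ independent classes gives an $L$ of
dimension $\alpha-\epsilon$ with $\operatorname{Hom}(E,L)=0$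
(`exists_homZero_of_mem_exceptionalSet`). Conversely such an $L$ makes $E\oplus L$ exceptional.
Because the orbit of $E$ contains a neighbourhood of $E$, the existence of $L$ is condition 4.

Pairs with a non-zero homomorphism form a hypersurface. Near $(E,E\oplus L)$ it consists of the
pairs with an embedding $A\hookrightarrow N$, a projection of the irreducible set of exact triples;
its closure is a component of general rank $\epsilon$ (`isFundamentalRank_of_homZero`). Conversely,
on a component $C$ of general rank $\epsilon$, take $(A,N)$ with $\hom(A,N)$ minimal and
$f_0:A\hookrightarrow N$. Continue $f_0$ to a polynomial family $s$ of homomorphisms along $C$. The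
differential applied to $s$ vanishes on $C$, hence is divisible by the generator of the ideal of
$C$. Taking a derivative shows that all variations $N'f_0$ lie in one line modulo coboundaries
(`exists_line_of_minimal_kernel`). These variations fill $\operatorname{Ext}(A,N/f_0A)$, so this
space has dimension at most $1$ and the Euler form forces $\operatorname{Hom}(A,N/f_0A)=0$
(`IsFundamentalRank.exists_homZero`).

For the closures, $\operatorname{Rep}_{\epsilon\hookrightarrow\alpha}(Q)$ is irreducible, and closed
by a valuation argument (`isClosed_repSub`); the exceptional set lies in it and contains a non-empty
open part of it. On the quotient side, if $\operatorname{Hom}(E,N)=0$ and $N\to E$ is onto with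
kernel $A$, then $N$ is the projection of $A\oplus E$ (`mem_projectionOrbits_of_surjective`). -/

namespace QuiverRep

/-! ### Polynomial maps, with the adjugate as a polynomial substitute for the inverse. -/

section Polynomial

variable {k : Type*} [Field k]
variable {V W U : Type*} [AddCommGroup V] [Module k V] [AddCommGroup W] [Module k W]
  [AddCommGroup U] [Module k U]

variable (k) in
/-- A map between vector spaces is polynomial if its composition with every linear form is. -/
def IsPoly (f : V → W) : Prop :=
  ∀ l : Module.Dual k W, (fun x => l (f x)) ∈ polyFun k V

theorem dual_mem_polyFun (l : Module.Dual k V) : (l : V → k) ∈ polyFun k V :=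
  Algebra.subset_adjoin ⟨l, rfl⟩

theorem const_mem_polyFun (c : k) : (fun _ : V => c) ∈ polyFun k V :=
  (polyFun k V).algebraMap_mem c

theorem isPoly_iff_mem {f : V → k} : IsPoly k f ↔ f ∈ polyFun k V := by
  constructor
  · intro h
    exact h LinearMap.id
  · intro h l
    have : (fun x => l (f x)) = f * fun _ => l 1 := by
      funext x
      have := l.map_smul (f x) 1
      simpa using this
    rw [this]
    exact mul_mem h (const_mem_polyFun _)

theorem isPoly_const (w : W) : IsPoly k (fun _ : V => w) := fun l => const_mem_polyFun (l w)

theorem isPoly_linear (f : V →ₗ[k] W) : IsPoly k f := fun l => dual_mem_polyFun (l ∘ₗ f)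

theorem isPoly_id : IsPoly k (fun x : V => x) := isPoly_linear LinearMap.id

theorem IsPoly.add {f g : V → W} (hf : IsPoly k f) (hg : IsPoly k g) :
    IsPoly k (fun x => f x + g x) := fun l => by
  simpa using! add_mem (hf l) (hg l)

theorem IsPoly.sub {f g : V → W} (hf : IsPoly k f) (hg : IsPoly k g) :
    IsPoly k (fun x => f x - g x) := fun l => by
  simpa using! sub_mem (hf l) (hg l)

theorem IsPoly.sum {ι : Type*} (s : Finset ι) {f : ι → V → W} (hf : ∀ i, IsPoly k (f i)) :
    IsPoly k (fun x => ∑ i ∈ s, f i x) := fun l => by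
  have := sum_mem (S := polyFun k V) (t := s) fun i _ => hf i l
  convert this using 1
  funext x
  simp

theorem IsPoly.comp_mem {f : V → W} (hf : IsPoly k f) {q : W → k} (hq : q ∈ polyFun k W) :
    (fun x => q (f x)) ∈ polyFun k V := by
  induction hq using Algebra.adjoin_induction with
  | mem q hq =>
    obtain ⟨l, rfl⟩ := hq
    exact hf l
  | algebraMap c => exact const_mem_polyFun c
  | add p q _ _ hp hq => exact add_mem hp hq
  | mul p q _ _ hp hq => exact mul_mem hp hq

theorem IsPoly.comp {g : W → U} (hg : IsPoly k g) {f : V → W} (hf : IsPoly k f) :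
    IsPoly k (fun x => g (f x)) := fun l => hf.comp_mem (hg l)

theorem IsPoly.linear_comp (L : W →ₗ[k] U) {f : V → W} (hf : IsPoly k f) :
    IsPoly k (fun x => L (f x)) := (isPoly_linear L).comp hf

theorem IsPoly.mul {f g : V → k} (hf : IsPoly k f) (hg : IsPoly k g) :
    IsPoly k (fun x => f x * g x) :=
  isPoly_iff_mem.2 (mul_mem (isPoly_iff_mem.1 hf) (isPoly_iff_mem.1 hg))

theorem IsPoly.prod {ι : Type*} (s : Finset ι) {f : ι → V → k} (hf : ∀ i, IsPoly k (f i)) :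
    IsPoly k (fun x => ∏ i ∈ s, f i x) := by
  have := prod_mem (S := polyFun k V) (t := s) fun i _ => isPoly_iff_mem.1 (hf i)
  rw [isPoly_iff_mem]
  convert this using 1
  funext x
  simp

/-- Expanding the first argument in a finite basis leaves a sum of products of polynomial functions.
Composition, evaluation and scaling of polynomial families all reduce to this. -/
theorem IsPoly.bilin {Z : Type*} [AddCommGroup Z] [Module k Z] [FiniteDimensional k W]
    (B : W →ₗ[k] U →ₗ[k] Z) {f : V → W} {g : V → U} (hf : IsPoly k f) (hg : IsPoly k g) :
    IsPoly k (fun x => B (f x) (g x)) := fun l => by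
  let b := Module.finBasis k W
  have key : ∀ x, l (B (f x) (g x)) = ∑ i, b.coord i (f x) * (l ∘ₗ B (b i)) (g x) := by
    intro x
    have h := congrArg (fun w => l (B w (g x))) (b.sum_repr (f x))
    simp only [map_sum, map_smul, LinearMap.sum_apply, LinearMap.smul_apply] at h
    simpa using h.symm
  simp_rw [key]
  exact isPoly_iff_mem.1 <|
    IsPoly.sum _ fun i => (hf.linear_comp (b.coord i)).mul (hg.linear_comp (l ∘ₗ B (b i)))

theorem IsPoly.smul {q : V → k} {f : V → W} (hq : IsPoly k q) (hf : IsPoly k f) :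
    IsPoly k (fun x => q x • f x) :=
  IsPoly.bilin (LinearMap.lsmul k W) hq hf

theorem IsPoly.prodMk {f : V → W} {g : V → U} (hf : IsPoly k f) (hg : IsPoly k g) :
    IsPoly k (fun x => (f x, g x)) := by
  have : (fun x => (f x, g x)) =
      fun x => LinearMap.inl k W U (f x) + LinearMap.inr k W U (g x) := by
    funext x; simp
  rw [this]
  exact (hf.linear_comp _).add (hg.linear_comp _)

theorem IsPoly.fst {f : V → W × U} (hf : IsPoly k f) : IsPoly k (fun x => (f x).1) :=
  hf.linear_comp (LinearMap.fst k W U)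

theorem IsPoly.snd {f : V → W × U} (hf : IsPoly k f) : IsPoly k (fun x => (f x).2) :=
  hf.linear_comp (LinearMap.snd k W U)

theorem IsPoly.pi {ι : Type*} [Finite ι] {X : ι → Type*} [∀ i, AddCommGroup (X i)]
    [∀ i, Module k (X i)] {f : V → ∀ i, X i} (hf : ∀ i, IsPoly k fun x => f x i) :
    IsPoly k f := by
  classical
  have := Fintype.ofFinite ι
  have : f = fun x => ∑ i, LinearMap.single k X i (f x i) := by
    funext x
    exact (Finset.univ_sum_single (f x)).symm
  rw [this]
  exact IsPoly.sum _ fun i => (hf i).linear_comp _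

theorem IsPoly.apply {ι : Type*} {X : ι → Type*} [∀ i, AddCommGroup (X i)]
    [∀ i, Module k (X i)] {f : V → ∀ i, X i} (hf : IsPoly k f) (i : ι) :
    IsPoly k fun x => f x i :=
  hf.linear_comp (LinearMap.proj i)

theorem IsPoly.linearMap_comp {Z : Type*} [AddCommGroup Z] [Module k Z]
    [FiniteDimensional k W] [FiniteDimensional k U] {f : V → W →ₗ[k] U} {g : V → Z →ₗ[k] W}
    (hf : IsPoly k f) (hg : IsPoly k g) : IsPoly k (fun x => f x ∘ₗ g x) :=
  IsPoly.bilin (LinearMap.llcomp k Z W U) hf hg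

theorem IsPoly.linearMap_apply [FiniteDimensional k W] [FiniteDimensional k U]
    {f : V → W →ₗ[k] U} {g : V → W} (hf : IsPoly k f) (hg : IsPoly k g) :
    IsPoly k (fun x => f x (g x)) :=
  IsPoly.bilin LinearMap.id hf hg

theorem isPoly_matrix_det (n : Type*) [Fintype n] [DecidableEq n] {f : V → Matrix n n k}
    (hf : ∀ i j, IsPoly k fun x => f x i j) : IsPoly k (fun x => (f x).det) := by
  simp_rw [Matrix.det_apply']
  exact IsPoly.sum _ fun σ => (isPoly_const _).mul (IsPoly.prod _ fun i => hf _ _)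

theorem isPoly_matrix_adjugate (n : Type*) [Fintype n] [DecidableEq n] {f : V → Matrix n n k}
    (hf : ∀ i j, IsPoly k fun x => f x i j) (i j : n) :
    IsPoly k (fun x => (f x).adjugate i j) := by
  simp_rw [Matrix.adjugate_apply]
  refine isPoly_matrix_det n fun a b => ?_
  by_cases h : a = j
  · subst h
    simpa using isPoly_const _
  · simpa [Matrix.updateRow_apply, h] using hf a b

theorem IsPoly.det [FiniteDimensional k W] {f : V → W →ₗ[k] W} (hf : IsPoly k f) :
    IsPoly k (fun x => LinearMap.det (f x)) := by
  let b := Module.finBasis k W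
  simp_rw [← LinearMap.det_toMatrix b]
  exact isPoly_matrix_det _ fun i j => ((hf.linear_comp (LinearMap.toMatrix b b).toLinearMap).apply
    i).apply j

/-- The adjugate of an endomorphism of a finite-dimensional vector space. -/
noncomputable def adjEnd [FiniteDimensional k W] (f : W →ₗ[k] W) : W →ₗ[k] W :=
  Matrix.toLin (Module.finBasis k W) (Module.finBasis k W)
    (LinearMap.toMatrix (Module.finBasis k W) (Module.finBasis k W) f).adjugate

theorem adjEnd_comp [FiniteDimensional k W] (f : W →ₗ[k] W) :
    adjEnd f ∘ₗ f = LinearMap.det f • LinearMap.id := by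
  let b := Module.finBasis k W
  apply (LinearMap.toMatrix b b).injective
  rw [LinearMap.toMatrix_comp b b b, adjEnd, LinearMap.toMatrix_toLin, Matrix.adjugate_mul,
    LinearMap.det_toMatrix]
  simp

theorem comp_adjEnd [FiniteDimensional k W] (f : W →ₗ[k] W) :
    f ∘ₗ adjEnd f = LinearMap.det f • LinearMap.id := by
  let b := Module.finBasis k W
  apply (LinearMap.toMatrix b b).injective
  rw [LinearMap.toMatrix_comp b b b, adjEnd, LinearMap.toMatrix_toLin, Matrix.mul_adjugate,
    LinearMap.det_toMatrix]
  simp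

theorem adjEnd_apply_apply [FiniteDimensional k W] (f : W →ₗ[k] W) (w : W) :
    adjEnd f (f w) = LinearMap.det f • w := by
  simpa using! LinearMap.congr_fun (adjEnd_comp f) w

theorem apply_adjEnd_apply [FiniteDimensional k W] (f : W →ₗ[k] W) (w : W) :
    f (adjEnd f w) = LinearMap.det f • w := by
  simpa using! LinearMap.congr_fun (comp_adjEnd f) w

theorem adjEnd_id [FiniteDimensional k W] : adjEnd (LinearMap.id : W →ₗ[k] W) = LinearMap.id := by
  simpa using! adjEnd_comp (LinearMap.id : W →ₗ[k] W)

theorem IsPoly.adjEnd [FiniteDimensional k W] {f : V → W →ₗ[k] W} (hf : IsPoly k f) :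
    IsPoly k (fun x => adjEnd (f x)) := by
  refine IsPoly.linear_comp (Matrix.toLin (Module.finBasis k W) (Module.finBasis k W)).toLinearMap
    (IsPoly.pi fun i => IsPoly.pi fun j => ?_)
  exact isPoly_matrix_adjugate _ (fun a b => ((hf.linear_comp
    (LinearMap.toMatrix (Module.finBasis k W) (Module.finBasis k W)).toLinearMap).apply a).apply b)
    i j

/-! ### Polynomial functions in coordinates -/

section Coordinates

variable {ι : Type*} (b : Module.Basis ι k V)

/-- A polynomial in the coordinates with respect to a basis, as a function. -/
noncomputable def evalBasis : MvPolynomial ι k →ₐ[k] (V → k) :=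
  MvPolynomial.aeval fun i => (b.coord i : V → k)

theorem evalBasis_apply (P : MvPolynomial ι k) (x : V) :
    evalBasis b P x = MvPolynomial.eval (fun i => b.repr x i) P := by
  induction P using MvPolynomial.induction_on with
  | C a => simp [evalBasis]
  | add p q hp hq => simp [hp, hq]
  | mul_X p i hp => simp [hp, show evalBasis b (MvPolynomial.X i) x = b.repr x i by
      simp [evalBasis]]

theorem evalBasis_mem (P : MvPolynomial ι k) : evalBasis b P ∈ polyFun k V := by
  induction P using MvPolynomial.induction_on with
  | C a => exact (MvPolynomial.aeval_C (fun i => (b.coord i : V → k)) a).symm ▸ const_mem_polyFun a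
  | add p q hp hq => rw [map_add]; exact add_mem hp hq
  | mul_X p i hp =>
    rw [map_mul]
    refine mul_mem hp ?_
    simpa [evalBasis] using! dual_mem_polyFun (b.coord i)

theorem exists_evalBasis [Finite ι] {q : V → k} (hq : q ∈ polyFun k V) :
    ∃ P : MvPolynomial ι k, evalBasis b P = q := by
  have := Fintype.ofFinite ι
  induction hq using Algebra.adjoin_induction with
  | mem q hq =>
    obtain ⟨l, rfl⟩ := hq
    refine ⟨∑ i, MvPolynomial.C (l (b i)) * MvPolynomial.X i, ?_⟩
    funext x
    rw [evalBasis_apply]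
    have h := congrArg l (b.sum_repr x)
    simp only [map_sum, map_smul] at h
    simpa [mul_comm] using h
  | algebraMap c => exact ⟨MvPolynomial.C c, by simp [evalBasis]⟩
  | add p q _ _ hp hq =>
    obtain ⟨P, rfl⟩ := hp
    obtain ⟨R, rfl⟩ := hq
    exact ⟨P + R, map_add _ _ _⟩
  | mul p q _ _ hp hq =>
    obtain ⟨P, rfl⟩ := hp
    obtain ⟨R, rfl⟩ := hq
    exact ⟨P * R, map_mul _ _ _⟩

theorem evalBasis_injective [Finite ι] [Infinite k] : Function.Injective (evalBasis b) := by
  intro P R h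
  have := Fintype.ofFinite ι
  refine MvPolynomial.funext fun c => ?_
  have := congrFun h (b.equivFun.symm c)
  rw [evalBasis_apply, evalBasis_apply] at this
  rwa [show (fun i => b.repr (b.equivFun.symm c) i) = c from b.equivFun.apply_symm_apply c]
    at this

end Coordinates

/-- Over an infinite field polynomial functions are the same as polynomials, which form a domain.
This is what makes affine space irreducible. -/
theorem polyFun_mul_eq_zero [Infinite k] [FiniteDimensional k V] {p q : V → k}
    (hp : p ∈ polyFun k V) (hq : q ∈ polyFun k V) (h : p * q = 0) : p = 0 ∨ q = 0 := by
  obtain ⟨P, rfl⟩ := exists_evalBasis (Module.finBasis k V) hp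
  obtain ⟨R, rfl⟩ := exists_evalBasis (Module.finBasis k V) hq
  rw [← map_mul, ← map_zero (evalBasis (Module.finBasis k V))] at h
  rcases mul_eq_zero.1 (evalBasis_injective _ h) with rfl | rfl <;> simp

/-- A polynomial map on the line with value `0` at the origin is divisible by the parameter. -/
theorem IsPoly.exists_div [FiniteDimensional k W] {f : k → W} (hf : IsPoly k f) :
    ∃ g : k → W, IsPoly k g ∧ ∀ t, f t = f 0 + t • g t := by
  have scalar : ∀ q ∈ polyFun k k, ∃ r ∈ polyFun k k, ∀ t, q t = q 0 + t * r t := by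
    intro q hq
    induction hq using Algebra.adjoin_induction with
    | mem q hq =>
      obtain ⟨l, rfl⟩ := hq
      refine ⟨fun _ => l 1, const_mem_polyFun _, fun t => ?_⟩
      have := l.map_smul t 1
      simpa using this
    | algebraMap c => exact ⟨0, zero_mem _, fun t => by simp⟩
    | add p q _ _ hp hq =>
      obtain ⟨r, hr, h⟩ := hp
      obtain ⟨r', hr', h'⟩ := hq
      exact ⟨r + r', add_mem hr hr', fun t => by simp [h t, h' t]; ring⟩
    | mul p q hp0 hq0 hp hq =>
      obtain ⟨r, hr, h⟩ := hp
      obtain ⟨r', hr', h'⟩ := hq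
      refine ⟨(fun _ => p 0) * r' + r * q, add_mem (mul_mem (const_mem_polyFun _) hr')
        (mul_mem hr hq0), fun t => ?_⟩
      simp only [Pi.mul_apply, Pi.add_apply]
      rw [h t]
      linear_combination p 0 * h' t
  let b := Module.finBasis k W
  choose r hr h using fun i => scalar _ (hf (b.coord i))
  refine ⟨fun t => ∑ i, r i t • b i,
    IsPoly.sum _ fun i => (isPoly_iff_mem.2 (hr i)).smul (isPoly_const _), fun t => ?_⟩
  apply b.ext_elem
  intro i
  have := h i t
  simp only [Module.Basis.coord_apply] at this
  rw [this]
  simp [Finsupp.single_apply]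

theorem isPoly_line (x v : V) : IsPoly k (fun t : k => x + t • v) :=
  (isPoly_const x).add (isPoly_id.smul (isPoly_const v))

/-- First-order Taylor expansion: `g 0` is the derivative of `f` at `x` in the direction `v`,
available without a calculus of derivatives. -/
theorem IsPoly.exists_line_expansion [FiniteDimensional k W] {f : V → W} (hf : IsPoly k f)
    (x v : V) : ∃ g : k → W, IsPoly k g ∧ ∀ t : k, f (x + t • v) = f x + t • g t := by
  obtain ⟨g, hg, h⟩ := (hf.comp (isPoly_line x v)).exists_div
  exact ⟨g, hg, fun t => by simpa using h t⟩

/-- Cancelling `t` is clear away from `0`; polynomiality carries it to `t = 0`, where derivatives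
are read off. -/
theorem IsPoly.eq_zero_of_smul [Infinite k] {f : k → W} (hf : IsPoly k f)
    (h : ∀ t : k, t • f t = 0) : f 0 = 0 := by
  rw [← Module.forall_dual_apply_eq_zero_iff k]
  intro l
  have : (fun t : k => t) * (fun t => l (f t)) = 0 := by
    funext t
    simpa using congrArg l (h t)
  rcases polyFun_mul_eq_zero (isPoly_iff_mem.1 isPoly_id) (hf l) this with h | h
  · exact absurd (congrFun h 1) one_ne_zero
  · exact congrFun h 0

end Polynomial

/-! ### The Zariski topology -/

section Topology

variable {k : Type*} [Field k]
variable {V W : Type*} [AddCommGroup V] [Module k V] [AddCommGroup W] [Module k W]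

theorem isClosed_zariski_iff {Z : Set V} : IsClosed[zariski k V] Z ↔
    ∃ S : Set (V → k), S ⊆ (polyFun k V : Set (V → k)) ∧ Z = {x | ∀ p ∈ S, p x = 0} := by
  let := zariski k V
  rw [← isOpen_compl_iff]
  change Zᶜᶜ ∈ _ ↔ _
  rw [compl_compl]
  rfl

theorem isClosed_zeros {q : V → k} (hq : q ∈ polyFun k V) : IsClosed[zariski k V] {x | q x = 0} :=
  isClosed_zariski_iff.2 ⟨{q}, by simpa using hq, by simp⟩

theorem isOpen_nonzeros {q : V → k} (hq : q ∈ polyFun k V) : IsOpen[zariski k V] {x | q x ≠ 0} := by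
  let := zariski k V
  rw [← isClosed_compl_iff]
  convert isClosed_zeros hq using 1
  ext x
  simp

theorem IsPoly.continuous {f : V → W} (hf : IsPoly k f) :
    @Continuous _ _ (zariski k V) (zariski k W) f := by
  let := zariski k V
  let := zariski k W
  rw [continuous_iff_isClosed]
  intro Z hZ
  obtain ⟨S, hS, rfl⟩ := isClosed_zariski_iff.1 hZ
  exact isClosed_zariski_iff.2 ⟨(fun q x => q (f x)) '' S, by
    rintro _ ⟨q, hq, rfl⟩
    exact hf.comp_mem (hS hq), by ext; simp⟩

theorem exists_mem_polyFun_of_isOpen {U : Set V} (hU : IsOpen[zariski k V] U) {x : V}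
    (hx : x ∈ U) : ∃ q ∈ polyFun k V, q x ≠ 0 ∧ ∀ y, q y ≠ 0 → y ∈ U := by
  let := zariski k V
  obtain ⟨S, hS, h⟩ := isClosed_zariski_iff.1 (isClosed_compl_iff.2 hU)
  have hx' : x ∉ Uᶜ := fun h => h hx
  rw [h] at hx'
  simp only [Set.mem_ofPred_eq, not_forall] at hx'
  obtain ⟨q, hq, hqx⟩ := hx'
  refine ⟨q, hS hq, hqx, fun y hy => ?_⟩
  by_contra hyU
  have hyU : y ∈ Uᶜ := hyU
  rw [h] at hyU
  exact hy (hyU q hq)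

variable (k V) in
theorem isIrreducible_univ_zariski [Infinite k] [FiniteDimensional k V] :
    @IsIrreducible V (zariski k V) Set.univ := by
  let := zariski k V
  refine ⟨⟨0, trivial⟩, ?_⟩
  rintro U U' hU hU' ⟨x, -, hx⟩ ⟨x', -, hx'⟩
  obtain ⟨q, hq, hqx, hqU⟩ := exists_mem_polyFun_of_isOpen hU hx
  obtain ⟨q', hq', hqx', hqU'⟩ := exists_mem_polyFun_of_isOpen hU' hx'
  by_contra hcon
  have : q * q' = 0 := by
    funext y
    by_contra hy
    have hy : q y * q' y ≠ 0 := hy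
    exact hcon ⟨y, trivial, hqU y (left_ne_zero_of_mul hy), hqU' y (right_ne_zero_of_mul hy)⟩
  rcases polyFun_mul_eq_zero hq hq' this with rfl | rfl
  · exact hqx rfl
  · exact hqx' rfl

/-- A non-empty relatively open subset of an irreducible set is dense in it. -/
theorem subset_closure_inter_of_isIrreducible {X : Type*} [TopologicalSpace X] {S U : Set X}
    (hS : IsPreirreducible S) (hU : IsOpen U) (hne : (S ∩ U).Nonempty) :
    S ⊆ closure (S ∩ U) := by
  intro x hx
  rw [mem_closure_iff]
  intro O hO hxO
  obtain ⟨y, hy, hy'⟩ := hS O U hO hU ⟨x, hx, hxO⟩ hne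
  exact ⟨y, hy'.1, hy, hy'.2⟩

theorem isIrreducible_inter_of_isOpen {X : Type*} [TopologicalSpace X] {S U : Set X}
    (hS : IsPreirreducible S) (hU : IsOpen U) (hne : (S ∩ U).Nonempty) :
    IsIrreducible (S ∩ U) := by
  refine ⟨hne, fun O O' hO hO' h h' => ?_⟩
  obtain ⟨x, ⟨hx, hxU⟩, hxO⟩ := h
  obtain ⟨y, ⟨hy, hyU⟩, hyO⟩ := h'
  obtain ⟨z, hz, ⟨hz1, hz2⟩, hz3, -⟩ := hS (O ∩ U) (O' ∩ U) (hO.inter hU) (hO'.inter hU)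
    ⟨x, hx, hxO, hxU⟩ ⟨y, hy, hyO, hyU⟩
  exact ⟨z, ⟨hz, hz2⟩, hz1, hz3⟩

theorem eq_zero_of_mem_closure {S : Set V} {q : V → k} (hq : q ∈ polyFun k V)
    (h : ∀ x ∈ S, q x = 0) {x : V} (hx : x ∈ closure[zariski k V] S) : q x = 0 := by
  let := zariski k V
  exact closure_minimal (t := {x | q x = 0}) h (isClosed_zeros hq) hx

end Topology


/-! ### Kernels in polynomial families of linear maps. -/

section KernelSection

variable {k : Type*} [Field k]
variable {Y V W : Type*} [AddCommGroup Y] [Module k Y] [AddCommGroup V] [Module k V]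
  [AddCommGroup W] [Module k W]

/-- Upper semicontinuity of the kernel of a polynomial family of linear maps, and polynomial
sections of the kernel through a given vector, along the locus where the kernel dimension does not
drop. -/
theorem exists_kernel_section [FiniteDimensional k V] [FiniteDimensional k W]
    {T : Y → V →ₗ[k] W} (hT : IsPoly k T) (y₀ : Y) {f₀ : V} (hf₀ : T y₀ f₀ = 0) :
    ∃ q ∈ polyFun k Y, ∃ s : Y → V, IsPoly k s ∧ q y₀ ≠ 0 ∧ s y₀ = f₀ ∧ ∀ y, q y ≠ 0 →
      Module.finrank k (LinearMap.ker (T y)) ≤ Module.finrank k (LinearMap.ker (T y₀)) ∧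
      (Module.finrank k (LinearMap.ker (T y)) = Module.finrank k (LinearMap.ker (T y₀)) →
        T y (s y) = 0) := by
  obtain ⟨S, hS⟩ : ∃ S : W →ₗ[k] V, ∀ f, T y₀ (S (T y₀ f)) = T y₀ f := by
    obtain ⟨h, hh⟩ := (T y₀).rangeRestrict.exists_rightInverse_of_surjective
      (LinearMap.range_rangeRestrict _)
    obtain ⟨S, hS⟩ := LinearMap.exists_extend h
    refine ⟨S, fun f => ?_⟩
    have h1 : S (T y₀ f) = h ((T y₀).rangeRestrict f) :=
      LinearMap.congr_fun hS ((T y₀).rangeRestrict f)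
    have h2 := LinearMap.congr_fun hh ((T y₀).rangeRestrict f)
    rw [h1]
    exact congrArg Subtype.val h2
  -- `S` is a generalized inverse of `T y₀`, so `pr` projects onto `ker (T y₀)`. The family `Φ` is
  -- the identity at `y₀` and coincides with `pr` on `ker (T y)`; where `Φ y` is invertible, `ker (T
  -- y)` therefore embeds into `ker (T y₀)`.
  let pr : V →ₗ[k] V := LinearMap.id - S ∘ₗ T y₀
  let Φ : Y → V →ₗ[k] V := fun y => S ∘ₗ T y + pr
  have hΦ : IsPoly k Φ := ((isPoly_const S).linearMap_comp hT).add (isPoly_const pr)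
  have hΦ₀ : Φ y₀ = LinearMap.id := by simp [Φ, pr]
  have hpr : ∀ f, pr f ∈ LinearMap.ker (T y₀) := fun f => by simp [pr, hS]
  refine ⟨fun y => LinearMap.det (Φ y), isPoly_iff_mem.1 hΦ.det, fun y => adjEnd (Φ y) f₀,
    hΦ.adjEnd.linearMap_apply (isPoly_const f₀), by simp [hΦ₀], by simp [hΦ₀, adjEnd_id],
    fun y hy => ?_⟩
  let m : LinearMap.ker (T y) →ₗ[k] LinearMap.ker (T y₀) :=
    LinearMap.codRestrict _ (pr ∘ₗ (LinearMap.ker (T y)).subtype) fun f => hpr _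
  have hm : ∀ f : LinearMap.ker (T y), ((m f : V)) = Φ y f := fun f => by
    have : T y f = 0 := f.2
    simp [m, Φ, this]
  have hinj : Function.Injective m := by
    rw [← LinearMap.ker_eq_bot, LinearMap.ker_eq_bot']
    intro f hf
    have h1 := adjEnd_apply_apply (Φ y) (f : V)
    rw [← hm, hf] at h1
    have h2 : (f : V) = 0 := by simpa [hy] using h1.symm
    exact Subtype.ext h2
  refine ⟨LinearMap.finrank_le_finrank_of_injective hinj, fun heq => ?_⟩
  -- For equal dimensions the embedding is onto, so `f₀ = Φ y f` for a kernel vector `f`, and the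
  -- adjugate returns a multiple of `f`.
  obtain ⟨f, hf⟩ := (LinearMap.injective_iff_surjective_of_finrank_eq_finrank heq).1 hinj
    ⟨f₀, hf₀⟩
  have h1 := hm f
  rw [hf] at h1
  have h1 : f₀ = Φ y f := h1
  have hTf : T y f = 0 := f.2
  change T y (adjEnd (Φ y) f₀) = 0
  rw [h1, adjEnd_apply_apply, map_smul, hTf, smul_zero]

end KernelSection

/-! ### Components of hypersurfaces and their first-order deformations. -/

section Hypersurface

variable {k : Type*} [Field k] {Y W : Type*} [AddCommGroup Y] [Module k Y]
  [AddCommGroup W] [Module k W]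

theorem vanishes_or_vanishes_of_isPreirreducible {C : Set Y}
    (hC : @IsPreirreducible Y (zariski k Y) C) {p q : Y → k} (hp : p ∈ polyFun k Y)
    (hq : q ∈ polyFun k Y) (h : ∀ y ∈ C, p y * q y = 0) :
    (∀ y ∈ C, p y = 0) ∨ ∀ y ∈ C, q y = 0 := by
  let := zariski k Y
  by_contra! hcon
  obtain ⟨⟨x, hx, hpx⟩, y, hy, hqy⟩ := hcon
  obtain ⟨z, hz, hpz, hqz⟩ := hC _ _ (isOpen_nonzeros hp) (isOpen_nonzeros hq)
    ⟨x, hx, hpx⟩ ⟨y, hy, hqy⟩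
  exact mul_ne_zero hpz hqz (h z hz)

/-- By the Nullstellensatz `q` lies in the radical of `(p)`, which is `(p)` itself because `p` is
prime. -/
theorem dvd_of_vanishes_on_zeros [IsAlgClosed k] {n : ℕ} {p q : MvPolynomial (Fin n) k}
    (hp : Prime p)
    (h : ∀ x : Fin n → k, MvPolynomial.eval x p = 0 → MvPolynomial.eval x q = 0) : p ∣ q := by
  have hI : (Ideal.span {p}).IsPrime := (Ideal.span_singleton_prime hp.ne_zero).2 hp
  rw [← Ideal.mem_span_singleton, ← hI.radical,
    ← MvPolynomial.vanishingIdeal_zeroLocus_eq_radical (K := k), MvPolynomial.mem_vanishingIdeal_iff]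
  intro x hx
  have : MvPolynomial.aeval x p = 0 := hx p (Ideal.mem_span_singleton_self p)
  rw [MvPolynomial.aeval_eq_eval] at this ⊢
  exact h x this

/-- An irreducible component of a hypersurface is cut out by one polynomial, which generates its
ideal. -/
theorem exists_generator_of_maximal [IsAlgClosed k] [FiniteDimensional k Y] {d : Y → k}
    (hd : d ∈ polyFun k Y) (hd0 : d ≠ 0) {C : Set Y}
    (hC : Maximal (fun S => S ⊆ {y | d y = 0} ∧ @IsIrreducible Y (zariski k Y) S) C) :
    ∃ p ∈ polyFun k Y, (∀ y ∈ C, p y = 0) ∧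
      ∀ q ∈ polyFun k Y, (∀ y ∈ C, q y = 0) → ∃ w ∈ polyFun k Y, ∀ y, q y = p y * w y := by
  let := zariski k Y
  let b := Module.finBasis k Y
  have hirr := hC.prop.2
  obtain ⟨D, rfl⟩ := exists_evalBasis b hd
  have hD0 : D ≠ 0 := fun h => hd0 (by rw [h, map_zero])
  -- On an irreducible set a vanishing product has a vanishing factor, so induction on the
  -- factorization isolates one prime factor of `D` that vanishes on `C`.
  have hprime : ∀ P : MvPolynomial (Fin (Module.finrank k Y)) k, P ≠ 0 →
      (∀ y ∈ C, evalBasis b P y = 0) → ∃ p, Prime p ∧ p ∣ P ∧ ∀ y ∈ C, evalBasis b p y = 0 := by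
    intro P
    induction P using UniqueFactorizationMonoid.induction_on_prime with
    | h₁ => exact fun h => absurd rfl h
    | h₂ u hu =>
      intro _ h
      obtain ⟨y, hy⟩ := hirr.nonempty
      obtain ⟨v, hv⟩ := hu.exists_right_inv
      have := congrFun (congrArg (evalBasis b) hv) y
      rw [map_mul, map_one, Pi.mul_apply, h y hy, zero_mul] at this
      exact absurd this zero_ne_one
    | h₃ a p ha hp ih =>
      intro _ h
      rcases vanishes_or_vanishes_of_isPreirreducible hirr.isPreirreducible (evalBasis_mem b p)
        (evalBasis_mem b a) (fun y hy => by simpa using h y hy) with h' | h'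
      · exact ⟨p, hp, dvd_mul_right _ _, h'⟩
      · obtain ⟨p', hp', hdvd, h''⟩ := ih ha h'
        exact ⟨p', hp', hdvd.mul_left p, h''⟩
  obtain ⟨p, hp, hpD, hpC⟩ := hprime D hD0 fun y hy => hC.prop.1 hy
  have hdvd : ∀ q, (∀ y, evalBasis b p y = 0 → evalBasis b q y = 0) → p ∣ q := by
    intro q hq
    refine dvd_of_vanishes_on_zeros hp fun x hx => ?_
    have := hq (b.equivFun.symm x)
    rw [evalBasis_apply, evalBasis_apply,
      show (fun i => b.repr (b.equivFun.symm x) i) = x from b.equivFun.apply_symm_apply x] at this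
    exact this hx
  let Z : Set Y := {y | evalBasis b p y = 0}
  have hZ : IsIrreducible Z := by
    refine ⟨hirr.nonempty.mono hpC, ?_⟩
    rintro U U' hU hU' ⟨x, hxZ, hx⟩ ⟨x', hxZ', hx'⟩
    obtain ⟨q, hq, hqx, hqU⟩ := exists_mem_polyFun_of_isOpen hU hx
    obtain ⟨q', hq', hqx', hqU'⟩ := exists_mem_polyFun_of_isOpen hU' hx'
    obtain ⟨q, rfl⟩ := exists_evalBasis b hq
    obtain ⟨q', rfl⟩ := exists_evalBasis b hq'
    by_contra hcon
    have : p ∣ q * q' := hdvd _ fun y hy => by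
      by_contra hne
      rw [map_mul, Pi.mul_apply] at hne
      exact hcon ⟨y, hy, hqU y (left_ne_zero_of_mul hne), hqU' y (right_ne_zero_of_mul hne)⟩
    have hvan : ∀ r, p ∣ r → ∀ y ∈ Z, evalBasis b r y = 0 := by
      rintro _ ⟨r, rfl⟩ y hy
      have hy : evalBasis b p y = 0 := hy
      simp [hy]
    rcases hp.dvd_or_dvd this with h | h
    · exact hqx (hvan _ h x hxZ)
    · exact hqx' (hvan _ h x' hxZ')
  -- The zero set of the prime is irreducible, lies in the hypersurface and contains `C`; maximality
  -- makes it equal to `C`.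
  have hZC : Z ⊆ C := by
    refine hC.le_of_ge ⟨fun y hy => ?_, hZ⟩ hpC
    have hy : evalBasis b p y = 0 := hy
    obtain ⟨r, rfl⟩ := hpD
    simp [hy]
  refine ⟨_, evalBasis_mem b p, hpC, fun q hq hqC => ?_⟩
  obtain ⟨q, rfl⟩ := exists_evalBasis b hq
  obtain ⟨w, rfl⟩ := hdvd q fun y hy => hqC y (hZC hy)
  exact ⟨_, evalBasis_mem b w, fun y => by simp⟩

theorem IsPoly.exists_eq_smul [FiniteDimensional k W] {C : Set Y} {p : Y → k}
    (hpC : ∀ q ∈ polyFun k Y, (∀ y ∈ C, q y = 0) → ∃ w ∈ polyFun k Y, ∀ y, q y = p y * w y)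
    {f : Y → W} (hf : IsPoly k f) (hfC : ∀ y ∈ C, f y = 0) :
    ∃ w : Y → W, IsPoly k w ∧ ∀ y, f y = p y • w y := by
  let b := Module.finBasis k W
  choose w hw h using fun i => hpC _ (hf (b.coord i)) (fun y hy => by simp [hfC y hy])
  refine ⟨fun y => ∑ i, w i y • b i,
    IsPoly.sum _ fun i => (isPoly_iff_mem.2 (hw i)).smul (isPoly_const _), fun y => ?_⟩
  apply b.ext_elem
  intro i
  have := h i y
  simp only [Module.Basis.coord_apply] at this
  rw [this]
  simp [Finsupp.single_apply]

/-- Let `T` be a family of linear maps that depends linearly on the point, and `C` an irreducible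
component of a hypersurface. If the kernel dimension is minimal on `C ∩ U` at `y₀`, then the
infinitesimal variation of `T` on a kernel vector `f₀` at `y₀` lies in the image of `T y₀` up to a
line. -/
theorem exists_line_of_minimal_kernel [IsAlgClosed k] [FiniteDimensional k Y] {V : Type*}
    [AddCommGroup V] [Module k V] [FiniteDimensional k V] [FiniteDimensional k W]
    (T : Y →ₗ[k] V →ₗ[k] W) {d : Y → k} (hd : d ∈ polyFun k Y) (hd0 : d ≠ 0) {C : Set Y}
    (hC : Maximal (fun S => S ⊆ {y | d y = 0} ∧ @IsIrreducible Y (zariski k Y) S) C)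
    {U : Set Y} (hU : IsOpen[zariski k Y] U) {y₀ : Y} (hy₀ : y₀ ∈ C ∩ U)
    (hmin : ∀ y ∈ C ∩ U, Module.finrank k (LinearMap.ker (T y₀)) ≤
      Module.finrank k (LinearMap.ker (T y))) {f₀ : V} (hf₀ : T y₀ f₀ = 0) :
    ∃ w₀ : W, ∀ v : Y, ∃ (f : V) (c : k), T v f₀ = T y₀ f + c • w₀ := by
  let := zariski k Y
  obtain ⟨q, hq, s, hs, hq₀, hs₀, H⟩ := exists_kernel_section (isPoly_linear T) y₀ hf₀
  obtain ⟨p, hp, hpC, hgen⟩ := exists_generator_of_maximal hd hd0 hC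
  have hTs : IsPoly k fun y => T y (s y) := (isPoly_linear T).linearMap_apply hs
  -- Near `y₀` the kernel dimension cannot exceed its value at `y₀`, and on `C ∩ U` it cannot be
  -- smaller. Hence `s` is a true kernel section on a dense part of `C`, and the equation extends to
  -- the closure.
  have hvan : ∀ y ∈ C, T y (s y) = 0 := by
    intro y hy
    rw [← Module.forall_dual_apply_eq_zero_iff k]
    intro l
    have hO : IsOpen (U ∩ {y | q y ≠ 0}) := hU.inter (isOpen_nonzeros hq)
    refine eq_zero_of_mem_closure (S := C ∩ (U ∩ {y | q y ≠ 0})) (hTs l) ?_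
      (subset_closure_inter_of_isIrreducible hC.prop.2.isPreirreducible hO
        ⟨y₀, hy₀.1, hy₀.2, hq₀⟩ hy)
    rintro z ⟨hzC, hzU, hzq⟩
    obtain ⟨h1, h2⟩ := H z hzq
    simp [h2 (le_antisymm h1 (hmin z ⟨hzC, hzU⟩))]
  obtain ⟨w, hw, hTw⟩ := hTs.exists_eq_smul hgen hvan
  refine ⟨w y₀, fun v => ?_⟩
  obtain ⟨s₁, hs₁, hs₁'⟩ := hs.exists_line_expansion y₀ v
  obtain ⟨p₁, hp₁, hp₁'⟩ := (isPoly_iff_mem.2 hp).exists_line_expansion y₀ v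
  have hp₀ : p y₀ = 0 := hpC y₀ hy₀.1
  -- `G` is the quotient by `t` of the difference of the two sides of `T y (s y) = p y • w y` at `y
  -- = y₀ + t • v`; its value at `0` is the derivative of the equation.
  let G : k → W := fun t => T v f₀ + T y₀ (s₁ t) + t • T v (s₁ t) - p₁ t • w (y₀ + t • v)
  have hG : IsPoly k G :=
    (((isPoly_const _).add (hs₁.linear_comp _)).add (isPoly_id.smul (hs₁.linear_comp _))).sub
      (hp₁.smul (hw.comp (isPoly_line y₀ v)))
  have hG0 : G 0 = 0 := by
    refine hG.eq_zero_of_smul fun t => ?_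
    have h := hTw (y₀ + t • v)
    simp only [hs₁', hp₁', hs₀, hp₀, map_add, map_smul, LinearMap.add_apply, LinearMap.smul_apply,
      hf₀, zero_add, smul_eq_mul] at h
    simp only [G]
    rw [smul_sub, smul_smul, ← h]
    simp only [smul_add]
    abel
  refine ⟨-s₁ 0, p₁ 0, ?_⟩
  have : T v f₀ + T y₀ (s₁ 0) - p₁ 0 • w y₀ = 0 := by simpa [G] using hG0
  rw [map_neg, ← sub_eq_zero, ← this]
  abel

end Hypersurface


/-! ### Evaluation maps from sums of copies of a representation. -/

section SumMap

variable {k : Type*} [Field k] {Q : Type*} {V S : Q → Type*}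
  [∀ v, AddCommGroup (V v)] [∀ v, Module k (V v)]
  [∀ v, AddCommGroup (S v)] [∀ v, Module k (S v)] {ι : Type*} [Fintype ι]

/-- The sum `E^ι → M` of a family of homomorphisms. -/
def sumMap (φ : ι → ∀ v, S v →ₗ[k] V v) (v : Q) : (ι → S v) →ₗ[k] V v :=
  ∑ i, φ i v ∘ₗ LinearMap.proj i

theorem sumMap_apply (φ : ι → ∀ v, S v →ₗ[k] V v) (v : Q) (m : ι → S v) :
    sumMap φ v m = ∑ i, φ i v (m i) := by simp [sumMap]

end SumMap

/-! ### Representations on arbitrary spaces, so that quotients and extensions need no coordinates.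
-/

section Abstract

variable {k : Type*} [Field k] {Q : Type*} [Quiver Q]

variable (k) in
/-- Families of linear maps indexed by the arrows, for families of vector spaces. A representation
on `V` is an element of `ArrowFamily k V V`. -/
abbrev ArrowFamily (V W : Q → Type*) [∀ v, AddCommGroup (V v)] [∀ v, Module k (V v)]
    [∀ v, AddCommGroup (W v)] [∀ v, Module k (W v)] : Type _ :=
  ∀ a b : Q, (a ⟶ b) → V a →ₗ[k] W b

variable {V W X S : Q → Type*}
  [∀ v, AddCommGroup (V v)] [∀ v, Module k (V v)]
  [∀ v, AddCommGroup (W v)] [∀ v, Module k (W v)]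
  [∀ v, AddCommGroup (X v)] [∀ v, Module k (X v)]
  [∀ v, AddCommGroup (S v)] [∀ v, Module k (S v)]

/-- A family of linear maps commutes with the arrows. -/
def IsHom (M : ArrowFamily k V V) (N : ArrowFamily k W W) (f : ∀ v, V v →ₗ[k] W v) : Prop :=
  ∀ (a b : Q) (x : a ⟶ b) (m : V a), N a b x (f a m) = f b (M a b x m)

/-- The class of `η` in the extension group of `M` by `N` vanishes. -/
def IsBoundary (M : ArrowFamily k V V) (N : ArrowFamily k W W) (η : ArrowFamily k V W) : Prop :=
  ∃ g : ∀ v, V v →ₗ[k] W v, ∀ (a b : Q) (x : a ⟶ b) (m : V a),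
    η a b x m = N a b x (g a m) - g b (M a b x m)

/-- There is no non-zero homomorphism from `M` to `N`. -/
def HomZero (M : ArrowFamily k V V) (N : ArrowFamily k W W) : Prop :=
  ∀ f, IsHom M N f → ∀ v m, f v m = 0

/-- The extension group of `M` by `N` vanishes. -/
def ExtZero (M : ArrowFamily k V V) (N : ArrowFamily k W W) : Prop :=
  ∀ η, IsBoundary M N η

/-- Both `Hom` and `Ext` from `M` to `N` vanish. -/
def Perp (M : ArrowFamily k V V) (N : ArrowFamily k W W) : Prop :=
  HomZero M N ∧ ExtZero M N

/-- Every endomorphism of `M` is a scalar. -/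
def IsBrick (M : ArrowFamily k V V) : Prop :=
  ∀ f, IsHom M M f → ∃ c : k, ∀ v m, f v m = c • m

theorem IsHom.comp {M : ArrowFamily k V V} {N : ArrowFamily k W W} {L : ArrowFamily k X X}
    {g : ∀ v, W v →ₗ[k] X v} {f : ∀ v, V v →ₗ[k] W v} (hg : IsHom N L g) (hf : IsHom M N f) :
    IsHom M L fun v => g v ∘ₗ f v := fun a b x m => by
  simp [hg a b x, hf a b x]

/-! ### Transport of structure -/

/-- Transport of a representation along linear equivalences. -/
def transport (M : ArrowFamily k V V) (e : ∀ v, V v ≃ₗ[k] W v) : ArrowFamily k W W :=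
  fun a b x => (e b).toLinearMap ∘ₗ M a b x ∘ₗ (e a).symm.toLinearMap

theorem isHom_transport (M : ArrowFamily k V V) (e : ∀ v, V v ≃ₗ[k] W v) :
    IsHom M (transport M e) fun v => (e v).toLinearMap := fun a b x m => by
  simp [transport]

theorem isHom_transport_symm (M : ArrowFamily k V V) (e : ∀ v, V v ≃ₗ[k] W v) :
    IsHom (transport M e) M fun v => (e v).symm.toLinearMap := fun a b x m => by
  simp [transport]

theorem IsHom.symm {M : ArrowFamily k V V} {N : ArrowFamily k W W} {e : ∀ v, V v ≃ₗ[k] W v}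
    (h : IsHom M N fun v => (e v).toLinearMap) : IsHom N M fun v => (e v).symm.toLinearMap :=
  fun a b x m => by
    apply (e b).injective
    have := h a b x ((e a).symm m)
    simpa using this.symm

theorem HomZero.of_iso {E : ArrowFamily k S S} {M : ArrowFamily k V V} {N : ArrowFamily k W W}
    (h : HomZero E M) {e : ∀ v, V v ≃ₗ[k] W v} (he : IsHom M N fun v => (e v).toLinearMap) :
    HomZero E N := fun f hf v m => by
  have := h _ (he.symm.comp hf) v m
  simpa using this

theorem ExtZero.of_iso {E : ArrowFamily k S S} {M : ArrowFamily k V V} {N : ArrowFamily k W W}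
    (h : ExtZero E M) {e : ∀ v, V v ≃ₗ[k] W v} (he : IsHom M N fun v => (e v).toLinearMap) :
    ExtZero E N := fun η => by
  obtain ⟨g, hg⟩ := h fun a b x => (e b).symm.toLinearMap ∘ₗ η a b x
  refine ⟨fun v => (e v).toLinearMap ∘ₗ g v, fun a b x m => ?_⟩
  have h1 := congrArg (e b) (hg a b x m)
  have h2 := he a b x (g a m)
  simp only [LinearMap.comp_apply, LinearEquiv.coe_coe, LinearEquiv.apply_symm_apply, map_sub]
    at h1 h2 ⊢
  rw [h1, h2]

theorem Perp.of_iso {E : ArrowFamily k S S} {M : ArrowFamily k V V} {N : ArrowFamily k W W}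
    (h : Perp E M) {e : ∀ v, V v ≃ₗ[k] W v} (he : IsHom M N fun v => (e v).toLinearMap) :
    Perp E N := ⟨h.1.of_iso he, h.2.of_iso he⟩

/-! ### Extensions by copies of a representation -/

section Extension

variable {ι : Type*} [Fintype ι]

/-- The extension of `ι` copies of `E` by `M` with class `ξ`. -/
def extRep (M : ArrowFamily k V V) (E : ArrowFamily k S S) (ξ : ι → ArrowFamily k S V) :
    ArrowFamily k (fun v => V v × (ι → S v)) (fun v => V v × (ι → S v)) := fun a b x =>
  LinearMap.prod
    (M a b x ∘ₗ LinearMap.fst k _ _ +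
      ∑ i, ξ i a b x ∘ₗ LinearMap.proj i ∘ₗ LinearMap.snd k (V a) (ι → S a))
    (LinearMap.pi fun i => E a b x ∘ₗ LinearMap.proj i ∘ₗ LinearMap.snd k (V a) (ι → S a))

theorem extRep_apply (M : ArrowFamily k V V) (E : ArrowFamily k S S) (ξ : ι → ArrowFamily k S V)
    (a b : Q) (x : a ⟶ b) (p : V a × (ι → S a)) :
    extRep M E ξ a b x p = (M a b x p.1 + ∑ i, ξ i a b x (p.2 i), fun i => E a b x (p.2 i)) := by
  ext <;> simp [extRep]

/-- The classes of the family `ξ` in the extension group are linearly independent. -/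
def ClassesIndependent (E : ArrowFamily k S S) (M : ArrowFamily k V V)
    (ξ : ι → ArrowFamily k S V) : Prop :=
  ∀ c : ι → k, IsBoundary E M (fun a b x => ∑ i, c i • ξ i a b x) → c = 0

/-- The classes of the family `ξ` span the extension group. -/
def ClassesSpan (E : ArrowFamily k S S) (M : ArrowFamily k V V)
    (ξ : ι → ArrowFamily k S V) : Prop :=
  ∀ η : ArrowFamily k S V, ∃ c : ι → k, IsBoundary E M (fun a b x => η a b x - ∑ i, c i • ξ i a b x)

/-- The components of `E → E^ι` are scalars `c`, as `E` is a brick. The map lifts to the extension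
only if the class `∑ c i • ξ i` vanishes, so independence gives `c = 0`; what remains is a
homomorphism `E → M`. -/
theorem homZero_extRep {E : ArrowFamily k S S} (hE : IsBrick E) {M : ArrowFamily k V V}
    (hM : HomZero E M) {ξ : ι → ArrowFamily k S V} (hξ : ClassesIndependent E M ξ) :
    HomZero E (extRep M E ξ) := by
  intro f hf
  have hf' : ∀ (a b : Q) (x : a ⟶ b) (m : S a),
      M a b x (f a m).1 + ∑ i, ξ i a b x ((f a m).2 i) = (f b (E a b x m)).1 ∧
      ∀ i, E a b x ((f a m).2 i) = (f b (E a b x m)).2 i := fun a b x m => by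
    have := hf a b x m
    rw [extRep_apply] at this
    exact ⟨congrArg Prod.fst this, fun i => congrFun (congrArg Prod.snd this) i⟩
  choose c hc using fun i => hE
    (fun v => LinearMap.proj i ∘ₗ LinearMap.snd k (V v) (ι → S v) ∘ₗ f v)
    fun a b x m => (hf' a b x m).2 i
  have hc : ∀ i v m, (f v m).2 i = c i • m := hc
  have hc0 : c = 0 := by
    refine hξ c ⟨fun v => -(LinearMap.fst k (V v) (ι → S v) ∘ₗ f v), fun a b x m => ?_⟩
    have := (hf' a b x m).1
    simp only [hc, map_smul] at this
    simp [← this]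
  have h2 : ∀ v m, (f v m).2 = 0 := fun v m => by
    funext i
    rw [hc, hc0]
    simp
  have h1 := hM (fun v => LinearMap.fst k (V v) (ι → S v) ∘ₗ f v) fun a b x m => by
    have := (hf' a b x m).1
    simpa [h2] using this
  intro v m
  exact Prod.ext (h1 v m) (h2 v m)

/-- The component in `E^ι` is a boundary because `E` is rigid. The boundary may be altered by
scalars `c i`, which is exactly the freedom needed to kill the class of the remaining component in
`Ext(E, M)`. -/
theorem extZero_extRep {E : ArrowFamily k S S} (hE : ExtZero E E) {M : ArrowFamily k V V}
    {ξ : ι → ArrowFamily k S V} (hξ : ClassesSpan E M ξ) : ExtZero E (extRep M E ξ) := by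
  intro η
  choose g hg using fun i => hE
    fun a b x => LinearMap.proj i ∘ₗ LinearMap.snd k (V b) (ι → S b) ∘ₗ η a b x
  obtain ⟨c, f, hf⟩ := hξ fun a b x => LinearMap.fst k (V b) (ι → S b) ∘ₗ η a b x -
    ∑ i, ξ i a b x ∘ₗ g i a
  refine ⟨fun v => LinearMap.prod (f v) (LinearMap.pi fun i => g i v + c i • LinearMap.id),
    fun a b x m => ?_⟩
  rw [extRep_apply]
  refine Prod.ext ?_ (funext fun i => ?_)
  · have := hf a b x m
    simp only [LinearMap.sub_apply, LinearMap.comp_apply, LinearMap.fst_apply, LinearMap.sum_apply,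
      LinearMap.smul_apply] at this
    change (η a b x m).1 =
      M a b x (f a m) + ∑ i, ξ i a b x (g i a m + c i • m) - f b (E a b x m)
    simp only [map_add, map_smul, Finset.sum_add_distrib]
    rw [sub_eq_iff_eq_add, sub_eq_iff_eq_add] at this
    rw [this]
    abel
  · have := hg i a b x m
    simp only [LinearMap.comp_apply, LinearMap.snd_apply, LinearMap.proj_apply] at this
    simp [this]

/-- Homomorphisms to an object right orthogonal to `E` extend uniquely along an inclusion whose
cokernel is a sum of copies of `E`. -/
theorem existsUnique_extension {E : ArrowFamily k S S} {M : ArrowFamily k V V}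
    (ξ : ι → ArrowFamily k S V) {L : ArrowFamily k X X} (hL : Perp E L)
    {f : ∀ v, V v →ₗ[k] X v} (hf : IsHom M L f) :
    ∃! g : ∀ v, V v × (ι → S v) →ₗ[k] X v, IsHom (extRep M E ξ) L g ∧ ∀ v m, g v (m, 0) = f v m := by
  classical
  have hsum : ∀ v (g : V v × (ι → S v) →ₗ[k] X v) (p : V v × (ι → S v)),
      g p = g (p.1, 0) + ∑ i, g (0, Pi.single i (p.2 i)) := by
    intro v g p
    have h1 : p = (p.1, 0) + ∑ i, ((0 : V v), (Pi.single i (p.2 i) : ι → S v)) := by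
      refine Prod.ext (by simp [Prod.fst_sum]) ?_
      simp [Prod.snd_sum, Finset.univ_sum_single]
    conv_lhs => rw [h1]
    simp
  -- The obstruction to extending `f` over the `i`-th copy of `E` is the class of `f ∘ ξ i`, which
  -- vanishes in `Ext(E, L)`.
  choose g hg using fun i => hL.2 fun a b x => f b ∘ₗ ξ i a b x
  refine ⟨fun v => LinearMap.coprod (f v) (∑ i, g i v ∘ₗ LinearMap.proj i), ⟨?_, ?_⟩, ?_⟩
  · intro a b x p
    have h1 := hf a b x p.1
    have h2 : ∀ i, f b (ξ i a b x (p.2 i)) =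
      L a b x (g i a (p.2 i)) - g i b (E a b x (p.2 i)) := fun i => hg i a b x (p.2 i)
    rw [extRep_apply]
    simp only [LinearMap.coprod_apply, LinearMap.sum_apply,
      LinearMap.comp_apply, LinearMap.proj_apply, map_add, map_sum, h1, h2,
      Finset.sum_sub_distrib]
    abel
  · intro v m
    simp
  · rintro g' ⟨hg', hg'f⟩
    -- Two extensions differ on the `i`-th copy by a homomorphism `E → L`, which is zero.
    have key : ∀ i, ∀ v m, g' v (0, Pi.single i m) - g i v m = 0 := fun i => by
      refine hL.1 (fun v => g' v ∘ₗ LinearMap.inr k (V v) (ι → S v) ∘ₗ LinearMap.single k _ i -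
        g i v) fun a b x m => ?_
      have h1 := hg' a b x (0, Pi.single i m)
      have h2 : f b (ξ i a b x m) = L a b x (g i a m) - g i b (E a b x m) := hg i a b x m
      rw [extRep_apply] at h1
      have h3 : ∑ j, ξ j a b x ((Pi.single i m : ι → S a) j) = ξ i a b x m := by
        rw [Finset.sum_eq_single i]
        · simp
        · intro j _ hj
          simp [Pi.single_eq_of_ne hj]
        · simp
      have h4 : (fun j => E a b x ((Pi.single i m : ι → S a) j)) = Pi.single i (E a b x m) := by
        funext j
        by_cases hj : j = i
        · subst hj; simp
        · simp [Pi.single_eq_of_ne hj]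
      simp only [map_zero, zero_add, h3, h4] at h1
      have h5 := g' b |>.map_add (ξ i a b x m, 0) (0, Pi.single i (E a b x m))
      simp only [Prod.mk_add_mk, add_zero, zero_add] at h5
      rw [h5, hg'f, h2] at h1
      simp only [LinearMap.sub_apply, LinearMap.comp_apply, LinearMap.inr_apply,
        LinearMap.single_apply, map_sub, h1]
      abel
    funext v
    refine LinearMap.ext fun p => ?_
    rw [hsum v (g' v) p, hg'f]
    simp only [LinearMap.coprod_apply, LinearMap.sum_apply,
      LinearMap.comp_apply, LinearMap.proj_apply]
    congr 1
    exact Finset.sum_congr rfl fun i _ => sub_eq_zero.1 (key i v (p.2 i))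

end Extension

/-! ### Quotients by the trace of a representation -/

section Trace

variable {ι : Type*} [Fintype ι]

/-- The quotient of a representation by a subrepresentation. -/
def quotRep (M : ArrowFamily k V V) (I : ∀ v, Submodule k (V v))
    (hI : ∀ (a b : Q) (x : a ⟶ b), ∀ w ∈ I a, M a b x w ∈ I b) :
    ArrowFamily k (fun v => V v ⧸ I v) (fun v => V v ⧸ I v) :=
  fun a b x => (I a).mapQ (I b) (M a b x) (hI a b x)

theorem sumMap_range_stable {E : ArrowFamily k S S} {M : ArrowFamily k V V}
    {φ : ι → ∀ v, S v →ₗ[k] V v} (hφ : ∀ i, IsHom E M (φ i)) (a b : Q) (x : a ⟶ b) :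
    ∀ w ∈ LinearMap.range (sumMap φ a), M a b x w ∈ LinearMap.range (sumMap φ b) := by
  rintro _ ⟨m, rfl⟩
  refine ⟨fun i => E a b x (m i), ?_⟩
  simp [sumMap_apply, hφ _ a b x]

/-- A cocycle with values in the trace of `E` is the boundary of a family with values in the
trace, as `E` has no self-extensions. -/
theorem exists_boundary_in_trace {E : ArrowFamily k S S} (hE : ExtZero E E)
    {M : ArrowFamily k V V} {φ : ι → ∀ v, S v →ₗ[k] V v} (hφ : ∀ i, IsHom E M (φ i))
    (ζ : ArrowFamily k S V) (hζ : ∀ a b x m, ζ a b x m ∈ LinearMap.range (sumMap φ b)) :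
    ∃ g : ∀ v, S v →ₗ[k] V v, (∀ v m, g v m ∈ LinearMap.range (sumMap φ v)) ∧
      ∀ (a b : Q) (x : a ⟶ b) (m : S a), ζ a b x m = M a b x (g a m) - g b (E a b x m) := by
  -- A quiver imposes no relations, so there is no cocycle condition: any arrowwise lift to `E^ι`
  -- represents a class, and that class vanishes by rigidity.
  have lift : ∀ a b x, ∃ η : S a →ₗ[k] (ι → S b), ∀ m, sumMap φ b (η m) = ζ a b x m := by
    intro a b x
    obtain ⟨r, hr⟩ := (sumMap φ b).rangeRestrict.exists_rightInverse_of_surjective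
      (LinearMap.range_rangeRestrict _)
    refine ⟨r ∘ₗ LinearMap.codRestrict _ (ζ a b x) (hζ a b x), fun m => ?_⟩
    exact congrArg Subtype.val (LinearMap.congr_fun hr ⟨ζ a b x m, hζ a b x m⟩)
  choose η hη using lift
  choose g hg using fun i => hE fun a b x => LinearMap.proj i ∘ₗ η a b x
  refine ⟨fun v => sumMap φ v ∘ₗ LinearMap.pi fun i => g i v, fun v m => ⟨_, rfl⟩,
    fun a b x m => ?_⟩
  have hg : ∀ i, η a b x m i = E a b x (g i a m) - g i b (E a b x m) := fun i => hg i a b x m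
  rw [← hη]
  simp only [sumMap_apply, LinearMap.comp_apply, LinearMap.pi_apply, hg, map_sub, map_sum,
    Finset.sum_sub_distrib, hφ _ a b x]

variable {E : ArrowFamily k S S} {M : ArrowFamily k V V} {φ : ι → ∀ v, S v →ₗ[k] V v}

/-- The quotient of `M` by the image of `E^ι → M`. -/
def traceQuot (hφ : ∀ i, IsHom E M (φ i)) :
    ArrowFamily k (fun v => V v ⧸ LinearMap.range (sumMap φ v))
      (fun v => V v ⧸ LinearMap.range (sumMap φ v)) :=
  quotRep M _ (sumMap_range_stable hφ)

theorem traceQuot_mk (hφ : ∀ i, IsHom E M (φ i)) (a b : Q) (x : a ⟶ b) (m : V a) :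
    traceQuot hφ a b x (Submodule.Quotient.mk m) = Submodule.Quotient.mk (M a b x m) := rfl

theorem exists_lift_quotient {A B : Type*} [AddCommGroup A] [Module k A] [AddCommGroup B]
    [Module k B] (I : Submodule k B) (f : A →ₗ[k] B ⧸ I) :
    ∃ g : A →ₗ[k] B, ∀ m, Submodule.Quotient.mk (g m) = f m := by
  obtain ⟨r, hr⟩ := I.mkQ.exists_rightInverse_of_surjective (Submodule.range_mkQ I)
  exact ⟨r ∘ₗ f, fun m => LinearMap.congr_fun hr (f m)⟩

/-- The trace is a quotient of a sum of copies of `E`, so its `Ext` from `E` vanishes. Every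
homomorphism `E → M/tr` therefore lifts to `M`, where its image lies in the trace. -/
theorem homZero_traceQuot (hE : ExtZero E E) (hφ : ∀ i, IsHom E M (φ i))
    (hspan : ∀ f, IsHom E M f → ∃ c : ι → k, ∀ v m, f v m = ∑ i, c i • φ i v m) :
    HomZero E (traceQuot hφ) := by
  intro f hf
  choose F hF using fun v => exists_lift_quotient _ (f v)
  obtain ⟨g, hg, hgb⟩ := exists_boundary_in_trace hE hφ
    (fun a b x => M a b x ∘ₗ F a - F b ∘ₗ E a b x) fun a b x m => by
      rw [← Submodule.Quotient.mk_eq_zero]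
      have := hf a b x m
      rw [← hF, ← hF, traceQuot_mk] at this
      simp [this]
  obtain ⟨c, hc⟩ := hspan (fun v => F v - g v) fun a b x m => by
    have := hgb a b x m
    simp only [LinearMap.sub_apply, LinearMap.comp_apply, map_sub] at this ⊢
    rw [sub_eq_sub_iff_add_eq_add] at this ⊢
    rw [this]
    abel
  intro v m
  rw [← hF, Submodule.Quotient.mk_eq_zero]
  have h1 := hc v m
  rw [LinearMap.sub_apply, sub_eq_iff_eq_add] at h1
  rw [h1]
  exact add_mem ⟨fun i => c i • m, by simp [sumMap_apply]⟩ (hg v m)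

/-- This is the injectivity of `Ext(E, M) → Ext(E, M/tr)`, again because `Ext(E, tr) = 0`. -/
theorem isBoundary_of_isBoundary_traceQuot (hE : ExtZero E E) (hφ : ∀ i, IsHom E M (φ i))
    {η : ArrowFamily k S V}
    (hη : IsBoundary E (traceQuot hφ) fun a b x => Submodule.mkQ _ ∘ₗ η a b x) :
    IsBoundary E M η := by
  obtain ⟨f, hf⟩ := hη
  choose F hF using fun v => exists_lift_quotient _ (f v)
  obtain ⟨g, hg, hgb⟩ := exists_boundary_in_trace hE hφ
    (fun a b x => η a b x - (M a b x ∘ₗ F a - F b ∘ₗ E a b x)) fun a b x m => by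
      rw [← Submodule.Quotient.mk_eq_zero]
      have := hf a b x m
      rw [← hF, ← hF, traceQuot_mk] at this
      simp only [LinearMap.comp_apply, Submodule.mkQ_apply] at this
      simp [this]
  refine ⟨fun v => F v + g v, fun a b x m => ?_⟩
  have := hgb a b x m
  simp only [LinearMap.sub_apply, LinearMap.comp_apply, LinearMap.add_apply, map_add] at this ⊢
  rw [sub_eq_iff_eq_add] at this
  rw [this]
  abel

theorem classesIndependent_traceQuot {κ : Type*} [Fintype κ] (hE : ExtZero E E)
    (hφ : ∀ i, IsHom E M (φ i)) {ξ : κ → ArrowFamily k S V} (hξ : ClassesIndependent E M ξ) :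
    ClassesIndependent E (traceQuot hφ) fun i a b x => Submodule.mkQ _ ∘ₗ ξ i a b x := by
  intro c hc
  refine hξ c (isBoundary_of_isBoundary_traceQuot hE hφ ?_)
  convert hc using 4 with a b x
  ext m
  simp

theorem classesSpan_traceQuot {κ : Type*} [Fintype κ] (hφ : ∀ i, IsHom E M (φ i))
    {ξ : κ → ArrowFamily k S V} (hξ : ClassesSpan E M ξ) :
    ClassesSpan E (traceQuot hφ) fun i a b x => Submodule.mkQ _ ∘ₗ ξ i a b x := by
  intro η
  choose H hH using fun a b x => exists_lift_quotient _ (η a b x)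
  obtain ⟨c, g, hg⟩ := hξ H
  refine ⟨c, fun v => Submodule.mkQ _ ∘ₗ g v, fun a b x m => ?_⟩
  have := congrArg (Submodule.Quotient.mk (p := LinearMap.range (sumMap φ b))) (hg a b x m)
  simp only [LinearMap.sub_apply, LinearMap.sum_apply, LinearMap.smul_apply,
    LinearMap.comp_apply, Submodule.mkQ_apply] at this ⊢
  rw [traceQuot_mk, ← Submodule.Quotient.mk_sub, ← this, ← hH]
  simp only [← Submodule.mkQ_apply, map_sub, map_sum, map_smul]

end Trace

end Abstract


/-! ### Short exact sequences of representations. -/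

section ShortExact

variable {k : Type*} [Field k] {Q : Type*} [Quiver Q]
variable {V W X S : Q → Type*}
  [∀ v, AddCommGroup (V v)] [∀ v, Module k (V v)]
  [∀ v, AddCommGroup (W v)] [∀ v, Module k (W v)]
  [∀ v, AddCommGroup (X v)] [∀ v, Module k (X v)]
  [∀ v, AddCommGroup (S v)] [∀ v, Module k (S v)]

/-- `0 → A → N → L → 0` is a short exact sequence of representations. -/
structure IsShortExact (A : ArrowFamily k V V) (N : ArrowFamily k W W) (L : ArrowFamily k X X)
    (i : ∀ v, V v →ₗ[k] W v) (p : ∀ v, W v →ₗ[k] X v) : Prop where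
  hom_left : IsHom A N i
  hom_right : IsHom N L p
  injective : ∀ v, Function.Injective (i v)
  surjective : ∀ v, Function.Surjective (p v)
  exact : ∀ v m, p v m = 0 ↔ ∃ a, i v a = m

/-- A homomorphism killed by `p` factors through the kernel of `p`. -/
theorem IsShortExact.exists_factor {A : ArrowFamily k V V} {N : ArrowFamily k W W}
    {L : ArrowFamily k X X} {i : ∀ v, V v →ₗ[k] W v} {p : ∀ v, W v →ₗ[k] X v}
    (h : IsShortExact A N L i p) {E : ArrowFamily k S S} {f : ∀ v, S v →ₗ[k] W v}
    (hf : IsHom E N f) (hpf : ∀ v m, p v (f v m) = 0) :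
    ∃ g : ∀ v, S v →ₗ[k] V v, IsHom E A g ∧ ∀ v m, f v m = i v (g v m) := by
  let e : ∀ v, V v ≃ₗ[k] LinearMap.range (i v) := fun v => LinearEquiv.ofInjective _ (h.injective v)
  have he : ∀ v n, i v ((e v).symm n) = n := fun v n =>
    congrArg Subtype.val ((e v).apply_symm_apply n)
  refine ⟨fun v => (e v).symm.toLinearMap ∘ₗ LinearMap.codRestrict _ (f v)
    fun m => (h.exact v _).1 (hpf v m), fun a b x m => ?_, fun v m => ?_⟩
  · apply h.injective b
    have h1 := h.hom_left a b x ((e a).symm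
      (LinearMap.codRestrict _ (f a) (fun m => (h.exact a _).1 (hpf a m)) m))
    simp only [LinearMap.comp_apply, LinearEquiv.coe_coe]
    rw [← h1, he, he]
    exact hf a b x m
  · simp only [LinearMap.comp_apply, LinearEquiv.coe_coe]
    rw [he]
    rfl

theorem IsShortExact.homZero_left {A : ArrowFamily k V V} {N : ArrowFamily k W W}
    {L : ArrowFamily k X X} {i : ∀ v, V v →ₗ[k] W v} {p : ∀ v, W v →ₗ[k] X v}
    (h : IsShortExact A N L i p) {E : ArrowFamily k S S} (hN : HomZero E N) : HomZero E A := by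
  intro f hf v m
  apply h.injective v
  rw [map_zero]
  exact hN _ (h.hom_left.comp hf) v m

theorem IsShortExact.transport {A : ArrowFamily k V V} {N : ArrowFamily k W W}
    {L : ArrowFamily k X X} {i : ∀ v, V v →ₗ[k] W v} {p : ∀ v, W v →ₗ[k] X v}
    (h : IsShortExact A N L i p) {W' : Q → Type*} [∀ v, AddCommGroup (W' v)]
    [∀ v, Module k (W' v)] (e : ∀ v, W v ≃ₗ[k] W' v) :
    IsShortExact A (transport N e) L (fun v => (e v).toLinearMap ∘ₗ i v)
      (fun v => p v ∘ₗ (e v).symm.toLinearMap) where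
  hom_left := (isHom_transport N e).comp h.hom_left
  hom_right := h.hom_right.comp (isHom_transport_symm N e)
  injective v := (e v).injective.comp (h.injective v)
  surjective v := (h.surjective v).comp (e v).symm.surjective
  exact v m := by
    simp only [LinearMap.comp_apply, LinearEquiv.coe_coe, h.exact]
    exact exists_congr fun a => (e v).eq_symm_apply

theorem IsShortExact.transport_left {A : ArrowFamily k V V} {N : ArrowFamily k W W}
    {L : ArrowFamily k X X} {i : ∀ v, V v →ₗ[k] W v} {p : ∀ v, W v →ₗ[k] X v}
    (h : IsShortExact A N L i p) {V' : Q → Type*} [∀ v, AddCommGroup (V' v)]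
    [∀ v, Module k (V' v)] (e : ∀ v, V v ≃ₗ[k] V' v) :
    IsShortExact (QuiverRep.transport A e) N L (fun v => i v ∘ₗ (e v).symm.toLinearMap) p where
  hom_left := h.hom_left.comp (isHom_transport_symm A e)
  hom_right := h.hom_right
  injective v := (h.injective v).comp (e v).symm.injective
  surjective v := h.surjective v
  exact v m := by
    rw [h.exact]
    exact ⟨fun ⟨a, ha⟩ => ⟨e v a, by simpa using ha⟩, fun ⟨a, ha⟩ => ⟨(e v).symm a, ha⟩⟩

theorem IsShortExact.transport_right {A : ArrowFamily k V V} {N : ArrowFamily k W W}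
    {L : ArrowFamily k X X} {i : ∀ v, V v →ₗ[k] W v} {p : ∀ v, W v →ₗ[k] X v}
    (h : IsShortExact A N L i p) {X' : Q → Type*} [∀ v, AddCommGroup (X' v)]
    [∀ v, Module k (X' v)] (e : ∀ v, X v ≃ₗ[k] X' v) :
    IsShortExact A N (QuiverRep.transport L e) i (fun v => (e v).toLinearMap ∘ₗ p v) where
  hom_left := h.hom_left
  hom_right := (isHom_transport L e).comp h.hom_right
  injective v := h.injective v
  surjective v := (e v).surjective.comp (h.surjective v)
  exact v m := by simp [h.exact]

theorem isShortExact_extRep (M : ArrowFamily k V V) (E : ArrowFamily k S S)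
    (ξ : Fin 1 → ArrowFamily k S V) :
    IsShortExact M (extRep M E ξ) E (fun v => LinearMap.inl k (V v) (Fin 1 → S v))
      (fun v => LinearMap.proj 0 ∘ₗ LinearMap.snd k (V v) (Fin 1 → S v)) where
  hom_left a b x m := by
    rw [extRep_apply]
    simp
    rfl
  hom_right a b x m := by
    rw [extRep_apply]
    simp
  injective v := LinearMap.inl_injective
  surjective v m := ⟨(0, fun _ => m), rfl⟩
  exact v m := by
    constructor
    · intro h
      refine ⟨m.1, Prod.ext rfl (funext fun j => ?_)⟩
      rw [Subsingleton.elim j 0]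
      exact h.symm
    · rintro ⟨a, rfl⟩
      rfl

/-- The direct sum of two representations. -/
def sumRep (A : ArrowFamily k V V) (B : ArrowFamily k W W) :
    ArrowFamily k (fun v => V v × W v) (fun v => V v × W v) :=
  fun a b x => LinearMap.prodMap (A a b x) (B a b x)

theorem isShortExact_sumRep (A : ArrowFamily k V V) (B : ArrowFamily k W W) :
    IsShortExact A (sumRep A B) B (fun v => LinearMap.inl k (V v) (W v))
      (fun v => LinearMap.snd k (V v) (W v)) where
  hom_left a b x m := by simp [sumRep]
  hom_right a b x m := by simp [sumRep]
  injective v := LinearMap.inl_injective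
  surjective v := LinearMap.snd_surjective
  exact v m := by
    constructor
    · intro h
      exact ⟨m.1, Prod.ext rfl h.symm⟩
    · rintro ⟨a, rfl⟩
      rfl

theorem isShortExact_quotRep (M : ArrowFamily k V V) (I : ∀ v, Submodule k (V v))
    (hI : ∀ (a b : Q) (x : a ⟶ b), ∀ w ∈ I a, M a b x w ∈ I b) :
    IsShortExact (V := fun v => I v) (fun a b x => (M a b x).restrict (hI a b x)) M (quotRep M I hI)
      (fun v => (I v).subtype) (fun v => (I v).mkQ) where
  hom_left a b x m := rfl
  hom_right a b x m := rfl
  injective v := (I v).subtype_injective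
  surjective v := (I v).mkQ_surjective
  exact v m := by simp

theorem IsHom.range_stable {A : ArrowFamily k V V} {N : ArrowFamily k W W}
    {f : ∀ v, V v →ₗ[k] W v} (hf : IsHom A N f) (a b : Q) (x : a ⟶ b) :
    ∀ w ∈ LinearMap.range (f a), N a b x w ∈ LinearMap.range (f b) := by
  rintro _ ⟨m, rfl⟩
  exact ⟨_, (hf a b x m).symm⟩

theorem IsHom.ker_stable {A : ArrowFamily k V V} {N : ArrowFamily k W W}
    {f : ∀ v, V v →ₗ[k] W v} (hf : IsHom A N f) (a b : Q) (x : a ⟶ b) :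
    ∀ w ∈ LinearMap.ker (f a), A a b x w ∈ LinearMap.ker (f b) := by
  intro w hw
  rw [LinearMap.mem_ker] at hw ⊢
  rw [← hf a b x w, hw, map_zero]

/-- Homomorphisms to an object right orthogonal to `E` extend uniquely along the kernel of a
surjection onto `E`. -/
theorem IsShortExact.existsUnique_extension {A : ArrowFamily k V V} {N : ArrowFamily k W W}
    {E : ArrowFamily k S S} {i : ∀ v, V v →ₗ[k] W v} {p : ∀ v, W v →ₗ[k] S v}
    (h : IsShortExact A N E i p) {L : ArrowFamily k X X} (hL : Perp E L)
    {f : ∀ v, V v →ₗ[k] X v} (hf : IsHom A L f) :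
    ∃! g : ∀ v, W v →ₗ[k] X v, IsHom N L g ∧ ∀ v m, g v (i v m) = f v m := by
  have hdesc : ∀ (a b : Q) (u : W a →ₗ[k] X b), (∀ m, u (i a m) = 0) →
      ∃ ū : S a →ₗ[k] X b, ∀ w, ū (p a w) = u w := by
    intro a b u hu
    obtain ⟨s, hs⟩ := (p a).exists_rightInverse_of_surjective
      (LinearMap.range_eq_top.2 (h.surjective a))
    refine ⟨u ∘ₗ s, fun w => ?_⟩
    have h1 : p a (s (p a w)) = p a w := LinearMap.congr_fun hs (p a w)
    obtain ⟨m, hm⟩ := (h.exact a (s (p a w) - w)).1 (by rw [map_sub, h1, sub_self])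
    have h2 := hu m
    rw [hm, map_sub, sub_eq_zero] at h2
    exact h2
  have hret : ∀ v, ∃ ρ : W v →ₗ[k] V v, ∀ m, ρ (i v m) = m := fun v => by
    obtain ⟨ρ, hρ⟩ := (i v).exists_leftInverse_of_injective (LinearMap.ker_eq_bot.2 (h.injective v))
    exact ⟨ρ, fun m => LinearMap.congr_fun hρ m⟩
  choose ρ hρ using hret
  -- Extended linearly by the retraction `ρ`, `f` fails to commute with the arrows by a cochain that
  -- vanishes on the image of `i`, so it descends to `E`. As `Ext(E, L) = 0`, that cochain is a
  -- boundary and corrects the extension.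
  choose ζ hζ using fun a b (x : a ⟶ b) =>
    hdesc a b (L a b x ∘ₗ f a ∘ₗ ρ a - f b ∘ₗ ρ b ∘ₗ N a b x) fun m => by
      have h1 := h.hom_left a b x m
      have h2 := hf a b x m
      simp only [LinearMap.sub_apply, LinearMap.comp_apply, h1, hρ, h2, sub_self]
  obtain ⟨g, hg⟩ := hL.2 ζ
  refine ⟨fun v => f v ∘ₗ ρ v - g v ∘ₗ p v, ⟨fun a b x w => ?_, fun v m => ?_⟩, ?_⟩
  · have h1 := hζ a b x w
    rw [hg, h.hom_right] at h1
    simp only [LinearMap.sub_apply, LinearMap.comp_apply, map_sub] at h1 ⊢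
    rw [sub_eq_sub_iff_add_eq_add] at h1 ⊢
    rw [add_comm, ← add_comm (L a b x (g a (p a w))), h1]
    abel
  · simp [hρ, (h.exact v (i v m)).2 ⟨m, rfl⟩]
  · rintro g' ⟨hg', hg'f⟩
    choose u hu using fun v => hdesc v v (g' v - (f v ∘ₗ ρ v - g v ∘ₗ p v)) fun m => by
      simp [hρ, (h.exact v (i v m)).2 ⟨m, rfl⟩, hg'f]
    have hu0 := hL.1 u fun a b x m => by
      obtain ⟨w, rfl⟩ := h.surjective a m
      rw [h.hom_right, hu, hu]
      have h1 := hζ a b x w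
      rw [hg, h.hom_right] at h1
      have h2 := hg' a b x w
      simp only [LinearMap.sub_apply, LinearMap.comp_apply, map_sub] at h1 ⊢
      rw [h2, sub_right_inj]
      rw [sub_eq_sub_iff_add_eq_add] at h1 ⊢
      rw [add_comm, ← add_comm (L a b x (g a (p a w))), h1]
      abel
    funext v
    ext w
    have := hu v w
    rw [hu0] at this
    exact sub_eq_zero.1 this.symm

end ShortExact

/-! ### Bases of subspaces and quotients. -/

section LinearAlgebra

variable {k : Type*} [Field k] {V : Type*} [AddCommGroup V] [Module k V]

theorem exists_spanning_family [FiniteDimensional k V] (p : Submodule k V) :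
    ∃ b : Fin (Module.finrank k p) → V, (∀ i, b i ∈ p) ∧
      ∀ w ∈ p, ∃ c : Fin (Module.finrank k p) → k, w = ∑ i, c i • b i := by
  let b := Module.finBasis k p
  refine ⟨fun i => b i, fun i => (b i).2, fun w hw => ⟨b.repr ⟨w, hw⟩, ?_⟩⟩
  have h1 := congrArg p.subtype (b.sum_repr ⟨w, hw⟩)
  rw [map_sum] at h1
  exact h1.symm

theorem finrank_submodule_eq_one_iff (p : Submodule k V) :
    Module.finrank k p = 1 ↔ ∃ w ∈ p, w ≠ 0 ∧ ∀ u ∈ p, ∃ c : k, c • w = u := by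
  rw [finrank_eq_one_iff']
  constructor
  · rintro ⟨w, hw, h⟩
    refine ⟨w, w.2, fun h0 => hw (Subtype.ext h0), fun u hu => ?_⟩
    obtain ⟨c, hc⟩ := h ⟨u, hu⟩
    exact ⟨c, congrArg Subtype.val hc⟩
  · rintro ⟨w, hw, hw0, h⟩
    refine ⟨⟨w, hw⟩, fun h0 => hw0 (congrArg Subtype.val h0), fun u => ?_⟩
    obtain ⟨c, hc⟩ := h u u.2
    exact ⟨c, Subtype.ext hc⟩

theorem finrank_quotient_eq_zero_iff [FiniteDimensional k V] (p : Submodule k V) :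
    Module.finrank k (V ⧸ p) = 0 ↔ ∀ v, v ∈ p := by
  rw [Module.finrank_zero_iff, ← Submodule.eq_top_iff']
  exact Submodule.Quotient.subsingleton_iff

theorem exists_quotient_basis [FiniteDimensional k V] (p : Submodule k V) :
    ∃ ξ : Fin (Module.finrank k (V ⧸ p)) → V, 
      (∀ c : Fin (Module.finrank k (V ⧸ p)) → k, ∑ i, c i • ξ i ∈ p → c = 0) ∧
      ∀ w, ∃ c : Fin (Module.finrank k (V ⧸ p)) → k, w - ∑ i, c i • ξ i ∈ p := by
  let b := Module.finBasis k (V ⧸ p)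
  choose ξ hξ using fun i => p.mkQ_surjective (b i)
  refine ⟨ξ, fun c hc => ?_, fun w => ⟨b.repr (p.mkQ w), ?_⟩⟩
  · rw [← Submodule.Quotient.mk_eq_zero, ← Submodule.mkQ_apply, map_sum] at hc
    simp only [map_smul, hξ] at hc
    funext i
    exact Fintype.linearIndependent_iff.1 b.linearIndependent c hc i
  · rw [← Submodule.Quotient.mk_eq_zero, ← Submodule.mkQ_apply, map_sub, map_sum]
    simp only [map_smul, hξ]
    rw [b.sum_repr, sub_self]

theorem finrank_vertexMaps {Q : Type*} [Fintype Q] {α β : Q → ℕ} :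
    (Module.finrank k (VertexMaps k α β) : ℤ) = ∑ v, (α v : ℤ) * β v := by
  rw [Module.finrank_pi_fintype]
  simp [Module.finrank_linearMap]

end LinearAlgebra

/-! ### The dimensions of Hom and Ext, and the Euler form. -/

section Dimension

variable {k : Type*} [Field k] {Q : Type*} [Quiver Q] {α β ε : Q → ℕ}

theorem mem_homSpace_iff (M : RepSpace k α) (N : RepSpace k β) (f : VertexMaps k α β) :
    f ∈ homSpace M N ↔ IsHom M N f := by
  rw [mem_homSpace]
  exact forall_congr' fun a => forall_congr' fun b => forall_congr' fun x => LinearMap.ext_iff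

theorem isBoundary_iff (M : RepSpace k α) (N : RepSpace k β) (η : ArrowMaps k α β) :
    IsBoundary M N η ↔ η ∈ LinearMap.range (diff M N) := by
  constructor
  · rintro ⟨g, hg⟩
    refine ⟨g, ?_⟩
    funext a b x
    refine LinearMap.ext fun m => ?_
    exact (hg a b x m).symm
  · rintro ⟨g, rfl⟩
    exact ⟨g, fun a b x m => rfl⟩

theorem homDim_eq_zero_iff [Finite Q] (M : RepSpace k α) (N : RepSpace k β) :
    homDim M N = 0 ↔ HomZero M N := by
  rw [homDim, Submodule.finrank_eq_zero, Submodule.eq_bot_iff]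
  constructor
  · intro h f hf v m
    rw [h f ((mem_homSpace_iff M N f).2 hf)]
    rfl
  · intro h f hf
    funext v
    exact LinearMap.ext fun m => h f ((mem_homSpace_iff M N f).1 hf) v m

theorem extDim_eq_zero_iff [Fintype Q] [∀ a b : Q, Fintype (a ⟶ b)]
    (M : RepSpace k α) (N : RepSpace k β) :
    extDim M N = 0 ↔ ExtZero M N := by
  rw [extDim, finrank_quotient_eq_zero_iff]
  exact forall_congr' fun η => (isBoundary_iff M N η).symm

theorem orthogonal_iff [Fintype Q] [∀ a b : Q, Fintype (a ⟶ b)]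
    (M : RepSpace k α) (N : RepSpace k β) :
    Orthogonal M N ↔ Perp M N :=
  and_congr (homDim_eq_zero_iff M N) (extDim_eq_zero_iff M N)

theorem finrank_arrowMaps [Fintype Q] [∀ a b : Q, Fintype (a ⟶ b)] :
    (Module.finrank k (ArrowMaps k α β) : ℤ) =
    ∑ a, ∑ b, ∑ _x : a ⟶ b, (α a : ℤ) * β b := by
  simp [Module.finrank_pi_fintype (R := k), Module.finrank_linearMap]

/-- Rank-nullity for the two-term complex: kernel minus cokernel is the difference of the dimensions
of its terms. -/
theorem homDim_sub_extDim [Fintype Q] [∀ a b : Q, Fintype (a ⟶ b)]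
    (M : RepSpace k α) (N : RepSpace k β) :
    (homDim M N : ℤ) - extDim M N = eulerForm α β := by
  have h1 := LinearMap.finrank_range_add_finrank_ker (diff M N)
  have h2 := Submodule.finrank_quotient_add_finrank (LinearMap.range (diff M N))
  rw [eulerForm, ← finrank_vertexMaps (k := k), ← finrank_arrowMaps (k := k), ← h1, ← h2]
  change (Module.finrank k (LinearMap.ker (diff M N)) : ℤ) -
    Module.finrank k (ArrowMaps k α β ⧸ LinearMap.range (diff M N)) = _
  push_cast
  ring

theorem eulerForm_sub [Fintype Q] [∀ a b : Q, Fintype (a ⟶ b)]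
    (hle : ε ≤ α) : eulerForm β (α - ε) = eulerForm β α - eulerForm β ε := by
  simp only [eulerForm, Pi.sub_apply, Nat.cast_sub (hle _), mul_sub, Finset.sum_sub_distrib]
  ring

theorem isBrick_of_homDim_eq_one {E : RepSpace k ε} (h : homDim E E = 1) : IsBrick E := by
  intro f hf
  obtain ⟨w, -, hw0, hw⟩ := (finrank_submodule_eq_one_iff _).1 h
  have hid : (fun _ => LinearMap.id : VertexMaps k ε ε) ∈ homSpace E E :=
    (mem_homSpace_iff E E _).2 fun a b x m => rfl
  obtain ⟨c, hc⟩ := hw _ hid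
  obtain ⟨d, hd⟩ := hw f ((mem_homSpace_iff E E f).2 hf)
  have hc0 : c ≠ 0 := by
    rintro rfl
    rw [zero_smul] at hc
    refine hw0 ?_
    funext u
    refine LinearMap.ext fun m => ?_
    have : (LinearMap.id : (Fin (ε u) → k) →ₗ[k] _) = 0 := (congrFun hc u).symm
    have hm : m = 0 := LinearMap.congr_fun this m
    rw [hm, map_zero, map_zero]
  refine ⟨d * c⁻¹, fun u m => ?_⟩
  have h1 : m = c • w u m :=
    (LinearMap.congr_fun (congrFun hc u) m).symm
  conv_rhs => rw [h1]
  rw [← hd, smul_smul, mul_assoc, inv_mul_cancel₀ hc0, mul_one]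
  rfl

theorem exists_hom_basis [Finite Q] (M : RepSpace k α) (N : RepSpace k β) :
    ∃ φ : Fin (homDim M N) → VertexMaps k α β, (∀ i, IsHom M N (φ i)) ∧
      ∀ f, IsHom M N f → ∃ c : Fin (homDim M N) → k, ∀ v m, f v m = ∑ i, c i • φ i v m := by
  obtain ⟨b, hb, hspan⟩ := exists_spanning_family (homSpace M N)
  refine ⟨b, fun i => (mem_homSpace_iff M N _).1 (hb i), fun f hf => ?_⟩
  obtain ⟨c, rfl⟩ := hspan f ((mem_homSpace_iff M N f).2 hf)
  refine ⟨c, fun v m => ?_⟩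
  simp only [Finset.sum_apply, LinearMap.sum_apply]
  rfl

theorem exists_ext_basis [Fintype Q] [∀ a b : Q, Fintype (a ⟶ b)]
    (M : RepSpace k α) (N : RepSpace k β) :
    ∃ ξ : Fin (extDim M N) → ArrowMaps k α β, ClassesIndependent M N ξ ∧ ClassesSpan M N ξ := by
  obtain ⟨ξ, hind, hspan⟩ := exists_quotient_basis (LinearMap.range (diff M N))
  refine ⟨ξ, fun c hc => hind c ?_, fun η => ?_⟩
  · rw [← isBoundary_iff]
    convert hc using 4
    simp only [Finset.sum_apply]
    rfl
  · obtain ⟨c, hc⟩ := hspan η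
    refine ⟨c, ?_⟩
    rw [← isBoundary_iff] at hc
    convert hc using 4
    simp only [Pi.sub_apply, Finset.sum_apply]
    rfl

end Dimension


/-! ### The orthogonal projection and the exceptional set. -/

section Projection

variable {k : Type*} [Field k] {Q : Type*} [Quiver Q] {α β γ ε : Q → ℕ}

/-- The uniqueness of universal objects; it allows any value of the projection to be replaced by the
explicit model. -/
theorem IsProjection.exists_iso {E : RepSpace k ε} {M : RepSpace k α} {N : RepSpace k β}
    {N' : RepSpace k γ} {r : VertexMaps k α β} {r' : VertexMaps k α γ}
    (h : IsProjection E M N r) (h' : IsProjection E M N' r') :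
    ∃ e : ∀ v, (Fin (β v) → k) ≃ₗ[k] (Fin (γ v) → k),
      IsHom N N' fun v => (e v).toLinearMap := by
  obtain ⟨g, ⟨hg, hgr⟩, -⟩ := h.2.2 γ N' h'.1 r' h'.2.1
  obtain ⟨g', ⟨hg', hgr'⟩, -⟩ := h'.2.2 β N h.1 r h.2.1
  have h1 : (fun v => g' v ∘ₗ g v) = fun v => LinearMap.id := by
    refine (h.2.2 β N h.1 r h.2.1).unique ⟨?_, fun v => ?_⟩ ⟨?_, fun v => rfl⟩
    · rw [mem_homSpace_iff] at hg hg' ⊢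
      exact hg'.comp hg
    · rw [LinearMap.comp_assoc, hgr, hgr']
    · exact (mem_homSpace_iff _ _ _).2 fun a b x m => rfl
  have h2 : (fun v => g v ∘ₗ g' v) = fun v => LinearMap.id := by
    refine (h'.2.2 γ N' h'.1 r' h'.2.1).unique ⟨?_, fun v => ?_⟩ ⟨?_, fun v => rfl⟩
    · rw [mem_homSpace_iff] at hg hg' ⊢
      exact hg.comp hg'
    · rw [LinearMap.comp_assoc, hgr', hgr]
    · exact (mem_homSpace_iff _ _ _).2 fun a b x m => rfl
  exact ⟨fun v => LinearEquiv.ofLinearMap (g v) (g' v) (congrFun h2 v) (congrFun h1 v),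
    (mem_homSpace_iff _ _ _).1 hg⟩

theorem ClassesIndependent.comp_succ {V W : Q → Type*} [∀ v, AddCommGroup (V v)]
    [∀ v, Module k (V v)] [∀ v, AddCommGroup (W v)] [∀ v, Module k (W v)]
    {A : ArrowFamily k V V} {B : ArrowFamily k W W} {n : ℕ}
    {ξ : Fin (n + 1) → ArrowFamily k V W} (h : ClassesIndependent A B ξ) :
    ClassesIndependent A B fun i : Fin n => ξ i.succ := by
  intro c hc
  have h1 := h (Fin.cons 0 c) (by simpa [Fin.sum_univ_succ] using hc)
  funext i
  simpa using congrFun h1 i.succ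

variable [Fintype Q] [∀ a b : Q, Fintype (a ⟶ b)]

/-- The orthogonal projection of `M` is an extension of copies of `E` by the quotient of `M` by the
trace of `E`. -/
theorem isProjection_extRep_traceQuot {E : RepSpace k ε} (hE : IsBrick E) (hEE : ExtZero E E)
    {M : RepSpace k α} {ι κ : Type*} [Fintype ι] [Fintype κ] {φ : ι → VertexMaps k ε α}
    (hφ : ∀ i, IsHom E M (φ i))
    (hspan : ∀ f, IsHom E M f → ∃ c : ι → k, ∀ v m, f v m = ∑ i, c i • φ i v m)
    {ξ : κ → ArrowMaps k ε α} (hξ : ClassesIndependent E M ξ) (hξ' : ClassesSpan E M ξ)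
    (e : ∀ v, (((Fin (α v) → k) ⧸ LinearMap.range (sumMap φ v)) × (κ → Fin (ε v) → k)) ≃ₗ[k]
      (Fin (γ v) → k)) :
    IsProjection E M
      (transport (extRep (traceQuot hφ) E fun i a b x => Submodule.mkQ _ ∘ₗ ξ i a b x) e)
      (fun v => (e v).toLinearMap ∘ₗ LinearMap.inl k _ _ ∘ₗ Submodule.mkQ _) := by
  have hperp : Perp E (extRep (traceQuot hφ) E fun i a b x => Submodule.mkQ _ ∘ₗ ξ i a b x) :=
    ⟨homZero_extRep hE (homZero_traceQuot hEE hφ hspan) (classesIndependent_traceQuot hEE hφ hξ),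
      extZero_extRep hEE (classesSpan_traceQuot hφ hξ')⟩
  refine ⟨(orthogonal_iff _ _).2 (hperp.of_iso (isHom_transport _ e)), ?_, ?_⟩
  · rw [mem_homSpace_iff]
    refine (isHom_transport _ e).comp (f := fun v => LinearMap.inl k _ _ ∘ₗ Submodule.mkQ _) ?_
    intro a b x m
    rw [extRep_apply]
    simp only [LinearMap.comp_apply, LinearMap.inl_apply, Pi.zero_apply, map_zero,
      Finset.sum_const_zero, add_zero, Submodule.mkQ_apply, traceQuot_mk]
    rfl
  · intro δ L hL f hf
    rw [orthogonal_iff] at hL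
    rw [mem_homSpace_iff] at hf
    have hker : ∀ v, LinearMap.range (sumMap φ v) ≤ LinearMap.ker (f v) := by
      rintro v _ ⟨m, rfl⟩
      rw [LinearMap.mem_ker, sumMap_apply, map_sum]
      exact Finset.sum_eq_zero fun i _ => hL.1 _ (hf.comp (hφ i)) v (m i)
    have hlift : IsHom (traceQuot hφ) L fun v => (LinearMap.range (sumMap φ v)).liftQ (f v)
        (hker v) := by
      intro a b x m
      obtain ⟨m, rfl⟩ := Submodule.Quotient.mk_surjective _ m
      rw [traceQuot_mk, Submodule.liftQ_apply, Submodule.liftQ_apply]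
      exact hf a b x m
    obtain ⟨g, ⟨hg, hgf⟩, huniq⟩ := existsUnique_extension
      (fun i a b x => Submodule.mkQ _ ∘ₗ ξ i a b x) hL hlift
    refine ⟨fun v => g v ∘ₗ (e v).symm.toLinearMap, ⟨?_, fun v => ?_⟩, ?_⟩
    · rw [mem_homSpace_iff]
      exact hg.comp (isHom_transport_symm _ e)
    · refine LinearMap.ext fun m => ?_
      simp only [LinearMap.comp_apply, LinearEquiv.coe_coe, LinearEquiv.symm_apply_apply,
        LinearMap.inl_apply, hgf, Submodule.mkQ_apply, Submodule.liftQ_apply]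
    · rintro g' ⟨hg', hgf'⟩
      rw [mem_homSpace_iff] at hg'
      have h1 := huniq (fun v => g' v ∘ₗ (e v).toLinearMap)
        ⟨hg'.comp (isHom_transport _ e), fun v m => by
          obtain ⟨m, rfl⟩ := Submodule.Quotient.mk_surjective _ m
          exact LinearMap.congr_fun (hgf' v) m⟩
      funext v
      have h2 := congrFun h1 v
      rw [← h2]
      refine LinearMap.ext fun m => ?_
      simp

theorem finrank_extRep_traceQuot {κ : Type*} [Fintype κ] {A : Type*} [AddCommGroup A] [Module k A]
    [FiniteDimensional k A] (I : Submodule k A) (n : ℕ) :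
    Module.finrank k ((A ⧸ I) × (κ → Fin n → k)) + Module.finrank k I =
      Module.finrank k A + Fintype.card κ * n := by
  rw [Module.finrank_prod, Module.finrank_pi_fintype]
  have := I.finrank_quotient_add_finrank
  simp
  omega

/-- If `⟨ε, α⟩ = 0` and `M` is regular, then `hom(E, M)` copies of `E` embed into `M`. -/
theorem IsRegular.finrank_range_sumMap {E : RepSpace k ε} (hE : IsBrick E) (hEE : ExtZero E E)
    (h0 : eulerForm ε α = 0) {M : RepSpace k α} (hM : IsRegular E M)
    {φ : Fin (homDim E M) → VertexMaps k ε α} (hφ : ∀ i, IsHom E M (φ i))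
    (hspan : ∀ f, IsHom E M f →
      ∃ c : Fin (homDim E M) → k, ∀ v m, f v m = ∑ i, c i • φ i v m) (v : Q) :
    Module.finrank k (LinearMap.range (sumMap φ v)) = homDim E M * ε v := by
  obtain ⟨β, N, r, hN, hβ⟩ := hM
  obtain ⟨ξ, hξ, hξ'⟩ := exists_ext_basis E M
  have hP := isProjection_extRep_traceQuot hE hEE hφ hspan hξ hξ'
    fun v => (Module.finBasis k _).equivFun
  obtain ⟨e, -⟩ := hN.exists_iso hP
  have h1 := (e v).finrank_eq
  have h2 := finrank_extRep_traceQuot (κ := Fin (extDim E M)) (LinearMap.range (sumMap φ v)) (ε v)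
  have h3 := hβ v
  have h4 := homDim_sub_extDim E M
  simp only [Module.finrank_fin_fun, Fintype.card_fin] at h1 h2
  rw [h0] at h3 h4
  -- Dividing by the trace and adding `ext(E, M)` copies of `E` must return the dimension vector
  -- `α`, so the trace has the dimension of that many copies.
  have h5 : extDim E M = homDim E M := by omega
  rw [h5] at h1 h2
  omega

variable {E : RepSpace k ε} {M : RepSpace k α}

theorem homDim_pos_of_mem_exceptionalSet (h0 : eulerForm ε α = 0) (hM : M ∈ exceptionalSet E α) :
    0 < homDim E M := by
  by_contra hcon
  have h := homDim_sub_extDim E M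
  exact hM.2 ⟨by omega, by omega⟩

theorem sumMap_injective_of_isRegular (hE : IsBrick E) (hEE : ExtZero E E)
    (h0 : eulerForm ε α = 0) (hM : IsRegular E M)
    {φ : Fin (homDim E M) → VertexMaps k ε α} (hφ : ∀ i, IsHom E M (φ i))
    (hspan : ∀ f, IsHom E M f →
      ∃ c : Fin (homDim E M) → k, ∀ v m, f v m = ∑ i, c i • φ i v m) (v : Q) :
    Function.Injective (sumMap φ v) := by
  have h1 := hM.finrank_range_sumMap hE hEE h0 hφ hspan v
  have h2 := LinearMap.finrank_range_add_finrank_ker (sumMap φ v)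
  rw [Module.finrank_pi_fintype] at h2
  simp only [Module.finrank_fin_fun, Finset.sum_const, Finset.card_univ, Fintype.card_fin,
    smul_eq_mul] at h2
  rw [← LinearMap.ker_eq_bot, ← Submodule.finrank_eq_zero (R := k)]
  omega

theorem exists_injective_of_mem_exceptionalSet (hE : IsBrick E) (hEE : ExtZero E E)
    (h0 : eulerForm ε α = 0) (hM : M ∈ exceptionalSet E α) :
    ∃ i : VertexMaps k ε α, IsHom E M i ∧ ∀ v, Function.Injective (i v) := by
  obtain ⟨φ, hφ, hspan⟩ := exists_hom_basis E M
  let j : Fin (homDim E M) := ⟨0, homDim_pos_of_mem_exceptionalSet h0 hM⟩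
  refine ⟨φ j, hφ j, fun v => ?_⟩
  have h1 := sumMap_injective_of_isRegular hE hEE h0 hM.1 hφ hspan v
  have h2 : ∀ m, φ j v m = sumMap φ v (Pi.single j m) := fun m => by
    rw [sumMap_apply, Finset.sum_eq_single j]
    · simp
    · intro i _ hi
      simp [Pi.single_eq_of_ne hi]
    · simp
  intro m m' h
  rw [h2, h2] at h
  exact Pi.single_injective j (h1 h)

/-- The values of the projection at exceptional points have `E` as a quotient. -/
theorem exists_surjective_of_mem_projectionOrbits (hE : IsBrick E) (hEE : ExtZero E E)
    (h0 : eulerForm ε α = 0) {N : RepSpace k α}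
    (hN : N ∈ projectionOrbits E (exceptionalSet E α)) :
    ∃ p : VertexMaps k α ε, IsHom N E p ∧ ∀ v, Function.Surjective (p v) := by
  obtain ⟨M, hM, r, hr⟩ := hN
  obtain ⟨φ, hφ, hspan⟩ := exists_hom_basis E M
  obtain ⟨ξ, hξ, hξ'⟩ := exists_ext_basis E M
  let b := fun v => (Module.finBasis k (((Fin (α v) → k) ⧸ LinearMap.range (sumMap φ v)) ×
    (Fin (extDim E M) → Fin (ε v) → k))).equivFun
  have hP := isProjection_extRep_traceQuot hE hEE hφ hspan hξ hξ' b
  obtain ⟨e, he⟩ := hr.exists_iso hP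
  have h1 := homDim_sub_extDim E M
  have h2 := homDim_pos_of_mem_exceptionalSet h0 hM
  let j : Fin (extDim E M) := ⟨0, by omega⟩
  have hproj : IsHom (extRep (traceQuot hφ) E fun i a b x => Submodule.mkQ _ ∘ₗ ξ i a b x) E
      fun v => LinearMap.proj j ∘ₗ LinearMap.snd k _ (Fin (extDim E M) → Fin (ε v) → k) := by
    intro a b x m
    rw [extRep_apply]
    rfl
  refine ⟨_, (hproj.comp (isHom_transport_symm _ _)).comp he, fun v => ?_⟩
  have hs : Function.Surjective
      fun m : ((Fin (α v) → k) ⧸ LinearMap.range (sumMap φ v)) × (Fin (extDim E M) → Fin (ε v) → k) =>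
        m.2 j := fun m => ⟨(0, fun _ => m), rfl⟩
  exact (hs.comp (b v).symm.surjective).comp (e v).surjective

/-- A representation of dimension vector `α - ε` without homomorphisms from `E`, built from an
exceptional point. -/
theorem exists_homZero_of_mem_exceptionalSet (hE : IsBrick E) (hEE : ExtZero E E)
    (h0 : eulerForm ε α = 0) (hM : M ∈ exceptionalSet E α) :
    ε ≤ α ∧ ∃ L : RepSpace k (α - ε), HomZero E L := by
  obtain ⟨φ, hφ, hspan⟩ := exists_hom_basis E M
  have hpos := homDim_pos_of_mem_exceptionalSet h0 hM
  have hr := hM.1.finrank_range_sumMap hE hEE h0 hφ hspan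
  have heul := homDim_sub_extDim E M
  -- Here `hom = ext = n + 1`. Dividing out `n + 1` copies of `E` and adding back only `n` leaves
  -- the dimension vector `α - ε`; the `n` retained classes are still independent, so `Hom(E, -)`
  -- stays zero.
  obtain ⟨n, hn⟩ : ∃ n, extDim E M = n + 1 := ⟨extDim E M - 1, by omega⟩
  have hh : homDim E M = n + 1 := by omega
  obtain ⟨ξ, hξ⟩ : ∃ ξ : Fin (n + 1) → ArrowMaps k ε α, ClassesIndependent E M ξ := by
    rw [← hn]
    obtain ⟨ξ, hξ, -⟩ := exists_ext_basis E M
    exact ⟨ξ, hξ⟩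
  have hle : ∀ v, Module.finrank k (LinearMap.range (sumMap φ v)) ≤ α v := fun v => by
    simpa using Submodule.finrank_le (LinearMap.range (sumMap φ v))
  have hεα : ε ≤ α := fun v => by
    refine le_trans ?_ ((hr v).symm.trans_le (hle v))
    rw [hh]
    exact Nat.le_mul_of_pos_left _ (Nat.succ_pos n)
  refine ⟨hεα, ?_⟩
  have hdim : ∀ v, Module.finrank k (((Fin (α v) → k) ⧸ LinearMap.range (sumMap φ v)) ×
      (Fin n → Fin (ε v) → k)) = Module.finrank k (Fin ((α - ε) v) → k) := fun v => by
    have h1 := finrank_extRep_traceQuot (κ := Fin n) (LinearMap.range (sumMap φ v)) (ε v)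
    have h2 := hr v
    have h3 := hεα v
    simp only [Module.finrank_fin_fun, Fintype.card_fin, Pi.sub_apply] at h1 ⊢
    have h4 : homDim E M * ε v = n * ε v + ε v := by rw [hh]; ring
    omega
  have hz := homZero_extRep hE (homZero_traceQuot hEE hφ hspan)
    (classesIndependent_traceQuot hEE hφ hξ).comp_succ
  exact ⟨transport _ fun v => LinearEquiv.ofFinrankEq _ _ (hdim v),
    hz.of_iso (isHom_transport _ _)⟩

/-- If `hom(E, M) = 1` and a homomorphism `E → M` is injective, then `M` is an exceptional
point. -/
theorem mem_exceptionalSet_of_injective (hE : IsBrick E) (hEE : ExtZero E E)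
    (h0 : eulerForm ε α = 0) (h1 : homDim E M = 1) {f : VertexMaps k ε α} (hf : IsHom E M f)
    (hinj : ∀ v, Function.Injective (f v)) : M ∈ exceptionalSet E α := by
  refine ⟨?_, fun h => by rw [h.1] at h1; omega⟩
  obtain ⟨φ, hφ, hspan⟩ : ∃ φ : Fin 1 → VertexMaps k ε α, (∀ i, IsHom E M (φ i)) ∧
      ∀ f, IsHom E M f → ∃ c : Fin 1 → k, ∀ v m, f v m = ∑ i, c i • φ i v m := by
    rw [← h1]
    exact exists_hom_basis E M
  obtain ⟨ξ, hξ, hξ'⟩ : ∃ ξ : Fin 1 → ArrowMaps k ε α,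
      ClassesIndependent E M ξ ∧ ClassesSpan E M ξ := by
    have h2 := homDim_sub_extDim E M
    rw [← show extDim E M = 1 by omega]
    exact exists_ext_basis E M
  obtain ⟨c, hc⟩ := hspan f hf
  have hsinj : ∀ v, Function.Injective (sumMap φ v) := by
    intro v
    rw [← LinearMap.ker_eq_bot, LinearMap.ker_eq_bot']
    intro m hm
    rw [sumMap_apply, Fin.sum_univ_one] at hm
    have h3 : f v (m 0) = 0 := by rw [hc, Fin.sum_univ_one, hm, smul_zero]
    have h4 : m 0 = 0 := hinj v (by rw [h3, map_zero])
    funext i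
    rw [Subsingleton.elim i 0, h4]
    rfl
  have hdim : ∀ v, Module.finrank k (((Fin (α v) → k) ⧸ LinearMap.range (sumMap φ v)) ×
      (Fin 1 → Fin (ε v) → k)) = Module.finrank k (Fin (α v) → k) := fun v => by
    have h3 := finrank_extRep_traceQuot (κ := Fin 1) (LinearMap.range (sumMap φ v)) (ε v)
    rw [LinearMap.finrank_range_of_inj (hsinj v), Module.finrank_pi_fintype] at h3
    simpa using h3
  exact ⟨α, _, _, isProjection_extRep_traceQuot hE hEE hφ hspan hξ hξ'
    fun v => LinearEquiv.ofFinrankEq _ _ (hdim v), fun v => by rw [h0]; ring⟩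

/-- A representation without homomorphisms from `E` that has `E` as a quotient is a value of the
projection at an exceptional point. -/
theorem mem_projectionOrbits_of_surjective (hE1 : homDim E E = 1) (h0 : eulerForm ε α = 0)
    {N : RepSpace k α} (hN : homDim E N = 0) {p : VertexMaps k α ε} (hp : IsHom N E p)
    (hsurj : ∀ v, Function.Surjective (p v)) :
    N ∈ projectionOrbits E (exceptionalSet E α) := by
  have hEN : Orthogonal E N := ⟨hN, by have := homDim_sub_extDim E N; omega⟩
  let A : ArrowFamily k (fun v => LinearMap.ker (p v)) (fun v => LinearMap.ker (p v)) :=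
    fun a b x => (N a b x).restrict (hp.ker_stable a b x)
  have hA : IsShortExact A N E (fun v => (LinearMap.ker (p v)).subtype) p :=
    { hom_left := fun a b x m => rfl
      hom_right := hp
      injective := fun v => Submodule.subtype_injective _
      surjective := hsurj
      exact := fun v m => by simp }
  have hdim : ∀ v, Module.finrank k (LinearMap.ker (p v) × (Fin (ε v) → k)) =
      Module.finrank k (Fin (α v) → k) := fun v => by
    have := LinearMap.finrank_range_add_finrank_ker (p v)
    rw [LinearMap.range_eq_top.2 (hsurj v), finrank_top] at this
    rw [Module.finrank_prod, add_comm]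
    exact this
  let e := fun v => LinearEquiv.ofFinrankEq _ _ (hdim v)
  -- The split representation on `ker p ⊕ E`. For `L` in `E^⊥`, homomorphisms to `L` vanish on the
  -- summand `E`, and those on `ker p` extend uniquely to `N`; hence `r`, the projection to `ker p`
  -- followed by its inclusion, is universal.
  let M : RepSpace k α := transport (sumRep A E) e
  let r : VertexMaps k α α := fun v =>
    ((LinearMap.ker (p v)).subtype ∘ₗ LinearMap.fst k _ _) ∘ₗ (e v).symm.toLinearMap
  have hproj : IsProjection E M N r := by
    refine ⟨hEN, ?_, fun γ L hL f hf => ?_⟩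
    · rw [mem_homSpace_iff]
      exact IsHom.comp (N := sumRep A E) (fun a b x m => rfl) (isHom_transport_symm _ e)
    · rw [mem_homSpace_iff] at hf
      rw [orthogonal_iff] at hL
      have hf' : IsHom (sumRep A E) L fun v => f v ∘ₗ (e v).toLinearMap :=
        hf.comp (isHom_transport _ e)
      have hfA : IsHom A L fun v => (f v ∘ₗ (e v).toLinearMap) ∘ₗ LinearMap.inl k _ _ :=
        hf'.comp (isShortExact_sumRep A E).hom_left
      have hfE : ∀ v m, f v (e v (0, m)) = 0 := fun v m =>
        hL.1 (fun v => (f v ∘ₗ (e v).toLinearMap) ∘ₗ LinearMap.inr k _ _)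
          (hf'.comp (M := E) (N := sumRep A E) fun a b x m => by simp [sumRep]) v m
      obtain ⟨g, ⟨hg, hgf⟩, huniq⟩ := hA.existsUnique_extension hL hfA
      refine ⟨g, ⟨(mem_homSpace_iff _ _ _).2 hg, fun v => ?_⟩, ?_⟩
      · refine LinearMap.ext fun m => ?_
        obtain ⟨⟨n, n'⟩, rfl⟩ := (e v).surjective m
        have h1 := hgf v n
        simp only [r, LinearMap.comp_apply, LinearEquiv.coe_coe, LinearEquiv.symm_apply_apply,
          LinearMap.fst_apply, LinearMap.inl_apply] at h1 ⊢
        rw [h1, show ((n, n') : LinearMap.ker (p v) × (Fin (ε v) → k)) = (n, 0) + (0, n') by simp,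
          map_add, map_add, hfE, add_zero]
      · rintro g' ⟨hg', hgf'⟩
        refine huniq g' ⟨(mem_homSpace_iff _ _ _).1 hg', fun v m => ?_⟩
        have h1 := LinearMap.congr_fun (hgf' v) (e v (m, 0))
        simpa [r] using h1
  refine ⟨M, ⟨⟨α, N, r, hproj, fun v => by rw [h0]; ring⟩, fun hM => ?_⟩, r, hproj⟩
  rw [orthogonal_iff] at hM
  have hz := hM.1 (fun v => (e v).toLinearMap ∘ₗ LinearMap.inr k _ _)
    ((isHom_transport (sumRep A E) e).comp (M := E) fun a b x m => by simp [sumRep])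
  have hEz : HomZero E E := fun f _ v m => by
    have h1 := hz v (f v m)
    have h2 : ((0 : LinearMap.ker (p v)), f v m) = 0 := (e v).injective (by
      rw [map_zero]; exact h1)
    exact congrArg Prod.snd h2
  rw [(homDim_eq_zero_iff E E).2 hEz] at hE1
  exact zero_ne_one hE1

end Projection


/-! ### Maximal minors and integral normal forms over a valuation ring. -/

section Matrix

theorem Matrix.exists_submatrix_det_ne_zero {k : Type*} [Field k] {n r : ℕ}
    (B : Matrix (Fin n) (Fin r) k) (hB : Function.Injective B.mulVec) :
    ∃ S : Fin r → Fin n, (B.submatrix S id).det ≠ 0 := by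
  have hrank : Module.finrank k (Submodule.span k (Set.range B.row)) = r := by
    rw [← Matrix.rank_eq_finrank_span_row, Matrix.rank, LinearMap.finrank_range_of_inj hB]
    simp
  obtain ⟨f, hf, -, hli⟩ := Submodule.exists_fun_fin_finrank_span_eq k (Set.range B.row)
  choose S hS using hf
  refine ⟨fun i => S (Fin.cast hrank.symm i), ?_⟩
  rw [← isUnit_iff_ne_zero, ← Matrix.isUnit_iff_isUnit_det,
    ← Matrix.linearIndependent_rows_iff_isUnit]
  have hrow : (B.submatrix (fun i => S (Fin.cast hrank.symm i)) id).row =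
      f ∘ Fin.cast hrank.symm := funext fun i => hS _
  rw [hrow]
  exact hli.comp _ (Fin.cast_injective _)

/-- Over the fraction field of a valuation ring, every subspace has a basis matrix with entries in
the valuation ring and an identity block. -/
theorem Matrix.exists_normalized {K : Type*} [Field K] (O : ValuationSubring K) {n r : ℕ}
    (B : Matrix (Fin n) (Fin r) K) (S₀ : Fin r → Fin n) (hS₀ : (B.submatrix S₀ id).det ≠ 0) :
    ∃ S : Fin r → Fin n, (B.submatrix S id).det ≠ 0 ∧
      ∀ i l, (B * (B.submatrix S id)⁻¹) i l ∈ O := by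
  -- Take the minor of largest valuation. By Cramer's rule each entry of the normalized matrix is a
  -- quotient of another minor by this one, so it has valuation at most `1`.
  obtain ⟨S, -, hS⟩ := Finset.exists_max_image Finset.univ
    (fun S : Fin r → Fin n => O.valuation (B.submatrix S id).det) ⟨S₀, Finset.mem_univ _⟩
  have hne : (B.submatrix S id).det ≠ 0 := by
    intro h
    have := hS S₀ (Finset.mem_univ _)
    rw [h, map_zero, le_zero_iff, map_eq_zero] at this
    exact hS₀ this
  refine ⟨S, hne, fun i l => ?_⟩
  have hdet : (B * (B.submatrix S id)⁻¹) i l * (B.submatrix S id).det =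
      (B.submatrix (Function.update S l i) id).det := by
    have h1 : B.submatrix (Function.update S l i) id = (B.submatrix S id).updateRow l (B i) := by
      ext a b
      by_cases h : a = l
      · subst h; simp
      · simp [Matrix.updateRow_ne h, Function.update_of_ne h]
    rw [h1, ← Matrix.cramer_transpose_apply, Matrix.cramer_eq_adjugate_mulVec,
      ← Matrix.adjugate_transpose, Matrix.mulVec_transpose, Matrix.inv_def,
      Ring.inverse_eq_inv, Matrix.mul_smul, Matrix.smul_apply, smul_eq_mul,
      mul_comm, ← mul_assoc, mul_inv_cancel₀ hne, one_mul]
    rfl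
  rw [← O.valuation_le_one_iff]
  have h2 := hS (Function.update S l i) (Finset.mem_univ _)
  rw [← hdet, map_mul] at h2
  have h3 : 0 < O.valuation (B.submatrix S id).det := by
    rw [zero_lt_iff]
    simpa using hne
  exact (mul_le_iff_le_one_left h3).1 h2

end Matrix

/-! ### Descent of solutions to an algebraically closed field. -/

section Descent

variable {k : Type*} [Field k] [IsAlgClosed k]

/-- The kernel is a proper ideal, hence has a zero over `k` by the Nullstellensatz. A system of
equations over `k` solvable in an extension field is thus solvable in `k`. -/
theorem exists_zero_of_ringHom {κ σ : Type*} [Field κ] [Finite σ] (Ψ : MvPolynomial σ k →+* κ) :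
    ∃ z : σ → k, ∀ P, Ψ P = 0 → MvPolynomial.eval z P = 0 := by
  have hne : RingHom.ker Ψ ≠ ⊤ := RingHom.ker_ne_top Ψ
  have hZ : (MvPolynomial.zeroLocus k (RingHom.ker Ψ)).Nonempty := by
    rw [Set.nonempty_iff_ne_empty]
    intro h
    have h1 := MvPolynomial.vanishingIdeal_zeroLocus_eq_radical (K := k) (RingHom.ker Ψ)
    rw [h, MvPolynomial.vanishingIdeal_empty] at h1
    exact hne (Ideal.radical_eq_top.1 h1.symm)
  obtain ⟨z, hz⟩ := hZ
  refine ⟨z, fun P hP => ?_⟩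
  have := hz P hP
  rwa [MvPolynomial.aeval_eq_eval] at this

variable {Q : Type*} [Quiver Q] {α γ : Q → ℕ}

/-- The existence of a stable family of subspaces in a given chart descends to an algebraically
closed ground field. -/
theorem exists_chart_point [Finite Q] {κ : Type*} [Field κ] (j : k →+* κ) (M : RepSpace k α)
    (S : ∀ v, Fin (γ v) → Fin (α v)) (Z : ∀ v, Matrix (Fin (α v)) (Fin (γ v)) κ)
    (hZ : ∀ v, (Z v).submatrix (S v) id = 1)
    (hM : ∀ (a b : Q) (x : a ⟶ b), (LinearMap.toMatrix' (M a b x)).map j * Z a =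
      Z b * ((LinearMap.toMatrix' (M a b x)).map j * Z a).submatrix (S b) id) :
    ∃ Z : ∀ v, Matrix (Fin (α v)) (Fin (γ v)) k, (∀ v, (Z v).submatrix (S v) id = 1) ∧
      ∀ (a b : Q) (x : a ⟶ b), LinearMap.toMatrix' (M a b x) * Z a =
        Z b * (LinearMap.toMatrix' (M a b x) * Z a).submatrix (S b) id := by
  let σ := Σ v, Fin (α v) × Fin (γ v)
  let Ψ : MvPolynomial σ k →+* κ := MvPolynomial.eval₂Hom j fun s => Z s.1 s.2.1 s.2.2
  obtain ⟨z, hz⟩ := exists_zero_of_ringHom Ψ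
  let G : ∀ v, Matrix (Fin (α v)) (Fin (γ v)) (MvPolynomial σ k) :=
    fun v => Matrix.of fun i l => MvPolynomial.X ⟨v, i, l⟩
  have hG : ∀ v, (G v).map Ψ = Z v := fun v => by
    ext i l
    simp [G, Ψ]
  let T : ∀ a b : Q, (a ⟶ b) → Matrix (Fin (α b)) (Fin (α a)) (MvPolynomial σ k) :=
    fun a b x => (LinearMap.toMatrix' (M a b x)).map MvPolynomial.C
  have hT : ∀ a b x, (T a b x).map Ψ = (LinearMap.toMatrix' (M a b x)).map j := fun a b x => by
    ext i l
    simp [T, Ψ]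
  have hT' : ∀ a b x, (T a b x).map (MvPolynomial.eval z) = LinearMap.toMatrix' (M a b x) :=
    fun a b x => by
      ext i l
      simp [T]
  -- Matrix identities that hold at the point with values in `κ` persist at the zero `z`, entry by
  -- entry.
  have key : ∀ {m n : Type _} (A B : Matrix m n (MvPolynomial σ k)), A.map Ψ = B.map Ψ →
      A.map (MvPolynomial.eval z) = B.map (MvPolynomial.eval z) := by
    intro m n A B h
    ext i l
    have h1 : Ψ (A i l - B i l) = 0 := by
      rw [map_sub, sub_eq_zero]
      exact congrFun (congrFun h i) l
    have h2 := hz _ h1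
    rw [map_sub, sub_eq_zero] at h2
    exact h2
  refine ⟨fun v => (G v).map (MvPolynomial.eval z), fun v => ?_, fun a b x => ?_⟩
  · have := key ((G v).submatrix (S v) id) 1 (by
      rw [← Matrix.submatrix_map, hG, hZ, Matrix.map_one _ (map_zero _) (map_one _)])
    rwa [Matrix.map_one _ (map_zero _) (map_one _), ← Matrix.submatrix_map] at this
  · have := key (T a b x * G a) (G b * (T a b x * G a).submatrix (S b) id) (by
      rw [Matrix.map_mul, Matrix.map_mul, ← Matrix.submatrix_map, Matrix.map_mul, hT, hG, hG]
      exact hM a b x)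
    rw [Matrix.map_mul, Matrix.map_mul, ← Matrix.submatrix_map, Matrix.map_mul, hT'] at this
    exact this

end Descent

/-! ### Closedness of the locus with a subrepresentation of given dimension. -/

section Closed

variable {k : Type*} [Field k] {Q : Type*} [Quiver Q] {α γ : Q → ℕ}

theorem exists_matrix_of_mem_repSub {M : RepSpace k α} (hM : M ∈ repSub k γ α) :
    ∃ (B : ∀ v, Matrix (Fin (α v)) (Fin (γ v)) k)
      (C : ∀ a b : Q, (a ⟶ b) → Matrix (Fin (γ b)) (Fin (γ a)) k),
      (∀ v, Function.Injective (B v).mulVec) ∧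
      ∀ a b x, LinearMap.toMatrix' (M a b x) * B a = B b * C a b x := by
  obtain ⟨W, hW, hdim⟩ := hM
  let e : ∀ v, W v ≃ₗ[k] (Fin (γ v) → k) := fun v =>
    LinearEquiv.ofFinrankEq _ _ (by rw [hdim, Module.finrank_fin_fun])
  let f : ∀ v, (Fin (γ v) → k) →ₗ[k] (Fin (α v) → k) := fun v =>
    (W v).subtype ∘ₗ (e v).symm.toLinearMap
  refine ⟨fun v => LinearMap.toMatrix' (f v), fun a b x => LinearMap.toMatrix'
    ((e b).toLinearMap ∘ₗ (M a b x).restrict (hW a b x) ∘ₗ (e a).symm.toLinearMap),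
    fun v => ?_, fun a b x => ?_⟩
  · have : (LinearMap.toMatrix' (f v)).mulVec = f v := by
      funext m
      exact LinearMap.toMatrix'_mulVec _ _
    rw [this]
    exact (W v).subtype_injective.comp (e v).symm.injective
  · rw [← LinearMap.toMatrix'_comp, ← LinearMap.toMatrix'_comp]
    congr 1
    refine LinearMap.ext fun m => ?_
    simp [f]

theorem mem_repSub_of_chart {M : RepSpace k α} {S : ∀ v, Fin (γ v) → Fin (α v)}
    {Z : ∀ v, Matrix (Fin (α v)) (Fin (γ v)) k} (hZ : ∀ v, (Z v).submatrix (S v) id = 1)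
    {C : ∀ a b : Q, (a ⟶ b) → Matrix (Fin (γ b)) (Fin (γ a)) k}
    (hM : ∀ (a b : Q) (x : a ⟶ b), LinearMap.toMatrix' (M a b x) * Z a = Z b * C a b x) :
    M ∈ repSub k γ α := by
  refine ⟨fun v => LinearMap.range (Z v).mulVecLin, ?_, fun v => ?_⟩
  · rintro a b x _ ⟨m, rfl⟩
    refine ⟨(C a b x).mulVec m, ?_⟩
    simp only [Matrix.mulVecLin_apply]
    rw [Matrix.mulVec_mulVec, ← hM, ← Matrix.mulVec_mulVec, LinearMap.toMatrix'_mulVec]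
  · rw [LinearMap.finrank_range_of_inj, Module.finrank_fin_fun]
    intro m m' h
    simp only [Matrix.mulVecLin_apply] at h
    have h1 : ∀ m, ((Z v).mulVec m) ∘ S v = m := fun m => by
      have := Matrix.one_mulVec m
      rw [← hZ v] at this
      exact this
    rw [← h1 m, h, h1]

/-- The ultrafilter plays the role of a curve through `y₀`: germs along it form a field, and the
valuation ring dominates the image of the polynomial functions at `y₀`. -/
theorem exists_valuationSubring_dominating {Y : Type*} [AddCommGroup Y] [Module k Y]
    (u : Ultrafilter Y) {y₀ : Y} (hu : (u : Filter Y) ≤ @nhds Y (zariski k Y) y₀) :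
    ∃ O : ValuationSubring (Filter.Germ (u : Filter Y) k), ∀ q ∈ polyFun k Y,
      Filter.Germ.coeRingHom (u : Filter Y) q ∈ O ∧
      (q y₀ = 0 → Filter.Germ.coeRingHom (u : Filter Y) q ∈ O.nonunits) := by
  let := zariski k Y
  let θ : polyFun k Y →+* Filter.Germ (u : Filter Y) k :=
    (Filter.Germ.coeRingHom (u : Filter Y)).comp (polyFun k Y).val.toRingHom
  let ev : polyFun k Y →+* k := (Pi.evalRingHom (fun _ => k) y₀).comp (polyFun k Y).val.toRingHom
  let I : Ideal θ.range := (RingHom.ker ev).map θ.rangeRestrict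
  -- A germ equal to `1` cannot come from `q` with `q y₀ = 0`, since `q ≠ 1` holds on a
  -- neighbourhood of `y₀`, which belongs to the ultrafilter.
  have hI : I ≠ ⊤ := by
    intro h
    have h1 : (1 : θ.range) ∈ I := by rw [h]; trivial
    rw [Ideal.mem_map_iff_of_surjective _ θ.rangeRestrict_surjective] at h1
    obtain ⟨q, hq, hq1⟩ := h1
    have hq : q.1 y₀ = 0 := hq
    have hq1 : Filter.Germ.coeRingHom (u : Filter Y) q.1 =
        Filter.Germ.coeRingHom (u : Filter Y) 1 := by
      rw [map_one]
      exact congrArg Subtype.val hq1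
    have h2 : ∀ᶠ y in (u : Filter Y), q.1 y = 1 := Filter.Germ.coe_eq.1 hq1
    have h3 : IsOpen {y | q.1 y - 1 ≠ 0} :=
      isOpen_nonzeros (sub_mem q.2 (one_mem (polyFun k Y)))
    have h4 : ∀ᶠ y in (u : Filter Y), q.1 y - 1 ≠ 0 :=
      hu (h3.mem_nhds (by simp [hq]))
    obtain ⟨y, hy1, hy2⟩ := (h2.and h4).exists
    exact hy2 (by rw [hy1, sub_self])
  obtain ⟨O, hO, hmem⟩ := Ideal.image_subset_nonunits_valuationSubring I hI
  exact ⟨O, fun q hq => ⟨hO ⟨⟨q, hq⟩, rfl⟩, fun h0 =>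
    hmem ⟨_, Ideal.mem_map_of_mem θ.rangeRestrict (x := ⟨q, hq⟩) h0, rfl⟩⟩⟩

/-- The set of representations with a `γ`-dimensional subrepresentation is closed. -/
theorem isClosed_repSub [IsAlgClosed k] [Finite Q] : IsClosed[zariski k _] (repSub k γ α) := by
  let := zariski k (RepSpace k α)
  refine isClosed_of_closure_subset fun M₀ hM₀ => ?_
  obtain ⟨u, hu, huM⟩ := mem_closure_iff_ultrafilter.1 hM₀
  obtain ⟨O, hO⟩ := exists_valuationSubring_dominating (k := k) u huM
  let c : (RepSpace k α → k) →+* Filter.Germ (u : Filter (RepSpace k α)) k :=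
    Filter.Germ.coeRingHom (u : Filter (RepSpace k α))
  have hc : ∀ {f g : RepSpace k α → k}, (∀ᶠ M in (u : Filter _), f M = g M) → c f = c g :=
    fun h => Filter.Germ.coe_eq.2 h
  have hu' : ∀ᶠ M in (u : Filter (RepSpace k α)), M ∈ repSub k γ α := hu
  have hall : ∀ M : RepSpace k α, ∃ (B : ∀ v, Matrix (Fin (α v)) (Fin (γ v)) k)
      (C : ∀ a b : Q, (a ⟶ b) → Matrix (Fin (γ b)) (Fin (γ a)) k), M ∈ repSub k γ α →
      (∀ v, Function.Injective (B v).mulVec) ∧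
      ∀ a b x, LinearMap.toMatrix' (M a b x) * B a = B b * C a b x := fun M => by
    by_cases hM : M ∈ repSub k γ α
    · obtain ⟨B, C, h⟩ := exists_matrix_of_mem_repSub hM
      exact ⟨B, C, fun _ => h⟩
    -- The values outside the locus are irrelevant, because the ultrafilter is concentrated on it.
    · exact ⟨0, 0, fun h => absurd h hM⟩
  choose B C hBC using hall
  let B' : ∀ v, Matrix (Fin (α v)) (Fin (γ v)) (RepSpace k α → k) :=
    fun v => Matrix.of fun i l M => B M v i l
  let C' : ∀ a b : Q, (a ⟶ b) → Matrix (Fin (γ b)) (Fin (γ a)) (RepSpace k α → k) :=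
    fun a b x => Matrix.of fun i l M => C M a b x i l
  let T : ∀ a b : Q, (a ⟶ b) → Matrix (Fin (α b)) (Fin (α a)) (RepSpace k α → k) :=
    fun a b x => Matrix.of fun i l M => LinearMap.toMatrix' (M a b x) i l
  have hTpoly : ∀ a b x i l, T a b x i l ∈ polyFun k (RepSpace k α) := fun a b x i l =>
    isPoly_iff_mem.1 ((((((isPoly_id (k := k) (V := RepSpace k α)).apply a).apply b).apply
      x).linear_comp (LinearMap.toMatrix' (R := k)).toLinearMap).apply i |>.apply l)
  have hTB : ∀ a b x, (T a b x).map c * (B' a).map c = (B' b).map c * (C' a b x).map c := by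
    intro a b x
    rw [← Matrix.map_mul, ← Matrix.map_mul]
    ext i l
    refine hc (hu'.mono fun M hM => ?_)
    have h1 := congrFun (congrFun ((hBC M hM).2 a b x) i) l
    simp only [Matrix.mul_apply] at h1 ⊢
    simpa [T, B', C'] using h1
  have hS₀ : ∀ v, ∃ S : Fin (γ v) → Fin (α v), (((B' v).map c).submatrix S id).det ≠ 0 := by
    intro v
    -- There are finitely many choices of rows. If every maximal minor vanished as a germ, all would
    -- vanish at a single point of the locus, contradicting injectivity there.
    by_contra! hcon
    have h1 : ∀ S : Fin (γ v) → Fin (α v), ∀ᶠ M in (u : Filter (RepSpace k α)),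
        ((B M v).submatrix S id).det = 0 := by
      intro S
      have h2 := hcon S
      rw [Matrix.submatrix_map, ← RingHom.mapMatrix_apply, ← RingHom.map_det] at h2
      have h3 : ∀ᶠ M in (u : Filter (RepSpace k α)), ((B' v).submatrix S id).det M = 0 :=
        Filter.Germ.coe_eq.1 (h2.trans (map_zero c).symm)
      refine h3.mono fun M hM => ?_
      have h4 := RingHom.map_det (Pi.evalRingHom (fun _ : RepSpace k α => k) M)
        ((B' v).submatrix S id)
      rw [← h4.symm.trans hM]
      rfl
    obtain ⟨M, hM, hM'⟩ := (hu'.and (Filter.eventually_all.2 h1)).exists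
    obtain ⟨S, hS⟩ := Matrix.exists_submatrix_det_ne_zero (B M v) ((hBC M hM).1 v)
    exact hS (hM' S)
  choose S₀ hS₀ using hS₀
  choose S hS hSO using fun v => Matrix.exists_normalized O ((B' v).map c) (S₀ v) (hS₀ v)
  let D := fun v => ((B' v).map c).submatrix (S v) id
  have hD : ∀ v, IsUnit (D v).det := fun v => isUnit_iff_ne_zero.2 (hS v)
  let Z := fun v => (B' v).map c * (D v)⁻¹
  have hZS : ∀ v, (Z v).submatrix (S v) id = 1 := fun v => by
    have : (Z v).submatrix (S v) id = D v * (D v)⁻¹ := rfl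
    rw [this, Matrix.mul_nonsing_inv _ (hD v)]
  -- Stability in the chart: the identity block forces the matrix of the restricted arrow to be the
  -- block of rows `S b`, so the condition is a polynomial equation in the entries of `Z`.
  have hTZ : ∀ a b x, (T a b x).map c * Z a =
      Z b * ((T a b x).map c * Z a).submatrix (S b) id := by
    intro a b x
    have h1 : (T a b x).map c * Z a = Z b * (D b * (C' a b x).map c * (D a)⁻¹) := by
      simp only [Z]
      rw [← Matrix.mul_assoc, hTB, Matrix.mul_assoc (D b), ← Matrix.mul_assoc _ (D b),
        Matrix.mul_assoc _ (D b)⁻¹ (D b), Matrix.nonsing_inv_mul _ (hD b), Matrix.mul_one,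
        Matrix.mul_assoc]
    have h2 : ((T a b x).map c * Z a).submatrix (S b) id =
        D b * (C' a b x).map c * (D a)⁻¹ := by
      rw [h1]
      have : (Z b * (D b * (C' a b x).map c * (D a)⁻¹)).submatrix (S b) id =
        (Z b).submatrix (S b) id * (D b * (C' a b x).map c * (D a)⁻¹) := rfl
      rw [this, hZS, Matrix.one_mul]
    rw [h2, h1]
  let ZO : ∀ v, Matrix (Fin (α v)) (Fin (γ v)) O := fun v => Matrix.of fun i l => ⟨Z v i l, hSO v i l⟩
  let TO : ∀ a b : Q, (a ⟶ b) → Matrix (Fin (α b)) (Fin (α a)) O :=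
    fun a b x => Matrix.of fun i l => ⟨c (T a b x i l), (hO _ (hTpoly a b x i l)).1⟩
  have hZO : ∀ v, (ZO v).map O.subtype = Z v := fun v => rfl
  have hTO : ∀ a b x, (TO a b x).map O.subtype = (T a b x).map c := fun a b x => rfl
  have hinj : ∀ {m n : Type} {A A' : Matrix m n O}, A.map O.subtype = A'.map O.subtype → A = A' :=
    fun h => Matrix.map_injective Subtype.val_injective h
  let ρ := IsLocalRing.residue O
  let θ : polyFun k (RepSpace k α) →+* O :=
    (c.comp (polyFun k (RepSpace k α)).val.toRingHom).codRestrict O fun q => (hO q q.2).1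
  let j : k →+* IsLocalRing.ResidueField O := ρ.comp (θ.comp (algebraMap k (polyFun k _)))
  -- Reduction to the residue field evaluates polynomial functions at `M₀`. Reducing `Z` thus gives
  -- a stable family for `M₀` over the residue field, which then descends to `k`.
  have hρ : ∀ q : polyFun k (RepSpace k α), ρ (θ q) = j (q.1 M₀) := by
    intro q
    rw [← sub_eq_zero]
    change ρ (θ q) - ρ (θ (algebraMap k _ (q.1 M₀))) = 0
    rw [← map_sub, ← map_sub, IsLocalRing.residue_eq_zero_iff,
      ← ValuationSubring.coe_mem_nonunits_iff]
    exact (hO _ (q - algebraMap k _ (q.1 M₀)).2).2 (sub_self _)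
  obtain ⟨Z₀, hZ₀, hM₀⟩ := exists_chart_point j M₀ S (fun v => (ZO v).map ρ)
    (fun v => by
      have : (ZO v).submatrix (S v) id = 1 := hinj (by
        rw [Matrix.map_one _ (map_zero _) (map_one _)]
        exact hZS v)
      rw [Matrix.submatrix_map, this, Matrix.map_one _ (map_zero _) (map_one _)])
    (fun a b x => by
      have h1 : (LinearMap.toMatrix' (M₀ a b x)).map j = (TO a b x).map ρ := by
        ext i l
        exact (hρ ⟨T a b x i l, hTpoly a b x i l⟩).symm
      have h2 : TO a b x * ZO a = ZO b * (TO a b x * ZO a).submatrix (S b) id := hinj (by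
        rw [Matrix.map_mul, Matrix.map_mul, ← Matrix.submatrix_map, Matrix.map_mul, hTO, hZO, hZO]
        exact hTZ a b x)
      have h3 := congrArg (fun A => A.map ρ) h2
      simp only [Matrix.map_mul, ← Matrix.submatrix_map] at h3
      rw [h1]
      exact h3)
  exact mem_repSub_of_chart hZ₀ hM₀

end Closed


/-! ### The irreducible parameter space of short exact sequences. -/

section ExactTriples

variable {k : Type*} [Field k] {Q : Type*} [Quiver Q] {α γ₁ γ₂ : Q → ℕ}

variable (k) in
/-- The triples of representations that fit into a short exact sequence. -/
def exactTriples (γ₁ α γ₂ : Q → ℕ) : Set (RepSpace k γ₁ × RepSpace k α × RepSpace k γ₂) :=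
  {t | ∃ i p, IsShortExact t.1 t.2.1 t.2.2 i p}

/-- The block triangular representation with diagonal blocks `A` and `L`, in coordinates. -/
def blockRep (u : ∀ v, (Fin (α v) → k) ≃ₗ[k] (Fin (γ₁ v) → k) × (Fin (γ₂ v) → k))
    (A : RepSpace k γ₁) (ζ : ArrowMaps k γ₂ γ₁) (L : RepSpace k γ₂) : RepSpace k α := fun a b x =>
  (u b).symm.toLinearMap ∘ₗ
    (LinearMap.inl k _ _ ∘ₗ (A a b x ∘ₗ LinearMap.fst k _ _ + ζ a b x ∘ₗ LinearMap.snd k _ _) +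
      LinearMap.inr k _ _ ∘ₗ L a b x ∘ₗ LinearMap.snd k _ _) ∘ₗ (u a).toLinearMap

theorem blockRep_apply (u : ∀ v, (Fin (α v) → k) ≃ₗ[k] (Fin (γ₁ v) → k) × (Fin (γ₂ v) → k))
    (A : RepSpace k γ₁) (ζ : ArrowMaps k γ₂ γ₁) (L : RepSpace k γ₂) (a b : Q) (x : a ⟶ b)
    (m : Fin (α a) → k) : blockRep u A ζ L a b x m =
      (u b).symm (A a b x (u a m).1 + ζ a b x (u a m).2, L a b x (u a m).2) := by
  simp [blockRep]

/-- The parametrization of the exact triples by a base change and a block triangular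
representation. -/
noncomputable def tripleParam
    (u : ∀ v, (Fin (α v) → k) ≃ₗ[k] (Fin (γ₁ v) → k) × (Fin (γ₂ v) → k))
    (y : VertexMaps k α α × RepSpace k γ₁ × ArrowMaps k γ₂ γ₁ × RepSpace k γ₂) :
    RepSpace k γ₁ × RepSpace k α × RepSpace k γ₂ :=
  (fun a b x => LinearMap.det (y.1 a) • y.2.1 a b x,
    fun a b x => y.1 b ∘ₗ blockRep u y.2.1 y.2.2.1 y.2.2.2 a b x ∘ₗ adjEnd (y.1 a),
    fun a b x => LinearMap.det (y.1 a) • y.2.2.2 a b x)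

theorem isPoly_tripleParam [Finite Q] [∀ a b : Q, Finite (a ⟶ b)]
    (u : ∀ v, (Fin (α v) → k) ≃ₗ[k] (Fin (γ₁ v) → k) × (Fin (γ₂ v) → k)) :
    IsPoly k (tripleParam u) := by
  have hid := isPoly_id (k := k)
    (V := VertexMaps k α α × RepSpace k γ₁ × ArrowMaps k γ₂ γ₁ × RepSpace k γ₂)
  refine IsPoly.prodMk ?_ (IsPoly.prodMk ?_ ?_) <;>
    refine IsPoly.pi fun a => IsPoly.pi fun b => IsPoly.pi fun x => ?_
  · exact (hid.fst.apply a).det.smul (((hid.snd.fst.apply a).apply b).apply x)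
  · refine (hid.fst.apply b).linearMap_comp (IsPoly.linearMap_comp ?_ (hid.fst.apply a).adjEnd)
    refine (isPoly_const _).linearMap_comp (IsPoly.linearMap_comp ?_ (isPoly_const _))
    exact ((isPoly_const _).linearMap_comp
      (((((hid.snd.fst.apply a).apply b).apply x).linearMap_comp (isPoly_const _)).add
        ((((hid.snd.snd.fst.apply a).apply b).apply x).linearMap_comp (isPoly_const _)))).add
      ((isPoly_const _).linearMap_comp
        ((((hid.snd.snd.snd.apply a).apply b).apply x).linearMap_comp (isPoly_const _)))
  · exact (hid.fst.apply a).det.smul (((hid.snd.snd.snd.apply a).apply b).apply x)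

theorem tripleParam_mem (u : ∀ v, (Fin (α v) → k) ≃ₗ[k] (Fin (γ₁ v) → k) × (Fin (γ₂ v) → k))
    {y : VertexMaps k α α × RepSpace k γ₁ × ArrowMaps k γ₂ γ₁ × RepSpace k γ₂}
    (hy : ∀ v, LinearMap.det (y.1 v) ≠ 0) : tripleParam u y ∈ exactTriples k γ₁ α γ₂ := by
  obtain ⟨g, A, ζ, L⟩ := y
  have hy : ∀ v, LinearMap.det (g v) ≠ 0 := hy
  have hadj : ∀ v m, g v m = 0 → m = 0 := fun v m h => by
    have := adjEnd_apply_apply (g v) m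
    rw [h, map_zero] at this
    simpa [hy v] using this.symm
  refine ⟨fun v => g v ∘ₗ (u v).symm.toLinearMap ∘ₗ LinearMap.inl k _ _,
    fun v => (LinearMap.det (g v))⁻¹ • (LinearMap.snd k _ _ ∘ₗ (u v).toLinearMap ∘ₗ adjEnd (g v)),
    ⟨fun a b x m => ?_, fun a b x m => ?_, fun v => ?_, fun v m => ?_, fun v m => ?_⟩⟩
  · simp [tripleParam, adjEnd_apply_apply, blockRep_apply]
  · simp [tripleParam, adjEnd_apply_apply, blockRep_apply, hy]
  · rw [← LinearMap.ker_eq_bot, LinearMap.ker_eq_bot']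
    intro m hm
    have h1 := hadj v _ hm
    simpa using h1
  · refine ⟨g v ((u v).symm (0, m)), ?_⟩
    simp [adjEnd_apply_apply, hy]
  · constructor
    · intro h
      have h : (u v (adjEnd (g v) m)).2 = 0 := by simpa [hy] using h
      refine ⟨(LinearMap.det (g v))⁻¹ • (u v (adjEnd (g v) m)).1, ?_⟩
      have h1 : LinearMap.inl k (Fin (γ₁ v) → k) (Fin (γ₂ v) → k)
          ((LinearMap.det (g v))⁻¹ • (u v (adjEnd (g v) m)).1) =
          (LinearMap.det (g v))⁻¹ • u v (adjEnd (g v) m) :=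
        Prod.ext rfl (by simp [h])
      change g v ((u v).symm (LinearMap.inl k _ _
        ((LinearMap.det (g v))⁻¹ • (u v (adjEnd (g v) m)).1))) = m
      rw [h1, map_smul, map_smul, LinearEquiv.symm_apply_apply, apply_adjEnd_apply, smul_smul,
        inv_mul_cancel₀ (hy v), one_smul]
    · rintro ⟨a, rfl⟩
      simp [adjEnd_apply_apply]

theorem exists_tripleParam (u : ∀ v, (Fin (α v) → k) ≃ₗ[k] (Fin (γ₁ v) → k) × (Fin (γ₂ v) → k))
    {t : RepSpace k γ₁ × RepSpace k α × RepSpace k γ₂} (ht : t ∈ exactTriples k γ₁ α γ₂) :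
    ∃ y, (∀ v, LinearMap.det (y.1 v) ≠ 0) ∧ tripleParam u y = t := by
  obtain ⟨A, N, L⟩ := t
  obtain ⟨i, p, h⟩ := ht
  have hi : IsHom A N i := h.hom_left
  have hp : IsHom N L p := h.hom_right
  have hsec : ∀ v, ∃ s : (Fin (γ₂ v) → k) →ₗ[k] (Fin (α v) → k), ∀ m, p v (s m) = m := fun v => by
    obtain ⟨s, hs⟩ := (p v).exists_rightInverse_of_surjective
      (LinearMap.range_eq_top.2 (h.surjective v))
    exact ⟨s, fun m => LinearMap.congr_fun hs m⟩
  choose s hs using hsec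
  have hret : ∀ v, ∃ ρ : (Fin (α v) → k) →ₗ[k] (Fin (γ₁ v) → k), ∀ m, ρ (i v m) = m := fun v => by
    obtain ⟨ρ, hρ⟩ := (i v).exists_leftInverse_of_injective (LinearMap.ker_eq_bot.2 (h.injective v))
    exact ⟨ρ, fun m => LinearMap.congr_fun hρ m⟩
  choose ρ hρ using hret
  have hρ' : ∀ v m, p v m = 0 → i v (ρ v m) = m := fun v m hm => by
    obtain ⟨a, rfl⟩ := (h.exact v m).1 hm
    rw [hρ]
  let g : VertexMaps k α α := fun v => (i v).coprod (s v) ∘ₗ (u v).toLinearMap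
  have hg : ∀ v, LinearMap.det (g v) ≠ 0 := fun v => by
    intro h0
    have h1 := LinearMap.bot_lt_ker_of_det_eq_zero h0
    refine h1.ne' (LinearMap.ker_eq_bot'.2 fun m hm => ?_)
    have hm : i v (u v m).1 + s v (u v m).2 = 0 := hm
    have h2 := congrArg (p v) hm
    rw [map_add, (h.exact v _).2 ⟨_, rfl⟩, hs, zero_add, map_zero] at h2
    rw [h2, map_zero, add_zero] at hm
    have h3 : (u v m).1 = 0 := h.injective v (by rw [hm, map_zero])
    exact (u v).injective (by rw [map_zero]; exact Prod.ext h3 h2)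
  let ζ : ArrowMaps k γ₂ γ₁ := fun a b x => ρ b ∘ₗ (N a b x ∘ₗ s a - s b ∘ₗ L a b x)
  have hζ : ∀ a b x m, i b (ζ a b x m) = N a b x (s a m) - s b (L a b x m) := fun a b x m => by
    refine hρ' b _ ?_
    have := hp a b x (s a m)
    simp only [LinearMap.sub_apply, LinearMap.comp_apply, map_sub]
    rw [← this, hs, hs, sub_self]
  -- Conjugation uses the adjugate instead of the inverse, which multiplies the maps on arrows out
  -- of `a` by `det (g a)`. Scaling the blocks by the inverse determinant restores the given triple.
  let d : Q → k := fun v => (LinearMap.det (g v))⁻¹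
  have hd : ∀ v, LinearMap.det (g v) * d v = 1 := fun v => mul_inv_cancel₀ (hg v)
  refine ⟨(g, fun a b x => d a • A a b x, fun a b x => d a • ζ a b x, fun a b x => d a • L a b x),
    hg, ?_⟩
  refine Prod.ext ?_ (Prod.ext ?_ ?_)
  · funext a b x
    simp [tripleParam, smul_smul, hd]
  · funext a b x
    refine LinearMap.ext fun m => ?_
    have hblock : ∀ n, g b (blockRep u (fun a b x => d a • A a b x) (fun a b x => d a • ζ a b x)
        (fun a b x => d a • L a b x) a b x n) = d a • N a b x (g a n) := by
      intro n
      rw [blockRep_apply]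
      have h1 := hi a b x (u a n).1
      simp only [g, LinearMap.comp_apply, LinearEquiv.coe_coe, LinearEquiv.apply_symm_apply,
        LinearMap.coprod_apply, LinearMap.smul_apply, map_add, map_smul, hζ, h1]
      rw [← smul_add, ← smul_add]
      congr 1
      abel
    change g b (blockRep u _ _ _ a b x (adjEnd (g a) m)) = N a b x m
    rw [hblock, apply_adjEnd_apply, map_smul, smul_smul, mul_comm, hd, one_smul]
  · funext a b x
    simp [tripleParam, smul_smul, hd]

theorem isIrreducible_exactTriples [Infinite k] [Finite Q] [∀ a b : Q, Finite (a ⟶ b)]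
    (h : ∀ v, γ₁ v + γ₂ v = α v) :
    @IsIrreducible _ (zariski k _) (exactTriples k γ₁ α γ₂) := by
  have := Fintype.ofFinite Q
  let u : ∀ v, (Fin (α v) → k) ≃ₗ[k] (Fin (γ₁ v) → k) × (Fin (γ₂ v) → k) := fun v =>
    LinearEquiv.ofFinrankEq _ _ (by simp [h v])
  let Y := VertexMaps k α α × RepSpace k γ₁ × ArrowMaps k γ₂ γ₁ × RepSpace k γ₂
  let := zariski k Y
  let := zariski k (RepSpace k γ₁ × RepSpace k α × RepSpace k γ₂)
  have hδ : IsPoly k fun y : Y => ∏ v, LinearMap.det (y.1 v) :=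
    IsPoly.prod _ fun v => (isPoly_id.fst.apply v).det
  have hY : IsIrreducible (Set.univ ∩ {y : Y | ∏ v, LinearMap.det (y.1 v) ≠ 0}) :=
    isIrreducible_inter_of_isOpen (isIrreducible_univ_zariski k Y).isPreirreducible
      (isOpen_nonzeros (isPoly_iff_mem.1 hδ))
      ⟨(fun _ => LinearMap.id, 0), trivial, by simp⟩
  -- The triples are the polynomial image of a principal open subset of a vector space, hence
  -- irreducible.
  have himage : exactTriples k γ₁ α γ₂ =
      tripleParam u '' (Set.univ ∩ {y : Y | ∏ v, LinearMap.det (y.1 v) ≠ 0}) := by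
    ext t
    constructor
    · intro ht
      obtain ⟨y, hy, rfl⟩ := exists_tripleParam u ht
      exact ⟨y, ⟨trivial, Finset.prod_ne_zero_iff.2 fun v _ => hy v⟩, rfl⟩
    · rintro ⟨y, ⟨-, hy⟩, rfl⟩
      exact tripleParam_mem u fun v => Finset.prod_ne_zero_iff.1 hy v (Finset.mem_univ v)
  rw [himage]
  exact hY.image _ (isPoly_tripleParam u).continuous.continuousOn

/-- The cokernel of an injective homomorphism, in coordinates. -/
theorem exists_cokernel (h : ∀ v, γ₁ v + γ₂ v = α v) {A : RepSpace k γ₁} {N : RepSpace k α}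
    {i : VertexMaps k γ₁ α} (hi : IsHom A N i) (hinj : ∀ v, Function.Injective (i v)) :
    ∃ (L : RepSpace k γ₂) (p : VertexMaps k α γ₂), IsShortExact A N L i p := by
  have hdim : ∀ v, Module.finrank k ((Fin (α v) → k) ⧸ LinearMap.range (i v)) =
      Module.finrank k (Fin (γ₂ v) → k) := fun v => by
    have h1 := (LinearMap.range (i v)).finrank_quotient_add_finrank
    rw [LinearMap.finrank_range_of_inj (hinj v)] at h1
    have h2 := h v
    simp only [Module.finrank_fin_fun] at h1 ⊢
    omega
  have hq := isShortExact_quotRep N (fun v => LinearMap.range (i v)) hi.range_stable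
  have hq' : IsShortExact A N (quotRep N (fun v => LinearMap.range (i v)) hi.range_stable) i
      (fun v => (LinearMap.range (i v)).mkQ) :=
    { hom_left := hi
      hom_right := hq.hom_right
      injective := hinj
      surjective := hq.surjective
      exact := fun v m => by simp }
  exact ⟨_, _, hq'.transport_right fun v => LinearEquiv.ofFinrankEq _ _ (hdim v)⟩

theorem mem_repSub_iff (h : ∀ v, γ₁ v + γ₂ v = α v) (N : RepSpace k α) :
    N ∈ repSub k γ₁ α ↔ ∃ A L, (A, N, L) ∈ exactTriples k γ₁ α γ₂ := by
  constructor
  · rintro ⟨W, hW, hdim⟩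
    have hq := isShortExact_quotRep N W hW
    let e := fun v => LinearEquiv.ofFinrankEq (W v) (Fin (γ₁ v) → k)
      (by rw [hdim, Module.finrank_fin_fun])
    have hA := hq.transport_left e
    obtain ⟨L, p, hL⟩ := exists_cokernel h hA.hom_left hA.injective
    exact ⟨_, L, _, p, hL⟩
  · rintro ⟨A, L, i, p, hex⟩
    exact ⟨fun v => LinearMap.range (i v), fun a b x => hex.hom_left.range_stable a b x, fun v => by
      rw [LinearMap.finrank_range_of_inj (hex.injective v), Module.finrank_fin_fun]⟩

theorem repQuot_eq_repSub (h : ∀ v, γ₁ v + γ₂ v = α v) : repQuot k α γ₂ = repSub k γ₁ α := by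
  ext N
  refine exists_congr fun W => and_congr_right fun _ => forall_congr' fun v => ?_
  have h1 := (W v).finrank_quotient_add_finrank
  have h2 := h v
  simp only [Module.finrank_fin_fun] at h1
  omega

end ExactTriples


/-! ### Open conditions and general representations. -/

section Genericity

variable {k : Type*} [Field k] {Q : Type*} {α β ε : Q → ℕ}

/-- Injectivity of families of linear maps is an open condition. -/
theorem exists_nonzeros_injective [Finite Q] {f₀ : VertexMaps k α β}
    (hf₀ : ∀ v, Function.Injective (f₀ v)) :
    ∃ q ∈ polyFun k (VertexMaps k α β), q f₀ ≠ 0 ∧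
      ∀ f, q f ≠ 0 → ∀ v, Function.Injective (f v) := by
  have := Fintype.ofFinite Q
  have hret : ∀ v, ∃ ρ : (Fin (β v) → k) →ₗ[k] (Fin (α v) → k), ρ ∘ₗ f₀ v = LinearMap.id :=
    fun v => (f₀ v).exists_leftInverse_of_injective (LinearMap.ker_eq_bot.2 (hf₀ v))
  choose ρ hρ using hret
  refine ⟨fun f => ∏ v, LinearMap.det (ρ v ∘ₗ f v), isPoly_iff_mem.1 (IsPoly.prod _ fun v =>
    ((isPoly_const _).linearMap_comp (isPoly_id.apply v)).det), by simp [hρ], fun f hf v => ?_⟩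
  have h1 := Finset.prod_ne_zero_iff.1 hf v (Finset.mem_univ v)
  rw [← LinearMap.ker_eq_bot, LinearMap.ker_eq_bot']
  intro m hm
  have h2 := adjEnd_apply_apply (ρ v ∘ₗ f v) m
  rw [LinearMap.comp_apply, hm, map_zero, map_zero] at h2
  simpa [h1] using h2.symm

variable [Quiver Q]

variable (k α β) in
/-- The differential `diff`, as a linear function of the pair of representations. -/
def diffLin : (RepSpace k α × RepSpace k β) →ₗ[k] VertexMaps k α β →ₗ[k] ArrowMaps k α β where
  toFun p := diff p.1 p.2
  map_add' p q := by
    refine LinearMap.ext fun f => ?_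
    funext a b x
    refine LinearMap.ext fun m => ?_
    simp [diff]
    abel
  map_smul' c p := by
    refine LinearMap.ext fun f => ?_
    funext a b x
    refine LinearMap.ext fun m => ?_
    simp [diff, smul_sub]

variable (k α β) in
theorem isPoly_diff : IsPoly k fun p : RepSpace k α × RepSpace k β => diff p.1 p.2 :=
  isPoly_linear (V := RepSpace k α × RepSpace k β)
    (W := VertexMaps k α β →ₗ[k] ArrowMaps k α β) (diffLin k α β)

theorem HomZero.of_iso_left {V W X : Q → Type*}
    [∀ v, AddCommGroup (V v)] [∀ v, Module k (V v)]
    [∀ v, AddCommGroup (W v)] [∀ v, Module k (W v)]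
    [∀ v, AddCommGroup (X v)] [∀ v, Module k (X v)]
    {E : ArrowFamily k V V} {A : ArrowFamily k W W} {L : ArrowFamily k X X}
    (h : HomZero A L) {e : ∀ v, V v ≃ₗ[k] W v} (he : IsHom E A fun v => (e v).toLinearMap) :
    HomZero E L := fun f hf v m => by
  have := h _ (hf.comp he.symm) v (e v m)
  simpa using this

variable [Fintype Q]

theorem homDim_pos_of_injective {A : RepSpace k α} {N : RepSpace k β} {i : VertexMaps k α β}
    (hi : IsHom A N i) (hinj : ∀ v, Function.Injective (i v)) (h : homDim A A ≠ 0) :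
    0 < homDim A N := by
  rw [Nat.pos_iff_ne_zero]
  intro h0
  rw [homDim_eq_zero_iff] at h0
  refine h ((homDim_eq_zero_iff _ _).2 fun f _ v m => hinj v ?_)
  rw [h0 i hi, map_zero]

/-- As `Hom(E, L) = 0`, every homomorphism `E → M` factors through `i`, and the endomorphisms of `E`
are scalars. -/
theorem homDim_eq_one_of_isShortExact {E : RepSpace k ε} (hE : homDim E E = 1) {M : RepSpace k α}
    {L : RepSpace k β} {i : VertexMaps k ε α} {p : VertexMaps k α β}
    (h : IsShortExact E M L i p) (hL : HomZero E L) : homDim E M = 1 := by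
  have hpos := homDim_pos_of_injective h.hom_left h.injective (by rw [hE]; exact one_ne_zero)
  refine (finrank_submodule_eq_one_iff _).2 ⟨i, (mem_homSpace_iff _ _ _).2 h.hom_left, ?_, ?_⟩
  · rintro rfl
    have hz : HomZero E E := fun f _ v m => h.injective v rfl
    rw [(homDim_eq_zero_iff _ _).2 hz] at hE
    exact zero_ne_one hE
  · intro f hf
    obtain ⟨g, hg, hfg⟩ := h.exists_factor ((mem_homSpace_iff _ _ _).1 hf)
      fun v m => hL _ (h.hom_right.comp ((mem_homSpace_iff _ _ _).1 hf)) v m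
    obtain ⟨c, hc⟩ := isBrick_of_homDim_eq_one hE g hg
    refine ⟨c, ?_⟩
    funext v
    refine LinearMap.ext fun m => ?_
    rw [hfg, hc, map_smul]
    rfl

theorem exists_direct_sum {E : RepSpace k ε} (hE : homDim E E = 1) {L : RepSpace k β}
    (h : ∀ v, ε v + β v = α v) (hL : HomZero E L) :
    ∃ (M : RepSpace k α) (i : VertexMaps k ε α) (p : VertexMaps k α β),
      IsShortExact E M L i p ∧ homDim E M = 1 := by
  have hM := (isShortExact_sumRep E L).transport fun v =>
    LinearEquiv.ofFinrankEq _ (Fin (α v) → k) (by simp [Module.finrank_prod, h v])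
  exact ⟨_, _, _, hM, homDim_eq_one_of_isShortExact hE hM hL⟩

variable [∀ a b : Q, Fintype (a ⟶ b)]

/-- The vanishing of `Hom` is an open condition. -/
theorem exists_nonzeros_homDim_eq_zero {p₀ : RepSpace k α × RepSpace k β}
    (h : homDim p₀.1 p₀.2 = 0) :
    ∃ q ∈ polyFun k (RepSpace k α × RepSpace k β), q p₀ ≠ 0 ∧
      ∀ p, q p ≠ 0 → homDim p.1 p.2 = 0 := by
  obtain ⟨q, hq, s, -, hq₀, -, H⟩ :=
    exists_kernel_section (isPoly_diff k α β) p₀ (f₀ := 0)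
      (LinearMap.map_zero (diff p₀.1 p₀.2))
  exact ⟨q, hq, hq₀, fun p hp => Nat.le_zero.1 (((H p hp).1).trans_eq h)⟩

/-- Near a pair with a one-dimensional space of homomorphisms spanned by an injective one, every
pair with a non-zero homomorphism has these properties. -/
theorem exists_nonzeros_injective_hom {p₀ : RepSpace k α × RepSpace k β}
    (h : homDim p₀.1 p₀.2 = 1) {f₀ : VertexMaps k α β} (hf₀ : IsHom p₀.1 p₀.2 f₀)
    (hinj : ∀ v, Function.Injective (f₀ v)) :
    ∃ q ∈ polyFun k (RepSpace k α × RepSpace k β), q p₀ ≠ 0 ∧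
      ∀ p, q p ≠ 0 → 0 < homDim p.1 p.2 → homDim p.1 p.2 = 1 ∧
        ∃ f : VertexMaps k α β, IsHom p.1 p.2 f ∧ ∀ v, Function.Injective (f v) := by
  obtain ⟨q, hq, s, hs, hq₀, hs₀, H⟩ :=
    exists_kernel_section (isPoly_diff k α β) p₀ (f₀ := f₀)
      ((mem_homSpace_iff _ _ _).2 hf₀)
  obtain ⟨q', hq', hq'₀, H'⟩ := exists_nonzeros_injective hinj
  refine ⟨q * fun p => q' (s p), mul_mem hq (hs.comp_mem hq'), ?_, fun p hp hpos => ?_⟩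
  · rw [Pi.mul_apply, hs₀]
    exact mul_ne_zero hq₀ hq'₀
  · have hle : homDim p.1 p.2 ≤ homDim p₀.1 p₀.2 := (H p (left_ne_zero_of_mul hp)).1
    have heq : homDim p.1 p.2 = 1 := by omega
    refine ⟨heq, s p, (mem_homSpace_iff _ _ _).1 ?_, H' _ (right_ne_zero_of_mul hp)⟩
    exact (H p (left_ne_zero_of_mul hp)).2 (heq.trans h.symm)

/-- The orbit of an exceptional representation contains an open neighbourhood of it. -/
theorem exists_nonzeros_iso {E : RepSpace k ε} (hE : IsExceptional E) :
    ∃ q ∈ polyFun k (RepSpace k ε), q E ≠ 0 ∧ ∀ A, q A ≠ 0 →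
      ∃ e : ∀ v, (Fin (ε v) → k) ≃ₗ[k] (Fin (ε v) → k), IsHom E A fun v => (e v).toLinearMap := by
  obtain ⟨q, hq, hq₀, H⟩ := exists_nonzeros_injective_hom (p₀ := (E, E)) hE.1
    (f₀ := fun _ => LinearMap.id) (fun a b x m => rfl) fun v => Function.injective_id
  have hpoly : IsPoly k fun A : RepSpace k ε => (E, A) := (isPoly_const E).prodMk isPoly_id
  refine ⟨fun A => q (E, A), hpoly.comp_mem hq, hq₀, fun A hA => ?_⟩
  have h1 := homDim_sub_extDim E E
  have h2 := homDim_sub_extDim E A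
  rw [hE.1, hE.2] at h1
  -- Since `⟨ε, ε⟩ = 1`, there is always a non-zero homomorphism `E → A`; near `E` some homomorphism
  -- is injective, and equal dimensions make it an isomorphism.
  obtain ⟨-, f, hf, hinj⟩ := H (E, A) hA (by
    change 0 < homDim E A
    omega)
  exact ⟨fun v => LinearEquiv.ofInjectiveEndo (f v) (hinj v), hf⟩

theorem eulerForm_self {E : RepSpace k ε} (hE : IsExceptional E) : eulerForm ε ε = 1 := by
  have h1 := homDim_sub_extDim E E
  rw [hE.1, hE.2] at h1
  omega

theorem eulerForm_of_leftOrthogonal {E : RepSpace k ε} (h : LeftOrthogonal E α) :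
    eulerForm ε α = 0 := by
  obtain ⟨M, h1, h2⟩ := h
  have := homDim_sub_extDim E M
  rw [h1, h2] at this
  omega

/-- A general first component is isomorphic to `E`. The non-zero polynomials expressing this and the
vanishing of `Hom` have a common point of non-vanishing. -/
theorem GeneralHomEq.exists_homZero [IsAlgClosed k] {E : RepSpace k ε} (hE : IsExceptional E)
    (h : GeneralHomEq k ε β 0) : ∃ L : RepSpace k β, HomZero E L := by
  obtain ⟨U, -, ⟨p₀, -, hp₀⟩, hU⟩ := h
  obtain ⟨q, hq, hq₀, H⟩ := exists_nonzeros_homDim_eq_zero (hU p₀ ⟨trivial, hp₀⟩)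
  obtain ⟨q', hq', hq'₀, H'⟩ := exists_nonzeros_iso hE
  let q'' : RepSpace k ε × RepSpace k β → k := fun p => q' p.1
  have hq'' : q'' ∈ polyFun k (RepSpace k ε × RepSpace k β) := isPoly_id.fst.comp_mem hq'
  obtain ⟨⟨A, L⟩, hAL⟩ : ∃ p, q p * q'' p ≠ 0 := by
    by_contra! hcon
    rcases polyFun_mul_eq_zero hq hq'' (funext hcon) with rfl | h0
    · exact hq₀ rfl
    · exact hq'₀ (congrFun h0 (E, 0))
  obtain ⟨e, he⟩ := H' A (right_ne_zero_of_mul hAL)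
  have h1 : HomZero A L := (homDim_eq_zero_iff _ _).1 (H (A, L) (left_ne_zero_of_mul hAL))
  exact ⟨L, h1.of_iso_left he⟩

theorem generalHomEq_zero {A : RepSpace k α} {L : RepSpace k β} (h : HomZero A L) :
    GeneralHomEq k α β 0 := by
  obtain ⟨q, hq, hq₀, H⟩ := exists_nonzeros_homDim_eq_zero (p₀ := (A, L))
    ((homDim_eq_zero_iff _ _).2 h)
  exact ⟨_, isOpen_nonzeros hq, ⟨_, trivial, hq₀⟩, fun p hp => H p hp.2⟩

theorem generalExtEq_one_iff (h : eulerForm α β = -1) :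
    GeneralExtEq k α β 1 ↔ GeneralHomEq k α β 0 := by
  have key : ∀ p : RepSpace k α × RepSpace k β, extDim p.1 p.2 = 1 ↔ homDim p.1 p.2 = 0 :=
    fun p => by
      have := homDim_sub_extDim p.1 p.2
      omega
  simp only [GeneralExtEq, GeneralHomEq, key]

/-- The locus of pairs with a non-zero homomorphism is a hypersurface if `⟨α, β⟩ = 0`. -/
theorem exists_homLocus_eq (h : eulerForm α β = 0) :
    ∃ d ∈ polyFun k (RepSpace k α × RepSpace k β), homLocus k α β = {p | d p = 0} := by
  have hdim : Module.finrank k (ArrowMaps k α β) = Module.finrank k (VertexMaps k α β) := by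
    have h1 := finrank_vertexMaps (k := k) (α := α) (β := β)
    have h2 := finrank_arrowMaps (k := k) (α := α) (β := β)
    rw [eulerForm, ← h1, ← h2] at h
    omega
  let θ := LinearEquiv.ofFinrankEq _ _ hdim
  -- Both terms of the complex have the same dimension, so identifying them by `θ` turns the
  -- differential into a square matrix.
  refine ⟨fun p => LinearMap.det (θ.toLinearMap ∘ₗ diffLin k α β p), isPoly_iff_mem.1
    ((isPoly_const _).linearMap_comp (isPoly_linear _)).det, ?_⟩
  ext p
  change 0 < homDim p.1 p.2 ↔ LinearMap.det (θ.toLinearMap ∘ₗ diff p.1 p.2) = 0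
  have hker : LinearMap.ker (θ.toLinearMap ∘ₗ diff p.1 p.2) = homSpace p.1 p.2 :=
    LinearEquiv.ker_comp _ _
  constructor
  · intro hpos
    by_contra hne
    have h1 : LinearMap.ker (θ.toLinearMap ∘ₗ diff p.1 p.2) = ⊥ :=
      LinearMap.ker_eq_bot'.2 fun m hm => by
        have := adjEnd_apply_apply (θ.toLinearMap ∘ₗ diff p.1 p.2) m
        rw [hm, map_zero] at this
        simpa [hne] using this.symm
    rw [homDim, ← hker, h1, finrank_bot] at hpos
    exact lt_irrefl _ hpos
  · intro h0
    have h1 := LinearMap.bot_lt_ker_of_det_eq_zero h0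
    rw [hker] at h1
    rw [Nat.pos_iff_ne_zero]
    exact fun h2 => h1.ne' (Submodule.finrank_eq_zero.1 h2)

end Genericity

/-! ### The fundamental rank `ε` and the vanishing of Hom. -/

section FundamentalRank

variable {k : Type*} [Field k] [IsAlgClosed k] {Q : Type*} [Quiver Q] [Fintype Q]
  [∀ a b : Q, Fintype (a ⟶ b)] {α β ε : Q → ℕ}

/-- Around `(E, E ⊕ L)` every non-zero Hom space is a line spanned by an injective map. There the
hypersurface is the irreducible set of pairs underlying exact triples. -/
theorem isFundamentalRank_of_homZero {E : RepSpace k ε} (hE : IsExceptional E)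
    (h0 : eulerForm ε α = 0) (hεα : ∀ v, ε v + β v = α v) {L : RepSpace k β} (hL : HomZero E L) :
    IsFundamentalRank k ε α ε := by
  let := zariski k (RepSpace k ε × RepSpace k α)
  obtain ⟨M, i, p, hex, h1⟩ := exists_direct_sum hE.1 hεα hL
  obtain ⟨q, hq, hq₀, H⟩ := exists_nonzeros_injective_hom (p₀ := (E, M)) h1 hex.hom_left
    hex.injective
  obtain ⟨d, hd, hlocus⟩ := exists_homLocus_eq (k := k) h0
  have hclosed : IsClosed (homLocus k ε α) := by
    rw [hlocus]
    exact isClosed_zeros hd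
  let O : Set (RepSpace k ε × RepSpace k α) := {p | q p ≠ 0}
  have hO : IsOpen O := isOpen_nonzeros hq
  let J : Set (RepSpace k ε × RepSpace k α) :=
    (fun t : RepSpace k ε × RepSpace k α × RepSpace k β => (t.1, t.2.1)) '' exactTriples k ε α β
  have hJ : IsIrreducible J := by
    let := zariski k (RepSpace k ε × RepSpace k α × RepSpace k β)
    exact (isIrreducible_exactTriples hεα).image _
      (isPoly_id.fst.prodMk isPoly_id.snd.fst).continuous.continuousOn
  have hinter : homLocus k ε α ∩ O = J ∩ O := by
    ext p
    refine and_congr_left fun hp => ?_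
    constructor
    · intro hpos
      obtain ⟨-, f, hf, hinj⟩ := H p hp hpos
      obtain ⟨L, π, hL⟩ := exists_cokernel hεα hf hinj
      exact ⟨(p.1, p.2, L), ⟨f, π, hL⟩, rfl⟩
    · rintro ⟨⟨A, N, L⟩, ⟨f, π, hex⟩, rfl⟩
      have h2 := homDim_sub_extDim A A
      rw [eulerForm_self hE] at h2
      exact homDim_pos_of_injective (A := A) (N := N) hex.hom_left hex.injective (by omega)
  have hne : (homLocus k ε α ∩ O).Nonempty := ⟨(E, M), by
    change 0 < homDim E M
    omega, hq₀⟩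
  have hirr : IsIrreducible (homLocus k ε α ∩ O) := by
    rw [hinter] at hne ⊢
    exact isIrreducible_inter_of_isOpen hJ.isPreirreducible hO hne
  refine ⟨h0, closure (homLocus k ε α ∩ O), ⟨⟨closure_minimal Set.inter_subset_left hclosed,
    hirr.closure⟩, ?_⟩, O, hO, ?_, ?_⟩
  -- A larger irreducible subset of the hypersurface meets `O` in a dense subset, and that subset
  -- already lies in `homLocus k ε α ∩ O`.
  · rintro S ⟨hS, hSirr⟩ hle
    obtain ⟨x, hx⟩ := hne
    refine (subset_closure_inter_of_isIrreducible hSirr.isPreirreducible hO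
      ⟨x, hle (subset_closure hx), hx.2⟩).trans (closure_mono ?_)
    exact Set.inter_subset_inter_left _ hS
  · obtain ⟨x, hx⟩ := hne
    exact ⟨x, subset_closure hx, hx.2⟩
  · rintro y ⟨hy, hyO⟩
    have hpos : 0 < homDim y.1 y.2 := closure_minimal Set.inter_subset_left hclosed hy
    obtain ⟨-, f, hf, hinj⟩ := H y hyO hpos
    obtain ⟨q', hq', hq'₀, H'⟩ := exists_nonzeros_injective hinj
    refine ⟨_, isOpen_nonzeros hq', ⟨f, (mem_homSpace_iff _ _ _).2 hf, hq'₀⟩, ?_⟩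
    rintro g ⟨-, hg⟩ v
    rw [LinearMap.finrank_range_of_inj (H' g hg v), Module.finrank_fin_fun]

/-- The dimension of `Ext(A, L)`, for `L` the cokernel of a general embedding, is bounded by the
codimension of the component, which is one. The representation `A` need not be `E`: any pair with
vanishing Hom suffices. -/
theorem IsFundamentalRank.exists_homZero {E : RepSpace k ε} (hE : IsExceptional E)
    (hα : LeftOrthogonal E α) (h : IsFundamentalRank k ε α ε) :
    ε ≤ α ∧ ∃ (A : RepSpace k ε) (L : RepSpace k (α - ε)), HomZero A L := by
  obtain ⟨h0, C, hC, U, hU, hne, hgen⟩ := h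
  obtain ⟨d, hd, hlocus⟩ := exists_homLocus_eq (k := k) h0
  rw [hlocus] at hC
  -- An object of `E^⊥` of dimension `α` keeps the determinant from vanishing identically.
  have hd0 : d ≠ 0 := by
    rintro rfl
    obtain ⟨M, hM, -⟩ := hα
    have : (E, M) ∈ homLocus k ε α := by rw [hlocus]; rfl
    exact (Nat.pos_iff_ne_zero.1 this) hM
  obtain ⟨y₀, hy₀, hmin⟩ : ∃ y₀ ∈ C ∩ U, ∀ y ∈ C ∩ U, homDim y₀.1 y₀.2 ≤ homDim y.1 y.2 := by
    obtain ⟨y₀, hy₀, h⟩ := (measure fun y : RepSpace k ε × RepSpace k α =>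
      homDim y.1 y.2).wf.has_min _ hne
    exact ⟨y₀, hy₀, fun y hy => not_lt.1 (h y hy)⟩
  obtain ⟨f₀, hf₀, hinj⟩ : ∃ f₀ : VertexMaps k ε α, IsHom y₀.1 y₀.2 f₀ ∧
      ∀ v, Function.Injective (f₀ v) := by
    obtain ⟨O, -, ⟨f, hf, hfO⟩, hrank⟩ := hgen y₀ hy₀
    refine ⟨f, (mem_homSpace_iff _ _ _).1 hf, fun v => ?_⟩
    have h1 := LinearMap.finrank_range_add_finrank_ker (f v)
    rw [hrank f ⟨hf, hfO⟩ v, Module.finrank_fin_fun] at h1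
    rw [← LinearMap.ker_eq_bot, ← Submodule.finrank_eq_zero (R := k)]
    omega
  have hεα : ε ≤ α := fun v => by
    simpa using LinearMap.finrank_le_finrank_of_injective (hinj v)
  refine ⟨hεα, ?_⟩
  obtain ⟨w₀, hw₀⟩ := exists_line_of_minimal_kernel (diffLin k ε α) hd hd0 hC hU hy₀ hmin
    (f₀ := f₀) ((mem_homSpace_iff _ _ _).2 hf₀)
  obtain ⟨L, p, hex⟩ := exists_cokernel (γ₂ := α - ε)
    (fun v => Nat.add_sub_cancel' (hεα v)) hf₀ hinj
  refine ⟨y₀.1, L, (homDim_eq_zero_iff _ _).1 ?_⟩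
  have hext : extDim y₀.1 L ≤ 1 := by
    refine finrank_le_one (Submodule.Quotient.mk fun a b x => p b ∘ₗ w₀ a b x) fun η => ?_
    obtain ⟨η, rfl⟩ := Submodule.Quotient.mk_surjective _ η
    have hlift : ∀ a b (x : a ⟶ b), ∃ N' : (Fin (α a) → k) →ₗ[k] (Fin (α b) → k),
        ∀ m, p b (N' (f₀ a m)) = η a b x m := by
      intro a b x
      obtain ⟨s, hs⟩ := (p b).exists_rightInverse_of_surjective
        (LinearMap.range_eq_top.2 (hex.surjective b))
      obtain ⟨ρ, hρ⟩ := (f₀ a).exists_leftInverse_of_injective (LinearMap.ker_eq_bot.2 (hinj a))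
      refine ⟨s ∘ₗ η a b x ∘ₗ ρ, fun m => ?_⟩
      have h1 : ρ (f₀ a m) = m := LinearMap.congr_fun hρ m
      simp only [LinearMap.comp_apply, h1]
      exact LinearMap.congr_fun hs _
    choose N' hN' using hlift
    -- Only the second representation is varied, in a direction `N'` with `p N' f₀ = η`. Applying
    -- `p` to the first-order equation writes the class of `η` as a multiple of the fixed class of
    -- `p w₀`.
    obtain ⟨f, c, hfc⟩ := hw₀ (0, N')
    refine ⟨c, ?_⟩
    rw [← Submodule.Quotient.mk_smul, ← sub_eq_zero, ← Submodule.Quotient.mk_sub,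
      Submodule.Quotient.mk_eq_zero]
    refine ⟨fun v => -(p v ∘ₗ f v), ?_⟩
    funext a b x
    refine LinearMap.ext fun m => ?_
    have h1 : N' a b x (f₀ a m) - f₀ b 0 =
        y₀.2 a b x (f a m) - f b (y₀.1 a b x m) + c • w₀ a b x m :=
      LinearMap.congr_fun (congrFun (congrFun (congrFun hfc a) b) x) m
    have h2 := congrArg (p b) h1
    have h3 := hex.hom_right a b x (f a m)
    simp only [map_zero, sub_zero, map_add, map_sub, map_smul, hN', ← h3] at h2
    change L a b x (-(p a (f a m))) - -(p b (f b (y₀.1 a b x m))) =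
      c • p b (w₀ a b x m) - η a b x m
    rw [h2, map_neg]
    abel
  have h1 := homDim_sub_extDim y₀.1 L
  rw [eulerForm_sub hεα, h0, eulerForm_self hE] at h1
  omega

end FundamentalRank

/-! ### The closures of the exceptional set and of its projections. -/

section Closures

variable {k : Type*} [Field k] {Q : Type*} [Quiver Q] [Fintype Q]
  [∀ a b : Q, Fintype (a ⟶ b)] {α β ε : Q → ℕ}

theorem exceptionalSet_subset_repSub {E : RepSpace k ε} (hE : IsExceptional E)
    (h0 : eulerForm ε α = 0) : exceptionalSet E α ⊆ repSub k ε α := by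
  intro M hM
  obtain ⟨i, hi, hinj⟩ := exists_injective_of_mem_exceptionalSet
    (isBrick_of_homDim_eq_one hE.1) ((extDim_eq_zero_iff _ _).1 hE.2) h0 hM
  exact ⟨fun v => LinearMap.range (i v), fun a b x => hi.range_stable a b x, fun v => by
    rw [LinearMap.finrank_range_of_inj (hinj v), Module.finrank_fin_fun]⟩

/-- The exceptional set contains a non-empty open subset of the representations with a subobject of
dimension vector `ε`, on which `hom(E, -) = 1`. -/
theorem exists_isOpen_inter_repSub {E : RepSpace k ε} (hE : IsExceptional E)
    (h0 : eulerForm ε α = 0) (hεα : ∀ v, ε v + β v = α v) {L : RepSpace k β} (hL : HomZero E L) :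
    ∃ O : Set (RepSpace k α), IsOpen[zariski k _] O ∧ (repSub k ε α ∩ O).Nonempty ∧
      ∀ M ∈ repSub k ε α ∩ O, M ∈ exceptionalSet E α ∧ homDim E M = 1 := by
  obtain ⟨M, i, p, hex, h1⟩ := exists_direct_sum hE.1 hεα hL
  obtain ⟨q, hq, hq₀, H⟩ := exists_nonzeros_injective_hom (p₀ := (E, M)) h1 hex.hom_left
    hex.injective
  have hpoly : IsPoly k fun N : RepSpace k α => (E, N) := (isPoly_const E).prodMk isPoly_id
  refine ⟨{N | q (E, N) ≠ 0}, isOpen_nonzeros (hpoly.comp_mem hq),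
    ⟨M, (mem_repSub_iff hεα M).2 ⟨E, L, i, p, hex⟩, hq₀⟩, ?_⟩
  rintro N ⟨hN, hNq⟩
  obtain ⟨A, L', j, p', hex'⟩ := (mem_repSub_iff hεα N).1 hN
  -- A subrepresentation `A` of dimension `ε` need not be `E`, but `⟨ε, ε⟩ = 1` forces a non-zero
  -- homomorphism `E → A`, hence one to `N`.
  have hpos : 0 < homDim E N := by
    rw [Nat.pos_iff_ne_zero]
    intro hN0
    have h2 := (homDim_eq_zero_iff E A).2 (hex'.homZero_left ((homDim_eq_zero_iff E N).1 hN0))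
    have h3 := homDim_sub_extDim E A
    rw [eulerForm_self hE] at h3
    omega
  obtain ⟨h2, f, hf, hinj⟩ := H (E, N) hNq hpos
  exact ⟨mem_exceptionalSet_of_injective (isBrick_of_homDim_eq_one hE.1)
    ((extDim_eq_zero_iff _ _).1 hE.2) h0 h2 hf hinj, h2⟩

variable [IsAlgClosed k]

theorem isIrreducible_repSub (hεα : ∀ v, ε v + β v = α v) :
    @IsIrreducible _ (zariski k _) (repSub k ε α) := by
  let := zariski k (RepSpace k α)
  let := zariski k (RepSpace k ε × RepSpace k α × RepSpace k β)
  have himage : repSub k ε α = (fun t : RepSpace k ε × RepSpace k α × RepSpace k β => t.2.1) ''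
      exactTriples k ε α β := by
    ext N
    rw [mem_repSub_iff hεα]
    constructor
    · rintro ⟨A, L, h⟩
      exact ⟨_, h, rfl⟩
    · rintro ⟨⟨A, N, L⟩, h, rfl⟩
      exact ⟨A, L, h⟩
  rw [himage]
  exact (isIrreducible_exactTriples hεα).image _ isPoly_id.snd.fst.continuous.continuousOn

theorem closure_exceptionalSet {E : RepSpace k ε} (hE : IsExceptional E)
    (h0 : eulerForm ε α = 0) (hεα : ∀ v, ε v + β v = α v) {L : RepSpace k β} (hL : HomZero E L) :
    closure[zariski k _] (exceptionalSet E α) = repSub k ε α := by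
  let := zariski k (RepSpace k α)
  obtain ⟨O, hO, hne, hsub⟩ := exists_isOpen_inter_repSub hE h0 hεα hL
  refine Set.Subset.antisymm
    (closure_minimal (exceptionalSet_subset_repSub hE h0) isClosed_repSub) ?_
  exact (subset_closure_inter_of_isIrreducible (isIrreducible_repSub hεα).isPreirreducible hO
    hne).trans (closure_mono fun M hM => (hsub M hM).1)

/-- A non-split extension of `E` by `L` has no homomorphism from `E`. So in the irreducible set of
exact triples, having no homomorphism from `E` and having third term isomorphic to `E` hold on a
dense part, where the middle terms are values of the projection. -/
theorem closure_projectionOrbits {E : RepSpace k ε} (hE : IsExceptional E)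
    (h0 : eulerForm ε α = 0) (hεα : ∀ v, β v + ε v = α v) {L : RepSpace k β} (hL : HomZero E L)
    (hLext : extDim E L = 1) :
    closure[zariski k _] (projectionOrbits E (exceptionalSet E α)) = repQuot k α ε := by
  let := zariski k (RepSpace k α)
  let := zariski k (RepSpace k β × RepSpace k α × RepSpace k ε)
  have hbrick := isBrick_of_homDim_eq_one hE.1
  have hrigid := (extDim_eq_zero_iff _ _).1 hE.2
  refine Set.Subset.antisymm (closure_minimal ?_ ?_) ?_
  · intro N hN
    obtain ⟨p, hp, hsurj⟩ := exists_surjective_of_mem_projectionOrbits hbrick hrigid h0 hN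
    refine ⟨fun v => LinearMap.ker (p v), fun a b x => hp.ker_stable a b x, fun v => ?_⟩
    rw [((p v).quotKerEquivOfSurjective (hsurj v)).finrank_eq, Module.finrank_fin_fun]
  · rw [repQuot_eq_repSub hεα]
    exact isClosed_repSub
  · obtain ⟨ξ, hξ⟩ : ∃ ξ : Fin 1 → ArrowMaps k ε β, ClassesIndependent E L ξ := by
      rw [← hLext]
      obtain ⟨ξ, hξ, -⟩ := exists_ext_basis E L
      exact ⟨ξ, hξ⟩
    let e : ∀ v, ((Fin (β v) → k) × (Fin 1 → Fin (ε v) → k)) ≃ₗ[k] (Fin (α v) → k) :=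
      fun v => LinearEquiv.ofFinrankEq _ _ (by simp [Module.finrank_prod, Module.finrank_pi_fintype, hεα v])
    have hN₁ := (isShortExact_extRep L E ξ).transport e
    have hN₁0 := (homZero_extRep hbrick hL hξ).of_iso (isHom_transport _ e)
    obtain ⟨q, hq, hq₀, H⟩ := exists_nonzeros_homDim_eq_zero
      (p₀ := (E, transport (extRep L E ξ) e)) ((homDim_eq_zero_iff _ _).2 hN₁0)
    obtain ⟨q', hq', hq'₀, H'⟩ := exists_nonzeros_iso hE
    have hpoly : IsPoly k fun t : RepSpace k β × RepSpace k α × RepSpace k ε => (E, t.2.1) :=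
      (isPoly_const E).prodMk isPoly_id.snd.fst
    let O : Set (RepSpace k β × RepSpace k α × RepSpace k ε) :=
      {t | q (E, t.2.1) * q' t.2.2 ≠ 0}
    have hO : IsOpen O :=
      isOpen_nonzeros (mul_mem (hpoly.comp_mem hq) (isPoly_id.snd.snd.comp_mem hq'))
    have hdense := subset_closure_inter_of_isIrreducible
      (isIrreducible_exactTriples (k := k) hεα).isPreirreducible hO
      ⟨(L, transport (extRep L E ξ) e, E), ⟨_, _, hN₁⟩, mul_ne_zero hq₀ hq'₀⟩
    have hcont : Continuous fun t : RepSpace k β × RepSpace k α × RepSpace k ε => t.2.1 :=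
      isPoly_id.snd.fst.continuous
    intro N hN
    rw [repQuot_eq_repSub hεα, mem_repSub_iff hεα] at hN
    obtain ⟨L', A, hT⟩ := hN
    -- The map to the middle term is continuous, so density among triples passes to density among
    -- middle terms.
    refine closure_mono ?_ (image_closure_subset_closure_image hcont ⟨_, hdense hT, rfl⟩)
    rintro _ ⟨⟨L', N, A⟩, ⟨⟨i, p, hex⟩, hO'⟩, rfl⟩
    obtain ⟨e', he'⟩ := H' A (right_ne_zero_of_mul hO')
    exact mem_projectionOrbits_of_surjective hE.1 h0 (H (E, N) (left_ne_zero_of_mul hO'))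
      (he'.symm.comp hex.hom_right) fun v => (e' v).symm.surjective.comp (hex.surjective v)

end Closures

end QuiverRep

/-! ### The equivalences and the closure statements. -/

theorem corollary3 {k : Type*} [Field k] [IsAlgClosed k] [CharZero k]
    {Q : Type*} [Quiver Q] [Fintype Q] [∀ a b : Q, Fintype (a ⟶ b)]
    (hQ : QuiverRep.NoOrientedCycles Q)
    {ε : Q → ℕ} (E : QuiverRep.RepSpace k ε) (hE : QuiverRep.IsExceptional E)
    (α : Q → ℕ) (hα : QuiverRep.LeftOrthogonal E α) :
    List.TFAE [
      QuiverRep.LeftExceptional E α,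
      QuiverRep.IsFundamentalRank k ε α ε,
      ε ≤ α ∧ QuiverRep.GeneralExtEq k ε (α - ε) 1,
      ε ≤ α ∧ QuiverRep.GeneralHomEq k ε (α - ε) 0] ∧
    (QuiverRep.LeftExceptional E α →
      @IsIrreducible _ (QuiverRep.zariski k _) (QuiverRep.exceptionalSet E α) ∧
      QuiverRep.Generically k (QuiverRep.exceptionalSet E α)
        (fun M => QuiverRep.homDim E M = 1) ∧
      closure[QuiverRep.zariski k _] (QuiverRep.exceptionalSet E α) = QuiverRep.repSub k ε α ∧
      closure[QuiverRep.zariski k _]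
          (QuiverRep.projectionOrbits E (QuiverRep.exceptionalSet E α)) =
        QuiverRep.repQuot k α ε) := by
  have hbrick := QuiverRep.isBrick_of_homDim_eq_one hE.1
  have hrigid := (QuiverRep.extDim_eq_zero_iff _ _).1 hE.2
  have h0 := QuiverRep.eulerForm_of_leftOrthogonal hα
  have heul : ε ≤ α → QuiverRep.eulerForm ε (α - ε) = -1 := fun h => by
    rw [QuiverRep.eulerForm_sub h, h0, QuiverRep.eulerForm_self hE, zero_sub]
  have hsum : ε ≤ α → ∀ v, ε v + (α - ε) v = α v := fun h v => Nat.add_sub_cancel' (h v)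
  constructor
  · tfae_have 1 → 4 := by
      rintro ⟨-, M, hM⟩
      obtain ⟨hεα, L, hL⟩ := QuiverRep.exists_homZero_of_mem_exceptionalSet hbrick hrigid h0 hM
      exact ⟨hεα, QuiverRep.generalHomEq_zero hL⟩
    tfae_have 4 → 1 := by
      rintro ⟨hεα, h⟩
      obtain ⟨L, hL⟩ := h.exists_homZero hE
      obtain ⟨M, i, p, hex, h1⟩ := QuiverRep.exists_direct_sum hE.1 (hsum hεα) hL
      exact ⟨hα, M, QuiverRep.mem_exceptionalSet_of_injective hbrick hrigid h0 h1 hex.hom_left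
        hex.injective⟩
    tfae_have 3 ↔ 4 :=
      and_congr_right fun hεα => QuiverRep.generalExtEq_one_iff (heul hεα)
    tfae_have 4 → 2 := by
      rintro ⟨hεα, h⟩
      obtain ⟨L, hL⟩ := h.exists_homZero hE
      exact QuiverRep.isFundamentalRank_of_homZero hE h0 (hsum hεα) hL
    tfae_have 2 → 4 := by
      intro h
      obtain ⟨hεα, A, L, hL⟩ := h.exists_homZero hE hα
      exact ⟨hεα, QuiverRep.generalHomEq_zero hL⟩
    tfae_finish
  · rintro ⟨-, M, hM⟩
    obtain ⟨hεα, L, hL⟩ := QuiverRep.exists_homZero_of_mem_exceptionalSet hbrick hrigid h0 hM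
    have hcl := QuiverRep.closure_exceptionalSet hE h0 (hsum hεα) hL
    obtain ⟨O, hO, ⟨N, hN⟩, hsub⟩ := QuiverRep.exists_isOpen_inter_repSub hE h0 (hsum hεα) hL
    refine ⟨?_, ⟨O, hO, ⟨N, (hsub N hN).1, hN.2⟩, ?_⟩, hcl, ?_⟩
    · let := QuiverRep.zariski k (QuiverRep.RepSpace k α)
      -- Irreducibility may be tested on the closure, which is an image of the exact triples.
      rw [← isIrreducible_iff_closure, hcl]
      exact QuiverRep.isIrreducible_repSub (hsum hεα)
    · rintro N ⟨hN, hNO⟩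
      exact (hsub N ⟨QuiverRep.exceptionalSet_subset_repSub hE h0 hN, hNO⟩).2
    · have h1 := QuiverRep.homDim_sub_extDim E L
      rw [heul hεα, (QuiverRep.homDim_eq_zero_iff _ _).2 hL] at h1
      exact QuiverRep.closure_projectionOrbits hE h0
        (fun v => Nat.sub_add_cancel (hεα v)) hL (by omega)
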